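/- Let $k$ be a field of characteristic $0$, let $\mathrm{GL}=\bigcup_{n\ge 1}\mathrm{GL}_n(k)$, regarded as a discrete group, and let $\mathbf V=\bigcup_{n\ge 1}k^n$ be its standard representation. A representation of $\mathrm{GL}$ over $k$ is *polynomial* if it is a subquotient of a (possibly infinite) direct sum of tensor powers of $\mathbf V$; an element of a representation is *polynomial* if the subrepresentation it generates is polynomial. A *$\mathrm{GL}$-algebra* is a commutative $k$-algebra $R$ with an action of $\mathrm{GL}$ by $k$-algebra automorphisms under which $R$ is a polynomial representation; it is *finitely $\mathrm{GL}$-generated* if it is generated as a $k$-algebra by the $\mathrm{GL}$-orbits of finitely many elements. $\mathrm{Mod}_R$ denotes the category of $\mathrm{GL}$-equivariant $R$-modules that are polynomial representations, with tensor product $\otimes_R$. A *$\mathrm{GL}$-field* is a field extension $K/k$ with an action of $\mathrm{GL}$ by $k$-automorphisms such that every element of $K$ has the form $a/b$ with $a,b\in K$ polynomial and $b\neq 0$. $\mathrm{Mod}_K$ denotes the category of semi-linear representations $M$ of $\mathrm{GL}$ over $K$ in which every element has the form $ax$ with $a\in K$ and $x\in M$ polynomial, with tensor product $\otimes_K$.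 Let $R$ be a finitely $\mathrm{GL}$-generated $\mathrm{GL}$-algebra that is an integral domain, let $K=\mathrm{Frac}(R)$ with the induced action of $\mathrm{GL}$ (a $\mathrm{GL}$-field), and suppose that $K^{\mathrm{GL}}=k$. Let $x$ be a $k$-point of $X=\mathrm{Spec}(R)$ that is $\mathrm{GL}$-generic, i.e. such that the Zariski closure of the orbit $\mathrm{GL}\cdot x$ is $X$, and let $\mathfrak m\subset R$ be the corresponding maximal ideal. Let $T\colon\mathrm{Mod}_R\to\mathrm{Mod}_K$ be the symmetric monoidal functor $M\mapsto K\otimes_R M$, and let $\tilde\Phi_x\colon\mathrm{Mod}_R\to\mathrm{Vec}_k$ be the symmetric monoidal functor $M\mapsto M/\mathfrak mM$. Then $\tilde\Phi_x$ induces a fiber functor $\Phi_x$ on $\mathrm{Mod}_K$. That is, there are a $k$-linear symmetric monoidal functor $\Phi_x\colon\mathrm{Mod}_K\to\mathrm{Vec}_k$ that is exact, faithful and cocontinuous, and a monoidal isomorphism of functors $e\colon\Phi_x\circ T\cong\tilde\Phi_x$. Moreover, the pair $(\Phi_x,e)$ is unique up to unique isomorphism: for every functor $\Phi'\colon\mathrm{Mod}_K\to\mathrm{Vec}_k$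 with an isomorphism $e'\colon\Phi'\circ T\cong\tilde\Phi_x$ there is exactly one isomorphism of functors $\alpha\colon\Phi_x\cong\Phi'$ with $e'\circ\alpha T=e$. -/

import Mathlib

universe u

open CategoryTheory MonoidalCategory TensorProduct

noncomputable section

namespace GLRep

/-! ### The infinite general linear group and polynomial representations -/

section Polynomial

variable (k : Type u) [Field k]

/-- The group `GL = ⋃ₙ GLₙ(k)`, realised on the space `𝕍 = ⋃ₙ kⁿ` of finitely supported
sequences: an automorphism `g` of `𝕍` lies in `GLₙ(k)` exactly if its matrix is block diagonal
`diag(A, 1)` with `A` of size `n × n`, i.e. if its columns and its rows of index `≥ n` are those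
of the identity matrix. -/
def GLInf : Subgroup ((ℕ →₀ k) ≃ₗ[k] (ℕ →₀ k)) where
  carrier := {g | ∃ n : ℕ, ∀ i, n ≤ i →
    g (Finsupp.single i 1) = Finsupp.single i 1 ∧ ∀ v, g v i = v i}
  one_mem' := ⟨0, fun i _ => ⟨rfl, fun _ => rfl⟩⟩
  mul_mem' := by
    rintro a b ⟨n, hn⟩ ⟨m, hm⟩
    refine ⟨max n m, fun i hi => ?_⟩
    have ha := hn i (le_trans (le_max_left _ _) hi)
    have hb := hm i (le_trans (le_max_right _ _) hi)
    refine ⟨?_, fun v => ?_⟩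
    · rw [LinearEquiv.mul_apply, hb.1, ha.1]
    · rw [LinearEquiv.mul_apply, ha.2, hb.2]
  inv_mem' := by
    rintro a ⟨n, hn⟩
    refine ⟨n, fun i hi => ⟨?_, fun v => ?_⟩⟩
    · exact a.injective (((LinearEquiv.mul_apply a a⁻¹ _).symm.trans
        (by rw [mul_inv_cancel]; rfl)).trans (hn i hi).1.symm)
    · rw [← (hn i hi).2 (a⁻¹ v), ← LinearEquiv.mul_apply, mul_inv_cancel]; rfl

/-- The standard representation `𝕍` of `GL`. -/
def stdRep : Representation k (GLInf k) (ℕ →₀ k) where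
  toFun g := (g : (ℕ →₀ k) ≃ₗ[k] (ℕ →₀ k)).toLinearMap
  map_one' := rfl
  map_mul' _ _ := rfl

/-- The representation of `GL` on the tensor power `𝕍^{⊗ d}`. -/
def tensorPowerRep (d : ℕ) : Representation k (GLInf k) (⨂[k]^d (ℕ →₀ k)) where
  toFun g := PiTensorProduct.map fun _ => stdRep k g
  map_one' := by simp only [map_one]; exact PiTensorProduct.map_one
  map_mul' g h := by simp only [map_mul]; exact PiTensorProduct.map_mul _ _

variable {k}
variable {V W : Type u} [AddCommMonoid V] [Module k V] [AddCommMonoid W] [Module k W]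

/-- A representation of `GL` is polynomial if it is a subquotient (a quotient of a
subrepresentation) of a possibly infinite direct sum of tensor powers of `𝕍`. -/
def IsPolynomial (ρ : Representation k (GLInf k) V) : Prop :=
  ∃ (ι : Type u) (d : ι → ℕ)
    (S : Subrepresentation (Representation.directSum fun i => tensorPowerRep k (d i)))
    (f : S.toRepresentation.IntertwiningMap ρ), Function.Surjective f

/-- The subrepresentation generated by a vector. -/
def generatedSubrep (ρ : Representation k (GLInf k) V) (x : V) : Subrepresentation ρ where
  toSubmodule := Submodule.span k (Set.range fun g => ρ g x)
  apply_mem_toSubmodule g v hv := by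
    have : Submodule.span k (Set.range fun g => ρ g x) ≤
        (Submodule.span k (Set.range fun g => ρ g x)).comap (ρ g) := by
      rw [Submodule.span_le]
      rintro _ ⟨h, rfl⟩
      exact Submodule.subset_span ⟨g * h, by simp [map_mul]⟩
    exact this hv

/-- A vector of a representation of `GL` is polynomial if the subrepresentation that it generates
is a polynomial representation. The polynomial vectors of `V` form the set `V^pol`. -/
def IsPolynomialVector (ρ : Representation k (GLInf k) V) (x : V) : Prop :=
  IsPolynomial (generatedSubrep ρ x).toRepresentation

variable {ρ : Representation k (GLInf k) V} {σ : Representation k (GLInf k) W}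

lemma IsPolynomial.of_surjective (h : IsPolynomial ρ) (f : V →ₗ[k] W)
    (hf : ∀ g v, f (ρ g v) = σ g (f v)) (hs : Function.Surjective f) : IsPolynomial σ := by
  obtain ⟨ι, d, S, p, hp⟩ := h
  refine ⟨ι, d, S, LinearMap.intertwiningMap_of_isIntertwiningMap _ _
    (f ∘ₗ p.toLinearMap) fun g v => ?_, hs.comp hp⟩
  have := p.isIntertwining _ _ g v
  simp only [LinearMap.comp_apply, Representation.IntertwiningMap.toLinearMap_apply, this, hf]

lemma isPolynomial_of_injective_directSum {ι : Type u} (d : ι → ℕ)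
    (f : W →ₗ[k] DirectSum ι fun i => ⨂[k]^(d i) (ℕ →₀ k))
    (hf : ∀ g v, f (σ g v) =
      Representation.directSum (fun i => tensorPowerRep k (d i)) g (f v))
    (hi : Function.Injective f) : IsPolynomial σ := by
  let S : Subrepresentation (Representation.directSum fun i => tensorPowerRep k (d i)) :=
    { toSubmodule := LinearMap.range f
      apply_mem_toSubmodule := by
        rintro g _ ⟨v, rfl⟩
        exact ⟨σ g v, hf g v⟩ }
  let e : W ≃ₗ[k] LinearMap.range f := LinearEquiv.ofInjective f hi
  refine ⟨ι, d, S, LinearMap.intertwiningMap_of_isIntertwiningMap _ _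
    e.symm.toLinearMap fun g v => ?_, e.symm.surjective⟩
  obtain ⟨w, rfl⟩ := e.surjective v
  apply e.injective
  simp only [LinearEquiv.coe_coe, LinearEquiv.apply_symm_apply, LinearEquiv.symm_apply_apply]
  exact Subtype.ext (hf g w).symm

lemma IsPolynomial.of_injective (h : IsPolynomial ρ) (f : W →ₗ[k] V)
    (hf : ∀ g v, f (σ g v) = ρ g (f v)) (hi : Function.Injective f) : IsPolynomial σ := by
  obtain ⟨ι, d, S, p, hp⟩ := h
  let B := Representation.directSum fun i => tensorPowerRep k (d i)
  let T : Subrepresentation B :=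
    { toSubmodule := ((LinearMap.range f).comap p.toLinearMap).map S.toSubmodule.subtype
      apply_mem_toSubmodule := by
        rintro g _ ⟨s, ⟨w, hw⟩, rfl⟩
        refine ⟨S.toRepresentation g s, ⟨σ g w, ?_⟩, rfl⟩
        rw [hf, hw]
        exact (p.isIntertwining _ _ g s).symm }
  let e : W ≃ₗ[k] LinearMap.range f := LinearEquiv.ofInjective f hi
  have hTS : T.toSubmodule ≤ S.toSubmodule := by
    rintro _ ⟨s, -, rfl⟩; exact s.2
  let q : T.toSubmodule →ₗ[k] V := p.toLinearMap ∘ₗ Submodule.inclusion hTS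
  have hq : ∀ t, q t ∈ LinearMap.range f := by
    rintro ⟨_, s, hs, rfl⟩; exact hs
  refine ⟨ι, d, T, LinearMap.intertwiningMap_of_isIntertwiningMap _ _
    (e.symm.toLinearMap ∘ₗ q.codRestrict _ hq) fun g t => ?_, fun w => ?_⟩
  · apply e.injective
    apply Subtype.ext
    have h1 : ∀ t, f (e.symm (q.codRestrict _ hq t)) = q t := fun t =>
      congrArg Subtype.val (e.apply_symm_apply (q.codRestrict _ hq t))
    change f _ = f _
    simp only [LinearMap.comp_apply, LinearEquiv.coe_coe]
    rw [hf, h1, h1]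
    exact p.isIntertwining _ _ g (Submodule.inclusion hTS t)
  · obtain ⟨s, hs⟩ := hp (f w)
    refine ⟨⟨s.1, s, ⟨w, hs.symm⟩, rfl⟩, ?_⟩
    apply e.injective
    apply Subtype.ext
    exact (congrArg Subtype.val (e.apply_symm_apply _)).trans hs

lemma isPolynomial_directSum_tmul {ι₁ ι₂ : Type u} (d₁ : ι₁ → ℕ) (d₂ : ι₂ → ℕ) :
    IsPolynomial ((Representation.directSum fun i => tensorPowerRep k (d₁ i)).tprod
      (Representation.directSum fun i => tensorPowerRep k (d₂ i))) := by
  classical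
  let e := TensorProduct.directSum k k (fun i => ⨂[k]^(d₁ i) (ℕ →₀ k))
    (fun i => ⨂[k]^(d₂ i) (ℕ →₀ k))
  let m : ∀ i : ι₁ × ι₂, (⨂[k]^(d₁ i.1) (ℕ →₀ k)) ⊗[k] (⨂[k]^(d₂ i.2) (ℕ →₀ k)) ≃ₗ[k]
      ⨂[k]^(d₁ i.1 + d₂ i.2) (ℕ →₀ k) := fun i => TensorPower.mulEquiv
  let F := (DirectSum.lmap fun i => (m i).toLinearMap) ∘ₗ e.toLinearMap
  have key : ∀ g, F ∘ₗ ((Representation.directSum fun i => tensorPowerRep k (d₁ i)).tprod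
      (Representation.directSum fun i => tensorPowerRep k (d₂ i))) g =
      Representation.directSum
        (fun i : ι₁ × ι₂ => tensorPowerRep k (d₁ i.1 + d₂ i.2)) g ∘ₗ F := by
    intro g
    refine TensorProduct.ext (DirectSum.linearMap_ext _ fun i => PiTensorProduct.ext
      (MultilinearMap.ext fun x => DirectSum.linearMap_ext _ fun j => PiTensorProduct.ext
      (MultilinearMap.ext fun y => ?_)))
    change DirectSum.lmap _ (e (DirectSum.lmap _ (DirectSum.lof k ι₁ _ i _) ⊗ₜ
      DirectSum.lmap _ (DirectSum.lof k ι₂ _ j _))) =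
      DirectSum.lmap _ (DirectSum.lmap _ (e (DirectSum.lof k ι₁ _ i _ ⊗ₜ
      DirectSum.lof k ι₂ _ j _)))
    simp only [DirectSum.lmap_lof, e, TensorProduct.directSum_lof_tmul_lof]
    refine congrArg (DirectSum.lof k (ι₁ × ι₂) (fun i => ⨂[k]^(d₁ i.1 + d₂ i.2) (ℕ →₀ k)) (i, j)) ?_
    change TensorPower.mulEquiv (PiTensorProduct.map _ (PiTensorProduct.tprod k x) ⊗ₜ
      PiTensorProduct.map _ (PiTensorProduct.tprod k y)) =
      PiTensorProduct.map _ (TensorPower.mulEquiv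
        (PiTensorProduct.tprod k x ⊗ₜ PiTensorProduct.tprod k y))
    rw [PiTensorProduct.map_tprod, PiTensorProduct.map_tprod, ← TensorPower.gMul_def,
      ← TensorPower.gMul_def, TensorPower.tprod_mul_tprod, TensorPower.tprod_mul_tprod,
      PiTensorProduct.map_tprod]
    congr 1
    funext a
    refine Fin.addCases (fun a => ?_) (fun a => ?_) a <;> simp
  refine isPolynomial_of_injective_directSum (ι := ι₁ × ι₂) (fun i => d₁ i.1 + d₂ i.2) F
    (fun g v => LinearMap.congr_fun (key g) v) ?_
  exact ((DirectSum.lmap_injective _).2 fun i => (m i).injective).comp e.injective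

lemma flat_of_field (M : Type*) [AddCommMonoid M] [Module k M] : Module.Flat k M := by
  let _ := Module.addCommMonoidToAddCommGroup k (M := M)
  infer_instance

lemma IsPolynomial.tprod (hρ : IsPolynomial ρ) (hσ : IsPolynomial σ) :
    IsPolynomial (ρ.tprod σ) := by
  obtain ⟨ι₁, d₁, S₁, p₁, hp₁⟩ := hρ
  obtain ⟨ι₂, d₂, S₂, p₂, hp₂⟩ := hσ
  have h : IsPolynomial (S₁.toRepresentation.tprod S₂.toRepresentation) := by
    refine (isPolynomial_directSum_tmul d₁ d₂).of_injective
      (TensorProduct.map S₁.toSubmodule.subtype S₂.toSubmodule.subtype) (fun g v => ?_) ?_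
    · induction v with
      | zero => simp
      | add x y hx hy => simp only [map_add, hx, hy]
      | tmul x y => rfl
    · have := flat_of_field (k := k) (DirectSum ι₁ fun i => ⨂[k]^(d₁ i) (ℕ →₀ k))
      have := flat_of_field (k := k) S₂.toSubmodule
      exact TensorProduct.map_injective_of_flat_flat _ _
        S₁.toSubmodule.subtype_injective S₂.toSubmodule.subtype_injective
  refine h.of_surjective (TensorProduct.map p₁.toLinearMap p₂.toLinearMap) (fun g v => ?_)
    (TensorProduct.map_surjective hp₁ hp₂)
  induction v with
  | zero => simp
  | add x y hx hy => simp only [map_add, hx, hy]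
  | tmul x y =>
    simp only [Representation.tprod_apply, TensorProduct.map_tmul]
    exact congrArg₂ _ (p₁.isIntertwining _ _ g x) (p₂.isIntertwining _ _ g y)

lemma isPolynomial_directSum_prod {ι₁ ι₂ : Type u} (D : ι₁ ⊕ ι₂ → ℕ) :
    IsPolynomial ((Representation.directSum fun i => tensorPowerRep k (D (Sum.inl i))).prod
      (Representation.directSum fun i => tensorPowerRep k (D (Sum.inr i)))) := by
  classical
  let T : ι₁ ⊕ ι₂ → Type u := fun i => ⨂[k]^(D i) (ℕ →₀ k)
  let F₁ : (DirectSum ι₁ fun i => T (Sum.inl i)) →ₗ[k] DirectSum (ι₁ ⊕ ι₂) T :=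
    DirectSum.toModule k ι₁ _ fun i => DirectSum.lof k (ι₁ ⊕ ι₂) T (Sum.inl i)
  let F₂ : (DirectSum ι₂ fun i => T (Sum.inr i)) →ₗ[k] DirectSum (ι₁ ⊕ ι₂) T :=
    DirectSum.toModule k ι₂ _ fun i => DirectSum.lof k (ι₁ ⊕ ι₂) T (Sum.inr i)
  let G : DirectSum (ι₁ ⊕ ι₂) T →ₗ[k]
      (DirectSum ι₁ fun i => T (Sum.inl i)) × (DirectSum ι₂ fun i => T (Sum.inr i)) :=
    DirectSum.toModule k _ _ fun i => match i with
      | Sum.inl i => LinearMap.inl k _ _ ∘ₗ DirectSum.lof k ι₁ (fun i => T (Sum.inl i)) i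
      | Sum.inr i => LinearMap.inr k _ _ ∘ₗ DirectSum.lof k ι₂ (fun i => T (Sum.inr i)) i
  have hGF : G ∘ₗ F₁.coprod F₂ = LinearMap.id := by
    refine LinearMap.prod_ext (DirectSum.linearMap_ext _ fun i => LinearMap.ext fun x => ?_)
      (DirectSum.linearMap_ext _ fun i => LinearMap.ext fun x => ?_)
    · simp only [F₁, F₂, G, LinearMap.comp_apply, LinearMap.inl_apply, LinearMap.coprod_apply,
        map_zero, add_zero, DirectSum.toModule_lof]
      exact DirectSum.toModule_lof k (Sum.inl i) x
    · simp only [F₁, F₂, G, LinearMap.comp_apply, LinearMap.inr_apply, LinearMap.coprod_apply,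
        map_zero, zero_add, DirectSum.toModule_lof]
      exact DirectSum.toModule_lof k (Sum.inr i) x
  refine isPolynomial_of_injective_directSum D (F₁.coprod F₂) (fun g v => ?_)
    (Function.LeftInverse.injective (g := G) fun v => LinearMap.congr_fun hGF v)
  have key : F₁.coprod F₂ ∘ₗ
      ((Representation.directSum fun i => tensorPowerRep k (D (Sum.inl i))).prod
      (Representation.directSum fun i => tensorPowerRep k (D (Sum.inr i)))) g =
      Representation.directSum (fun i => tensorPowerRep k (D i)) g ∘ₗ F₁.coprod F₂ := by
    refine LinearMap.prod_ext (DirectSum.linearMap_ext _ fun i => LinearMap.ext fun x => ?_)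
      (DirectSum.linearMap_ext _ fun i => LinearMap.ext fun x => ?_)
    · simp [F₁, F₂, DirectSum.toModule_lof, T]
    · simp [F₁, F₂, DirectSum.toModule_lof, T]
  exact LinearMap.congr_fun key v

lemma IsPolynomial.prod (hρ : IsPolynomial ρ) (hσ : IsPolynomial σ) :
    IsPolynomial (ρ.prod σ) := by
  obtain ⟨ι₁, d₁, S₁, p₁, hp₁⟩ := hρ
  obtain ⟨ι₂, d₂, S₂, p₂, hp₂⟩ := hσ
  have h : IsPolynomial (S₁.toRepresentation.prod S₂.toRepresentation) :=
    (isPolynomial_directSum_prod (Sum.elim d₁ d₂)).of_injective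
      (S₁.toSubmodule.subtype.prodMap S₂.toSubmodule.subtype) (fun _ _ => rfl)
      (Function.Injective.prodMap S₁.toSubmodule.subtype_injective
        S₂.toSubmodule.subtype_injective)
  exact h.of_surjective (p₁.toLinearMap.prodMap p₂.toLinearMap)
    (fun g v => Prod.ext (p₁.isIntertwining _ _ g v.1) (p₂.isIntertwining _ _ g v.2))
    (Function.Surjective.prodMap hp₁ hp₂)

lemma IsPolynomialVector.of_map (hρ : IsPolynomial ρ) (f : V →ₗ[k] W)
    (hf : ∀ g v, f (ρ g v) = σ g (f v)) (x : V) : IsPolynomialVector σ (f x) := by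
  let A := generatedSubrep ρ x
  have hA : IsPolynomial A.toRepresentation :=
    hρ.of_injective A.toSubmodule.subtype (fun _ _ => rfl) A.toSubmodule.subtype_injective
  have hmap : A.toSubmodule.map f = (generatedSubrep σ (f x)).toSubmodule := by
    change Submodule.map f (Submodule.span k _) = Submodule.span k _
    rw [Submodule.map_span, ← Set.range_comp]
    congr 2
    funext g
    exact hf g x
  have hm : ∀ a : A.toSubmodule, (f ∘ₗ A.toSubmodule.subtype) a ∈
      (generatedSubrep σ (f x)).toSubmodule := fun a => hmap ▸ ⟨a.1, a.2, rfl⟩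
  refine hA.of_surjective ((f ∘ₗ A.toSubmodule.subtype).codRestrict _ hm)
    (fun g v => Subtype.ext (hf g v)) ?_
  rintro ⟨w, hw⟩
  rw [← hmap] at hw
  obtain ⟨a, ha, rfl⟩ := hw
  exact ⟨⟨a, ha⟩, rfl⟩

lemma mem_generatedSubrep (ρ : Representation k (GLInf k) V) (x : V) :
    x ∈ (generatedSubrep ρ x).toSubmodule :=
  Submodule.subset_span ⟨1, by simp⟩

lemma IsPolynomial.isPolynomialVector (hρ : IsPolynomial ρ) (x : V) :
    IsPolynomialVector ρ x :=
  IsPolynomialVector.of_map hρ LinearMap.id (fun _ _ => rfl) x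

lemma IsPolynomialVector.map {x : V} (hx : IsPolynomialVector ρ x) (f : V →ₗ[k] W)
    (hf : ∀ g v, f (ρ g v) = σ g (f v)) : IsPolynomialVector σ (f x) :=
  IsPolynomialVector.of_map hx (f ∘ₗ (generatedSubrep ρ x).toSubmodule.subtype)
    (fun g v => hf g v) ⟨x, mem_generatedSubrep ρ x⟩

lemma IsPolynomialVector.add {x y : V} (hx : IsPolynomialVector ρ x)
    (hy : IsPolynomialVector ρ y) : IsPolynomialVector ρ (x + y) :=
  IsPolynomialVector.of_map (IsPolynomial.prod hx hy)
    ((generatedSubrep ρ x).toSubmodule.subtype.coprod (generatedSubrep ρ y).toSubmodule.subtype)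
    (fun g _ => (map_add (ρ g) _ _).symm)
    (⟨x, mem_generatedSubrep ρ x⟩, ⟨y, mem_generatedSubrep ρ y⟩)

lemma IsPolynomialVector.bilin {U : Type u} [AddCommMonoid U] [Module k U]
    {τ : Representation k (GLInf k) U} {x : V} {y : W} (hx : IsPolynomialVector ρ x)
    (hy : IsPolynomialVector σ y) (B : V →ₗ[k] W →ₗ[k] U)
    (hB : ∀ g v w, B (ρ g v) (σ g w) = τ g (B v w)) : IsPolynomialVector τ (B x y) := by
  refine IsPolynomialVector.of_map (IsPolynomial.tprod hx hy)
    (TensorProduct.lift (B.compl₁₂ (generatedSubrep ρ x).toSubmodule.subtype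
      (generatedSubrep σ y).toSubmodule.subtype)) (fun g v => ?_)
    (⟨x, mem_generatedSubrep ρ x⟩ ⊗ₜ ⟨y, mem_generatedSubrep σ y⟩)
  induction v with
  | zero => simp
  | add x y hx hy => simp only [map_add, hx, hy]
  | tmul v w => exact hB g v w

lemma isPolynomialVector_of_invariant {x : V} (hx : ∀ g, ρ g x = x) :
    IsPolynomialVector ρ x := by
  classical
  have h : IsPolynomial (tensorPowerRep k 0) :=
    isPolynomial_of_injective_directSum (ι := PUnit.{u+1}) (fun _ => 0)
      (DirectSum.lof k PUnit.{u+1} (fun _ => ⨂[k]^0 (ℕ →₀ k)) PUnit.unit)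
      (fun g v => (DirectSum.lmap_lof (fun _ => tensorPowerRep k 0 g) PUnit.unit v).symm)
      (DirectSum.of_injective (β := fun _ : PUnit.{u+1} => ⨂[k]^0 (ℕ →₀ k)) PUnit.unit)
  let e := PiTensorProduct.isEmptyEquiv (R := k) (s := fun _ => ℕ →₀ k) (Fin 0)
  have he : ∀ g v, e (tensorPowerRep k 0 g v) = e v := by
    intro g v
    obtain ⟨c, rfl⟩ := e.symm.surjective v
    simp [e, tensorPowerRep, PiTensorProduct.map_tprod]
  have := IsPolynomialVector.of_map (σ := ρ) h (LinearMap.toSpanSingleton k V x ∘ₗ e.toLinearMap)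
    (fun g v => by simp [he, hx]) (e.symm 1)
  simpa using this

lemma isPolynomialVector_zero : IsPolynomialVector ρ 0 := by
  have h : IsPolynomial (1 : Representation k (GLInf k) PUnit.{u+1}) :=
    isPolynomial_of_injective_directSum (ι := PUnit.{u+1}) (fun _ => 0) 0 (by simp)
      (fun _ _ _ => rfl)
  simpa using IsPolynomialVector.of_map (σ := ρ) h 0 (by simp) 0

end Polynomial


/-! ### Semi-linear representations -/

section Semilinear

set_option linter.unusedSectionVars false

variable (k : Type u) [Field k] (G : Type u) [Group G]
  (R : Type u) [CommRing R] [Algebra k R] [MulSemiringAction G R] [SMulCommClass G k R]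

/-- Let the group `G` act on the commutative `k`-algebra `R` by `k`-algebra automorphisms.
A `G`-equivariant `R`-module is an `R`-module `M` with a `k`-linear action `ρ` of `G` such that
`g (r m) = (g r) (g m)`. (The `k`-module structure is the one induced from the `R`-module
structure, by the scalar tower.) If `R` is a field, this is a semi-linear representation. -/
structure EquivariantModule where
  /-- The underlying module. -/
  carrier : Type u
  [addCommGroup : AddCommGroup carrier]
  [moduleBase : Module k carrier]
  [module : Module R carrier]
  [isScalarTower : IsScalarTower k R carrier]
  /-- The action of `G`. -/
  ρ : Representation k G carrier
  ρ_smul : ∀ (g : G) (r : R) (m : carrier), ρ g (r • m) = (g • r) • ρ g m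

attribute [instance] EquivariantModule.addCommGroup EquivariantModule.moduleBase
  EquivariantModule.module EquivariantModule.isScalarTower

namespace EquivariantModule

variable {k G R}

/-- Morphisms of equivariant modules: `R`-linear maps that commute with the `G`-actions. -/
@[ext]
structure Hom (M N : EquivariantModule k G R) where
  /-- The underlying linear map. -/
  lin : M.carrier →ₗ[R] N.carrier
  comm : ∀ (g : G) (m : M.carrier), lin (M.ρ g m) = N.ρ g (lin m)

instance : Category (EquivariantModule k G R) where
  Hom := Hom
  id M := ⟨LinearMap.id, fun _ _ => rfl⟩
  comp f g := ⟨g.lin ∘ₗ f.lin, fun a m => by simp [f.comm, g.comm]⟩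

variable {M N P Q : EquivariantModule k G R}

@[ext] lemma hom_ext {f g : M ⟶ N} (h : f.lin = g.lin) : f = g := Hom.ext h

@[simp] lemma id_lin : Hom.lin (𝟙 M) = LinearMap.id := rfl
@[simp] lemma comp_lin (f : M ⟶ N) (g : N ⟶ P) : (f ≫ g).lin = g.lin ∘ₗ f.lin := rfl

/-- An equivariant linear isomorphism gives an isomorphism of equivariant modules. -/
def mkIso (e : M.carrier ≃ₗ[R] N.carrier) (he : ∀ g m, e (M.ρ g m) = N.ρ g (e m)) : M ≅ N where
  hom := ⟨e.toLinearMap, he⟩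
  inv := ⟨e.symm.toLinearMap, fun g n => by
    apply e.injective
    simp [he]⟩
  hom_inv_id := hom_ext (by ext; simp)
  inv_hom_id := hom_ext (by ext; simp)

instance : Add (M ⟶ N) := ⟨fun f g => ⟨f.lin + g.lin, fun a m => by simp [f.comm, g.comm]⟩⟩
instance : Zero (M ⟶ N) := ⟨⟨0, fun a m => by simp⟩⟩
instance : Neg (M ⟶ N) := ⟨fun f => ⟨-f.lin, fun a m => by simp [f.comm]⟩⟩
instance : Sub (M ⟶ N) := ⟨fun f g => ⟨f.lin - g.lin, fun a m => by simp [f.comm, g.comm]⟩⟩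
instance : SMul ℕ (M ⟶ N) := ⟨fun n f => ⟨n • f.lin, fun a m => by simp [f.comm]⟩⟩
instance : SMul ℤ (M ⟶ N) := ⟨fun n f => ⟨n • f.lin, fun a m => by simp [f.comm]⟩⟩

instance : SMul k (M ⟶ N) := ⟨fun c f => ⟨c • f.lin, fun a m => by simp [f.comm]⟩⟩

@[simp] lemma add_lin (f g : M ⟶ N) : (f + g).lin = f.lin + g.lin := rfl
@[simp] lemma zero_lin : (0 : M ⟶ N).lin = 0 := rfl
@[simp] lemma smul_lin (c : k) (f : M ⟶ N) : (c • f).lin = c • f.lin := rfl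

instance : AddCommGroup (M ⟶ N) :=
  Function.Injective.addCommGroup (fun f : M ⟶ N => f.lin) (fun _ _ h => hom_ext h)
    rfl (fun _ _ => rfl) (fun _ => rfl) (fun _ _ => rfl) (fun _ _ => rfl) (fun _ _ => rfl)

instance : Module k (M ⟶ N) :=
  Function.Injective.module k
    { toFun := fun f : M ⟶ N => f.lin, map_zero' := rfl, map_add' := fun _ _ => rfl }
    (fun _ _ h => hom_ext h) (fun _ _ => rfl)

instance : Preadditive (EquivariantModule k G R) where
  homGroup _ _ := inferInstance
  add_comp _ _ _ _ _ _ := hom_ext (LinearMap.comp_add _ _ _)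
  comp_add _ _ _ _ _ _ := hom_ext (LinearMap.add_comp _ _ _)

instance : Linear k (EquivariantModule k G R) where
  homModule _ _ := inferInstance
  smul_comp _ _ _ r f g := hom_ext (by ext; simp [LinearMap.map_smul_of_tower])
  comp_smul _ _ _ _ _ _ := hom_ext rfl

/-- The action of a group element, as a semi-linear map. -/
def ρₛ (M : EquivariantModule k G R) (g : G) :
    M.carrier →ₛₗ[MulSemiringAction.toRingHom G R g] M.carrier where
  toFun := M.ρ g
  map_add' := map_add _
  map_smul' r m := M.ρ_smul g r m

/-- The diagonal action `g (m ⊗ n) = g m ⊗ g n` on `M ⊗_R N`. -/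
def tensorρ (M N : EquivariantModule k G R) : Representation k G (M.carrier ⊗[R] N.carrier) where
  toFun g :=
    { toFun := TensorProduct.map (M.ρₛ g) (N.ρₛ g)
      map_add' := map_add _
      map_smul' := fun c x => by
        rw [RingHom.id_apply, ← algebraMap_smul R c x, LinearMap.map_smulₛₗ]
        simp [smul_algebraMap] }
  map_one' := by
    ext x
    induction x with
    | zero => simp
    | add x y hx hy => rw [map_add, hx, hy, map_add]
    | tmul x y =>
      change M.ρ 1 x ⊗ₜ N.ρ 1 y = _
      simp
  map_mul' g h := by
    ext x
    induction x with
    | zero => simp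
    | add x y hx hy => rw [map_add, hx, hy, map_add]
    | tmul x y =>
      change M.ρ (g * h) x ⊗ₜ N.ρ (g * h) y = M.ρ g (M.ρ h x) ⊗ₜ N.ρ g (N.ρ h y)
      simp

@[simp] lemma tensorρ_tmul (M N : EquivariantModule k G R) (g : G) (m : M.carrier)
    (n : N.carrier) : tensorρ M N g (m ⊗ₜ n) = M.ρ g m ⊗ₜ N.ρ g n := rfl

/-- The tensor product `M ⊗_R N`, with the diagonal action. -/
def tensor (M N : EquivariantModule k G R) : EquivariantModule k G R where
  carrier := M.carrier ⊗[R] N.carrier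
  ρ := tensorρ M N
  ρ_smul g r x := LinearMap.map_smulₛₗ (TensorProduct.map (M.ρₛ g) (N.ρₛ g)) r x

variable (k G R) in
/-- The module `R` itself. -/
def unit : EquivariantModule k G R where
  carrier := R
  ρ := Representation.ofDistribMulAction k G R
  ρ_smul g r m := MulSemiringAction.smul_mul g r m

lemma tensorρ_induction {X : Type*} [AddCommMonoid X] (M N : EquivariantModule k G R) (g : G)
    (F F' : M.carrier ⊗[R] N.carrier →+ X)
    (h : ∀ m n, F (M.ρ g m ⊗ₜ N.ρ g n) = F' (m ⊗ₜ n)) (x : M.carrier ⊗[R] N.carrier) :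
    F (tensorρ M N g x) = F' x := by
  induction x with
  | zero => simp
  | add x y hx hy => rw [map_add, map_add, map_add, hx, hy]
  | tmul x y => exact h x y

/-- The tensor product of two morphisms. -/
def tensorMap {M N M' N' : EquivariantModule k G R} (f : M ⟶ N) (g : M' ⟶ N') :
    tensor M M' ⟶ tensor N N' where
  lin := TensorProduct.map f.lin g.lin
  comm a := tensorρ_induction M M' a (TensorProduct.map f.lin g.lin).toAddMonoidHom
    ((tensorρ N N' a).toAddMonoidHom.comp (TensorProduct.map f.lin g.lin).toAddMonoidHom)
    fun m n => congrArg₂ (· ⊗ₜ[R] ·) (f.comm a m) (g.comm a n)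

/-- The associativity isomorphism. -/
def assocIso (M N P : EquivariantModule k G R) :
    tensor (tensor M N) P ≅ tensor M (tensor N P) :=
  mkIso (TensorProduct.assoc R M.carrier N.carrier P.carrier) fun g =>
    let e := (TensorProduct.assoc R M.carrier N.carrier P.carrier).toLinearMap.toAddMonoidHom
    let T := (tensorρ M (tensor N P) g).toAddMonoidHom
    let t (p : P.carrier) :=
      ((TensorProduct.mk R (M.carrier ⊗[R] N.carrier) P.carrier).flip p).toAddMonoidHom
    tensorρ_induction (tensor M N) P g e (T.comp e) fun x p =>
      tensorρ_induction M N g (e.comp (t (P.ρ g p))) ((T.comp e).comp (t p)) (fun _ _ => rfl) x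

/-- The left unit isomorphism. -/
def leftUnitIso (M : EquivariantModule k G R) : tensor (unit k G R) M ≅ M :=
  mkIso (TensorProduct.lid R M.carrier) fun g =>
    tensorρ_induction (unit k G R) M g (TensorProduct.lid R M.carrier).toLinearMap.toAddMonoidHom
      ((M.ρ g).toAddMonoidHom.comp (TensorProduct.lid R M.carrier).toLinearMap.toAddMonoidHom) fun r m => (M.ρ_smul g r m).symm

/-- The right unit isomorphism. -/
def rightUnitIso (M : EquivariantModule k G R) : tensor M (unit k G R) ≅ M :=
  mkIso (TensorProduct.rid R M.carrier) fun g =>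
    tensorρ_induction M (unit k G R) g (TensorProduct.rid R M.carrier).toLinearMap.toAddMonoidHom
      ((M.ρ g).toAddMonoidHom.comp (TensorProduct.rid R M.carrier).toLinearMap.toAddMonoidHom) fun m r => (M.ρ_smul g r m).symm

/-- The symmetry `m ⊗ n ↦ n ⊗ m`. -/
def braidIso (M N : EquivariantModule k G R) : tensor M N ≅ tensor N M :=
  mkIso (TensorProduct.comm R M.carrier N.carrier) fun g =>
    tensorρ_induction M N g (TensorProduct.comm R M.carrier N.carrier).toLinearMap.toAddMonoidHom
      ((tensorρ N M g).toAddMonoidHom.comp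
        (TensorProduct.comm R M.carrier N.carrier).toLinearMap.toAddMonoidHom) fun _ _ => rfl

instance : MonoidalCategoryStruct (EquivariantModule k G R) where
  tensorObj := tensor
  whiskerLeft M _ _ f := tensorMap (𝟙 M) f
  whiskerRight f N := tensorMap f (𝟙 N)
  tensorHom := tensorMap
  tensorUnit := unit k G R
  associator := assocIso
  leftUnitor := leftUnitIso
  rightUnitor := rightUnitIso

instance : MonoidalCategory (EquivariantModule k G R) := MonoidalCategory.ofTensorHom
  (id_tensorHom_id := fun M N => hom_ext (TensorProduct.ext' fun _ _ => rfl))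
  (tensorHom_comp_tensorHom := fun _ _ _ _ => hom_ext (TensorProduct.ext' fun _ _ => rfl))
  (associator_naturality := fun _ _ _ =>
    hom_ext (TensorProduct.ext_threefold fun _ _ _ => rfl))
  (leftUnitor_naturality := fun f =>
    hom_ext (TensorProduct.ext' fun r m => (f.lin.map_smul r m).symm))
  (rightUnitor_naturality := fun f =>
    hom_ext (TensorProduct.ext' fun m r => (f.lin.map_smul r m).symm))
  (pentagon := fun _ _ _ _ => hom_ext (TensorProduct.ext_fourfold fun _ _ _ _ => rfl))
  (triangle := fun _ _ =>
    hom_ext (TensorProduct.ext_threefold fun _ _ _ => TensorProduct.tmul_smul _ _ _))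

instance : BraidedCategory (EquivariantModule k G R) where
  braiding := braidIso
  braiding_naturality_right _ _ _ _ := hom_ext (TensorProduct.ext' fun _ _ => rfl)
  braiding_naturality_left _ _ := hom_ext (TensorProduct.ext' fun _ _ => rfl)
  hexagon_forward _ _ _ := hom_ext (TensorProduct.ext_threefold fun _ _ _ => rfl)
  hexagon_reverse X Y Z := by
    apply (cancel_epi (α_ X Y Z).hom).1
    exact hom_ext (TensorProduct.ext_threefold fun _ _ _ => rfl)

instance : SymmetricCategory (EquivariantModule k G R) where
  symmetry _ _ := hom_ext (TensorProduct.ext' fun _ _ => rfl)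

end EquivariantModule

end Semilinear


/-! ### Modules over `GL`-algebras and `GL`-fields -/

section GLAlgebra

variable (k : Type u) [Field k]

/-- A `GL`-algebra over `k` is a commutative `k`-algebra with an action of `GL` by `k`-algebra
automorphisms, under which it is a polynomial representation. -/
class IsGLAlgebra (R : Type u) [CommRing R] [Algebra k R] [MulSemiringAction (GLInf k) R] : Prop
    extends SMulCommClass (GLInf k) k R where
  isPolynomial : IsPolynomial (Representation.ofDistribMulAction k (GLInf k) R)

/-- A `GL`-field over `k` is an extension field `K` of `k` with an action of `GL` by
`k`-automorphisms such that every element of `K` is a quotient of polynomial elements. -/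
class IsGLField (K : Type u) [Field K] [Algebra k K] [MulSemiringAction (GLInf k) K] : Prop
    extends SMulCommClass (GLInf k) k K where
  exists_div : ∀ a : K, ∃ p q : K,
    IsPolynomialVector (Representation.ofDistribMulAction k (GLInf k) K) p ∧
    IsPolynomialVector (Representation.ofDistribMulAction k (GLInf k) K) q ∧
    q ≠ 0 ∧ a = p / q

/-- A `GL`-algebra is finitely `GL`-generated over `k` if it is generated, as a `k`-algebra, by the
`GL`-orbits of finitely many elements. -/
def IsFinitelyGLGenerated (R : Type u) [CommRing R] [Algebra k R]
    [MulSemiringAction (GLInf k) R] : Prop :=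
  ∃ s : Finset R, Algebra.adjoin k {r : R | ∃ g : GLInf k, ∃ a ∈ s, r = g • a} = ⊤

section ModR

variable (R : Type u) [CommRing R] [Algebra k R] [MulSemiringAction (GLInf k) R] [IsGLAlgebra k R]

/-- The property of being a polynomial representation, for `GL`-equivariant `R`-modules. -/
def isPolynomialModule : ObjectProperty (EquivariantModule k (GLInf k) R) :=
  fun M => IsPolynomial M.ρ

/-- The category `Mod_R` of modules over a `GL`-algebra `R`: the `GL`-equivariant `R`-modules that
are polynomial representations. -/
abbrev ModR : Type (u + 1) := (isPolynomialModule k R).FullSubcategory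

instance : (isPolynomialModule k R).IsMonoidal where
  prop_unit := IsGLAlgebra.isPolynomial (k := k) (R := R)
  prop_tensor M N hM hN := by
    refine IsPolynomial.of_surjective (IsPolynomial.tprod hM hN)
      (TensorProduct.lift ((TensorProduct.mk R M.carrier N.carrier).restrictScalars₁₂ k k))
      (fun g v => ?_) (fun v => ?_)
    · induction v with
      | zero => simp
      | add x y hx hy => simp only [map_add, hx, hy]
      | tmul x y => rfl
    · change M.carrier ⊗[R] N.carrier at v
      induction v with
      | zero => exact ⟨0, map_zero _⟩
      | add x y hx hy =>
        obtain ⟨x, rfl⟩ := hx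
        obtain ⟨y, rfl⟩ := hy
        exact ⟨x + y, map_add _ _ _⟩
      | tmul x y => exact ⟨x ⊗ₜ y, rfl⟩

end ModR

section ModK

variable (K : Type u) [Field K] [Algebra k K] [MulSemiringAction (GLInf k) K] [IsGLField k K]

/-- The property that every element of a semi-linear representation of `GL` over `K` has the form
`a x` with `a ∈ K` and `x` a polynomial element. -/
def isKModule : ObjectProperty (EquivariantModule k (GLInf k) K) :=
  fun M => ∀ m : M.carrier, ∃ (a : K) (x : M.carrier), IsPolynomialVector M.ρ x ∧ m = a • x

/-- The category `Mod_K` of modules over a `GL`-field `K`. -/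
abbrev ModK : Type (u + 1) := (isKModule k K).FullSubcategory

variable {k K}

lemma IsPolynomialVector.smul {M : EquivariantModule k (GLInf k) K} {a : K} {x : M.carrier}
    (ha : IsPolynomialVector (Representation.ofDistribMulAction k (GLInf k) K) a)
    (hx : IsPolynomialVector M.ρ x) : IsPolynomialVector M.ρ (a • x) :=
  IsPolynomialVector.bilin ha hx (Algebra.lsmul k k M.carrier).toLinearMap fun g r m => (M.ρ_smul g r m).symm

lemma exists_smul_add {M : EquivariantModule k (GLInf k) K} {v w : M.carrier}
    (hv : ∃ (a : K) (x : M.carrier), IsPolynomialVector M.ρ x ∧ v = a • x)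
    (hw : ∃ (a : K) (x : M.carrier), IsPolynomialVector M.ρ x ∧ w = a • x) :
    ∃ (a : K) (x : M.carrier), IsPolynomialVector M.ρ x ∧ v + w = a • x := by
  obtain ⟨a, x, hx, rfl⟩ := hv
  obtain ⟨b, y, hy, rfl⟩ := hw
  obtain ⟨p, q, hp, hq, hq0, rfl⟩ := IsGLField.exists_div (k := k) a
  obtain ⟨p', q', hp', hq', hq0', rfl⟩ := IsGLField.exists_div (k := k) b
  refine ⟨(q * q')⁻¹, q' • p • x + q • p' • y,
    IsPolynomialVector.add
      (IsPolynomialVector.smul hq' (IsPolynomialVector.smul hp hx))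
      (IsPolynomialVector.smul hq (IsPolynomialVector.smul hp' hy)), ?_⟩
  rw [smul_add, smul_smul, smul_smul, smul_smul, smul_smul]
  congr 2 <;> field_simp

instance : (isKModule k K).IsMonoidal where
  prop_unit := fun (m : K) => ⟨m, (1 : K),
    isPolynomialVector_of_invariant (ρ := Representation.ofDistribMulAction k (GLInf k) K)
      fun g => smul_one g, (mul_one m).symm⟩
  prop_tensor M N hM hN v := by
    change M.carrier ⊗[K] N.carrier at v
    induction v with
    | zero => exact ⟨0, 0, isPolynomialVector_zero,
        (smul_zero (A := M.carrier ⊗[K] N.carrier) _).symm⟩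
    | add x y hx hy => exact exists_smul_add hx hy
    | tmul m n =>
      obtain ⟨a, x, hx, rfl⟩ := hM m
      obtain ⟨b, y, hy, rfl⟩ := hN n
      exact ⟨a * b, x ⊗ₜ y, IsPolynomialVector.bilin hx hy
        ((TensorProduct.mk K M.carrier N.carrier).restrictScalars₁₂ k k) (fun _ _ _ => rfl),
        TensorProduct.smul_tmul_smul _ _ _ _⟩

end ModK

end GLAlgebra

/-! ### Extension of scalars -/

section Extension

variable (k : Type u) [Field k] (R : Type u) [CommRing R] [Algebra k R]
  [MulSemiringAction (GLInf k) R] [IsGLAlgebra k R]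
  (K : Type u) [Field K] [Algebra k K] [MulSemiringAction (GLInf k) K] [IsGLField k K]
  [Algebra R K] [IsScalarTower k R K] [SMulDistribClass (GLInf k) R K]

/-- The field `K`, as an equivariant `R`-module. -/
def fieldAsModule : EquivariantModule k (GLInf k) R where
  carrier := K
  ρ := Representation.ofDistribMulAction k (GLInf k) K
  ρ_smul g r a := smul_distrib_smul g r a

variable {k R}

/-- The `K`-module `K ⊗_R M`, with the diagonal action of `GL`. -/
def extendObj (M : EquivariantModule k (GLInf k) R) : EquivariantModule k (GLInf k) K where
  carrier := K ⊗[R] M.carrier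
  moduleBase := TensorProduct.leftModule
  module := TensorProduct.leftModule
  isScalarTower := TensorProduct.isScalarTower_left
  ρ := EquivariantModule.tensorρ (fieldAsModule k R K) M
  ρ_smul g a x := by
    induction x with
    | zero => simp only [smul_zero, map_zero]
    | add x y hx hy => rw [smul_add, map_add, map_add, smul_add, hx, hy]
    | tmul b m =>
      change (g • (a * b)) ⊗ₜ[R] M.ρ g m = (g • a) • ((g • b) ⊗ₜ[R] M.ρ g m)
      rw [MulSemiringAction.smul_mul]
      rfl

/-- The functor `M ↦ K ⊗_R M`, from equivariant `R`-modules to semi-linear representations. -/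
def extendFunctor : EquivariantModule k (GLInf k) R ⥤ EquivariantModule k (GLInf k) K where
  obj M := extendObj K M
  map {M N} f :=
    { lin := f.lin.baseChange K
      comm := fun g => EquivariantModule.tensorρ_induction (fieldAsModule k R K) M g
        (f.lin.baseChange K).toAddMonoidHom
        ((EquivariantModule.tensorρ (fieldAsModule k R K) N g).toAddMonoidHom.comp
          (f.lin.baseChange K).toAddMonoidHom)
        fun a m => congrArg (fun n => (g • (show K from a)) ⊗ₜ[R] n) (f.comm g m) }
  map_id _ := EquivariantModule.hom_ext LinearMap.baseChange_id
  map_comp _ _ := EquivariantModule.hom_ext (LinearMap.baseChange_comp _ _)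

lemma isKModule_extendObj (M : EquivariantModule k (GLInf k) R) (hM : IsPolynomial M.ρ) :
    isKModule k K (extendObj K M) := by
  intro v
  change K ⊗[R] M.carrier at v
  induction v with
  | zero => exact ⟨0, 0, isPolynomialVector_zero, (smul_zero (A := K ⊗[R] M.carrier) _).symm⟩
  | add x y hx hy => exact exists_smul_add hx hy
  | tmul a m =>
    refine ⟨a, (1 : K) ⊗ₜ[R] m, IsPolynomialVector.of_map hM
      (((TensorProduct.mk R K M.carrier) 1).restrictScalars k) (fun g v => ?_) m, ?_⟩
    · change (1 : K) ⊗ₜ[R] M.ρ g v = (g • (1 : K)) ⊗ₜ[R] M.ρ g v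
      rw [smul_one]
    · exact ((TensorProduct.smul_tmul' a (1 : K) m).trans (by rw [smul_eq_mul, mul_one])).symm


lemma baseChange_ext {M : Type*} [AddCommGroup M] [Module R M] {P : Type*} [AddCommGroup P]
    [Module K P] {f f' : K ⊗[R] M →ₗ[K] P} (h : ∀ m, f (1 ⊗ₜ m) = f' (1 ⊗ₜ m)) : f = f' := by
  refine LinearMap.ext fun x => ?_
  induction x with
  | zero => rw [map_zero, map_zero]
  | add x y hx hy => rw [map_add, map_add, hx, hy]
  | tmul a m =>
    have : a ⊗ₜ[R] m = a • ((1 : K) ⊗ₜ[R] m) := by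
      rw [TensorProduct.smul_tmul', smul_eq_mul, mul_one]
    rw [this, map_smul, map_smul, h]

lemma baseChange_ext₂ {M N : Type*} [AddCommGroup M] [Module R M] [AddCommGroup N] [Module R N]
    {P : Type*} [AddCommGroup P] [Module K P] {f f' : K ⊗[R] (M ⊗[R] N) →ₗ[K] P}
    (h : ∀ m n, f (1 ⊗ₜ (m ⊗ₜ n)) = f' (1 ⊗ₜ (m ⊗ₜ n))) : f = f' := by
  refine baseChange_ext K fun x => ?_
  induction x with
  | zero => simp only [TensorProduct.tmul_zero, map_zero]
  | add x y hx hy => simp only [TensorProduct.tmul_add, map_add, hx, hy]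
  | tmul m n => exact h m n

lemma baseChange_ext₃ {M N Q : Type*} [AddCommGroup M] [Module R M] [AddCommGroup N] [Module R N]
    [AddCommGroup Q] [Module R Q]
    {P : Type*} [AddCommGroup P] [Module K P] {f f' : K ⊗[R] ((M ⊗[R] N) ⊗[R] Q) →ₗ[K] P}
    (h : ∀ m n q, f (1 ⊗ₜ ((m ⊗ₜ n) ⊗ₜ q)) = f' (1 ⊗ₜ ((m ⊗ₜ n) ⊗ₜ q))) : f = f' := by
  refine baseChange_ext₂ K fun x q => ?_
  induction x with
  | zero => simp only [TensorProduct.tmul_zero, TensorProduct.zero_tmul, map_zero]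
  | add x y hx hy =>
    simp only [TensorProduct.tmul_add, TensorProduct.add_tmul, map_add, hx, hy]
  | tmul m n => exact h m n q

/-- The canonical isomorphism `K ⊗_R R ≅ K`. -/
def extendUnitIso : extendObj K (EquivariantModule.unit k (GLInf k) R) ≅
    EquivariantModule.unit k (GLInf k) K :=
  EquivariantModule.mkIso (M := extendObj K (EquivariantModule.unit k (GLInf k) R))
    (N := EquivariantModule.unit k (GLInf k) K) (AlgebraTensorModule.rid R K K) fun g =>
    EquivariantModule.tensorρ_induction (fieldAsModule k R K)
      (EquivariantModule.unit k (GLInf k) R) g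
      (AlgebraTensorModule.rid R K K).toLinearMap.toAddMonoidHom
      ((DistribSMul.toAddMonoidHom K g).comp
        (AlgebraTensorModule.rid R K K).toLinearMap.toAddMonoidHom)
      fun a r => (smul_distrib_smul g (show R from r) (show K from a)).symm

/-- The canonical isomorphism `K ⊗_R (M ⊗_R N) ≅ (K ⊗_R M) ⊗_K (K ⊗_R N)`. -/
def extendTensorIso (M N : EquivariantModule k (GLInf k) R) :
    extendObj K (EquivariantModule.tensor M N) ≅
      EquivariantModule.tensor (extendObj K M) (extendObj K N) :=
  EquivariantModule.mkIso (M := extendObj K (EquivariantModule.tensor M N))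
    (N := EquivariantModule.tensor (extendObj K M) (extendObj K N))
    (AlgebraTensorModule.distribBaseChange R K M.carrier N.carrier) fun g =>
    let D : K ⊗[R] (M.carrier ⊗[R] N.carrier) →+
        (K ⊗[R] M.carrier) ⊗[K] (K ⊗[R] N.carrier) :=
      (AlgebraTensorModule.distribBaseChange R K M.carrier N.carrier).toLinearMap.toAddMonoidHom
    let A := (EquivariantModule.tensorρ (extendObj K M) (extendObj K N) g).toAddMonoidHom
    let t (a : K) := (TensorProduct.mk R K (M.carrier ⊗[R] N.carrier) a).toAddMonoidHom
    EquivariantModule.tensorρ_induction (fieldAsModule k R K) (EquivariantModule.tensor M N) g D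
      (A.comp D) fun a =>
        EquivariantModule.tensorρ_induction M N g (D.comp (t (g • (show K from a))))
          ((A.comp D).comp (t a)) fun m n => by
            change ((g • (show K from a)) ⊗ₜ[R] M.ρ g m) ⊗ₜ[K] ((1 : K) ⊗ₜ[R] N.ρ g n) =
              ((g • (show K from a)) ⊗ₜ[R] M.ρ g m) ⊗ₜ[K] ((g • (1 : K)) ⊗ₜ[R] N.ρ g n)
            rw [smul_one]

/-- The monoidal structure of `M ↦ K ⊗_R M`, given by the canonical isomorphisms
`K ≅ K ⊗_R R` and `(K ⊗_R M) ⊗_K (K ⊗_R N) ≅ K ⊗_R (M ⊗_R N)`. -/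
def extendCoreMonoidal : (extendFunctor (k := k) (R := R) K).CoreMonoidal :=
  .mk'
    (εIso := (extendUnitIso K).symm)
    (μIso := fun M N => (extendTensorIso K M N).symm)
    (μIso_inv_natural_left := fun _ _ =>
      EquivariantModule.hom_ext (baseChange_ext₂ K fun _ _ => rfl))
    (μIso_inv_natural_right := fun _ _ =>
      EquivariantModule.hom_ext (baseChange_ext₂ K fun _ _ => rfl))
    (oplax_associativity := fun _ _ _ =>
      EquivariantModule.hom_ext (baseChange_ext₃ K fun _ _ _ => rfl))
    (oplax_left_unitality := fun M => EquivariantModule.hom_ext (by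
      refine baseChange_ext K fun m => ?_
      change (1 : K) ⊗ₜ[K] ((1 : K) ⊗ₜ[R] m) =
        ((1 : R) • (1 : K)) ⊗ₜ[K] ((1 : K) ⊗ₜ[R] m)
      rw [one_smul]))
    (oplax_right_unitality := fun M => EquivariantModule.hom_ext (by
      refine baseChange_ext K fun m => ?_
      change ((1 : K) ⊗ₜ[R] m) ⊗ₜ[K] (1 : K) =
        ((1 : K) ⊗ₜ[R] m) ⊗ₜ[K] ((1 : R) • (1 : K))
      rw [one_smul]))

instance : (extendFunctor (k := k) (R := R) K).Monoidal := (extendCoreMonoidal K).toMonoidal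

/-- The functor `Mod_R ⥤ Mod_K`, `M ↦ K ⊗_R M`. -/
def extendModR : ModR k R ⥤ ModK k K :=
  (isKModule k K).lift ((isPolynomialModule k R).ι ⋙ extendFunctor K)
    fun M => isKModule_extendObj K M.obj M.property

/-- The monoidal structure of `M ↦ K ⊗_R M`. -/
instance : (extendModR (k := k) (R := R) K).Monoidal :=
  Functor.CoreMonoidal.toMonoidal
    { εIso := (isKModule k K).isoMk (extendCoreMonoidal K).εIso
      μIso := fun M N => (isKModule k K).isoMk ((extendCoreMonoidal K).μIso M.obj N.obj)
      μIso_hom_natural_left := fun f N => ObjectProperty.hom_ext _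
        ((extendCoreMonoidal K).μIso_hom_natural_left f.hom N.obj)
      μIso_hom_natural_right := fun M f => ObjectProperty.hom_ext _
        ((extendCoreMonoidal K).μIso_hom_natural_right M.obj f.hom)
      associativity := fun M N P => ObjectProperty.hom_ext _
        ((extendCoreMonoidal K).associativity M.obj N.obj P.obj)
      left_unitality := fun M => ObjectProperty.hom_ext _
        ((extendCoreMonoidal K).left_unitality M.obj)
      right_unitality := fun M => ObjectProperty.hom_ext _
        ((extendCoreMonoidal K).right_unitality M.obj) }

end Extension

/-! ### The fiber functor at a `k`-point -/

section Fiber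

variable {k : Type u} [Field k] {R : Type u} [CommRing R] [Algebra k R] (x : R →ₐ[k] k)

section Tensor

variable (M N : Type u) [AddCommGroup M] [AddCommGroup N] [Module k M] [Module k N]
  [Module R M] [Module R N] [IsScalarTower k R M] [IsScalarTower k R N]

/-- The fiber `M/𝔪M`, where `𝔪` is the maximal ideal of the `k`-point `x`. -/
abbrev Fiber : Type u := M ⧸ (RingHom.ker x • ⊤ : Submodule R M)

variable {M N}

lemma fiber_smul (r : R) (v : Fiber x M) : r • v = x r • v := by
  obtain ⟨m, rfl⟩ := Submodule.Quotient.mk_surjective _ v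
  rw [← Submodule.Quotient.mk_smul, ← Submodule.Quotient.mk_smul, Submodule.Quotient.eq,
    ← algebraMap_smul R (x r) m, ← sub_smul]
  exact Submodule.smul_mem_smul (by simp [RingHom.mem_ker]) Submodule.mem_top

variable (M N)

/-- The map `M/𝔪M → N/𝔪N` induced by an `R`-linear map `M → N`. -/
def fiberMap {M N : Type u} [AddCommGroup M] [AddCommGroup N] [Module k M] [Module k N]
    [Module R M] [Module R N] [IsScalarTower k R M] [IsScalarTower k R N] (f : M →ₗ[R] N) :
    Fiber x M →ₗ[k] Fiber x N :=
  (Submodule.mapQ (RingHom.ker x • ⊤ : Submodule R M) (RingHom.ker x • ⊤ : Submodule R N) f (by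
    rw [← Submodule.map_le_iff_le_comap, Submodule.map_smul'']
    exact Submodule.smul_mono le_rfl le_top)).restrictScalars k

lemma fiberMap_id : fiberMap x (LinearMap.id : M →ₗ[R] M) = LinearMap.id := by
  refine LinearMap.ext fun v => ?_
  obtain ⟨m, rfl⟩ := Submodule.Quotient.mk_surjective _ v
  rfl

lemma fiberMap_comp {P : Type u} [AddCommGroup P] [Module k P] [Module R P] [IsScalarTower k R P]
    (f : M →ₗ[R] N) (g : N →ₗ[R] P) :
    fiberMap x (g ∘ₗ f) = fiberMap x g ∘ₗ fiberMap x f := by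
  refine LinearMap.ext fun v => ?_
  obtain ⟨m, rfl⟩ := Submodule.Quotient.mk_surjective _ v
  rfl

/-- The bilinear map `M/𝔪M × N/𝔪N → (M ⊗_R N)/𝔪(M ⊗_R N)`. -/
def fiberBilin : Fiber x M →ₗ[R] Fiber x N →ₗ[R] Fiber x (M ⊗[R] N) :=
  (Submodule.liftQ (RingHom.ker x • ⊤ : Submodule R N)
    (Submodule.liftQ (RingHom.ker x • ⊤ : Submodule R M)
    ((TensorProduct.mk R M N).compr₂
      (Submodule.mkQ (RingHom.ker x • ⊤ : Submodule R (M ⊗[R] N)))) (by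
      rw [Submodule.smul_le]
      intro r hr m _
      refine LinearMap.mem_ker.2 (LinearMap.ext fun n => ?_)
      refine (Submodule.Quotient.mk_eq_zero _).2 ?_
      change (r • m) ⊗ₜ n ∈ _
      rw [← TensorProduct.smul_tmul']
      exact Submodule.smul_mem_smul hr Submodule.mem_top)).flip (by
    rw [Submodule.smul_le]
    intro r hr n _
    refine LinearMap.mem_ker.2 (LinearMap.ext fun v => ?_)
    obtain ⟨m, rfl⟩ := Submodule.Quotient.mk_surjective _ v
    refine (Submodule.Quotient.mk_eq_zero _).2 ?_
    change m ⊗ₜ (r • n) ∈ _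
    rw [TensorProduct.tmul_smul]
    exact Submodule.smul_mem_smul hr Submodule.mem_top)).flip

lemma fiberBilin_bijective :
    Function.Bijective (TensorProduct.lift ((fiberBilin x M N).restrictScalars₁₂ k k)) := by
  let F := TensorProduct.lift ((fiberBilin x M N).restrictScalars₁₂ k k)
  let L₀ : M ⊗[R] N →ₗ[R] Fiber x M ⊗[k] Fiber x N := TensorProduct.lift
    (LinearMap.mk₂ R (fun m n => (Submodule.Quotient.mk m : Fiber x M) ⊗ₜ[k]
        (Submodule.Quotient.mk n : Fiber x N))
      (fun m m' n => by rw [Submodule.Quotient.mk_add, TensorProduct.add_tmul])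
      (fun r m n => by rw [Submodule.Quotient.mk_smul]; rfl)
      (fun m n n' => by rw [Submodule.Quotient.mk_add, TensorProduct.tmul_add])
      (fun r m n => by
        rw [Submodule.Quotient.mk_smul, fiber_smul, ← TensorProduct.smul_tmul, ← fiber_smul]
        rfl))
  have hL₀ : (RingHom.ker x • ⊤ : Submodule R (M ⊗[R] N)) ≤ LinearMap.ker L₀ := by
    rw [Submodule.smul_le]
    intro r hr t _
    rw [LinearMap.mem_ker, map_smul]
    induction t with
    | zero => rw [map_zero, smul_zero]
    | add s t hs ht => rw [map_add, smul_add, hs trivial, ht trivial, add_zero]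
    | tmul m n =>
      change (r • (Submodule.Quotient.mk m : Fiber x M)) ⊗ₜ[k] _ = 0
      rw [fiber_smul, (RingHom.mem_ker).1 hr, zero_smul, TensorProduct.zero_tmul]
  let L := Submodule.liftQ _ L₀ hL₀
  constructor
  · refine Function.LeftInverse.injective (g := L) fun v => ?_
    induction v with
    | zero => rw [map_zero, map_zero]
    | add v w hv hw => rw [map_add, map_add, hv, hw]
    | tmul v w =>
      obtain ⟨m, rfl⟩ := Submodule.Quotient.mk_surjective _ v
      obtain ⟨n, rfl⟩ := Submodule.Quotient.mk_surjective _ w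
      rfl
  · intro v
    obtain ⟨t, rfl⟩ := Submodule.Quotient.mk_surjective _ v
    induction t with
    | zero => exact ⟨0, map_zero _⟩
    | add s t hs ht =>
      obtain ⟨v, hv⟩ := hs
      obtain ⟨w, hw⟩ := ht
      exact ⟨v + w, by rw [map_add, hv, hw]; rfl⟩
    | tmul m n => exact ⟨Submodule.Quotient.mk m ⊗ₜ Submodule.Quotient.mk n, rfl⟩

/-- The isomorphism `M/𝔪M ⊗_k N/𝔪N ≅ (M ⊗_R N)/𝔪(M ⊗_R N)`, `[m] ⊗ [n] ↦ [m ⊗ n]`. -/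
def fiberTensorEquiv : Fiber x M ⊗[k] Fiber x N ≃ₗ[k] Fiber x (M ⊗[R] N) :=
  LinearEquiv.ofBijective
    (TensorProduct.lift ((fiberBilin x M N).restrictScalars₁₂ k k)) (fiberBilin_bijective x M N)

@[simp] lemma fiberTensorEquiv_mk (m : M) (n : N) :
    fiberTensorEquiv x M N (Submodule.Quotient.mk m ⊗ₜ Submodule.Quotient.mk n) =
      Submodule.Quotient.mk (m ⊗ₜ n) := rfl

/-- The isomorphism `k ≅ R/𝔪R`, `c ↦ [c]`. -/
def fiberUnitEquiv : k ≃ₗ[k] Fiber x R :=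
  LinearEquiv.ofBijective ((Submodule.mkQ (RingHom.ker x • ⊤ : Submodule R R)).restrictScalars k ∘ₗ
    Algebra.linearMap k R) (by
    constructor
    · refine (injective_iff_map_eq_zero _).2 fun c hc => ?_
      have h : algebraMap k R c ∈ (RingHom.ker x • ⊤ : Submodule R R) :=
        (Submodule.Quotient.mk_eq_zero _).1 hc
      rw [smul_eq_mul, Ideal.mul_top, RingHom.mem_ker, AlgHom.commutes] at h
      exact h
    · intro v
      obtain ⟨r, rfl⟩ := Submodule.Quotient.mk_surjective _ v
      refine ⟨x r, (Submodule.Quotient.eq _).2 ?_⟩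
      rw [smul_eq_mul, Ideal.mul_top, RingHom.mem_ker]
      simp)

variable {M N} in
lemma fiberTensor_natural {M' N' : Type u} [AddCommGroup M'] [AddCommGroup N'] [Module k M']
    [Module k N'] [Module R M'] [Module R N'] [IsScalarTower k R M'] [IsScalarTower k R N']
    (f : M →ₗ[R] M') (g : N →ₗ[R] N') :
    (fiberTensorEquiv x M' N').toLinearMap ∘ₗ TensorProduct.map (fiberMap x f) (fiberMap x g) =
      fiberMap x (TensorProduct.map f g) ∘ₗ (fiberTensorEquiv x M N).toLinearMap := by
  refine TensorProduct.ext' fun v w => ?_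
  obtain ⟨m, rfl⟩ := Submodule.Quotient.mk_surjective _ v
  obtain ⟨n, rfl⟩ := Submodule.Quotient.mk_surjective _ w
  rfl

lemma fiberTensor_assoc (P : Type u) [AddCommGroup P] [Module k P] [Module R P]
    [IsScalarTower k R P] :
    fiberMap x (TensorProduct.assoc R M N P).toLinearMap ∘ₗ
      (fiberTensorEquiv x (M ⊗[R] N) P).toLinearMap ∘ₗ
      TensorProduct.map (fiberTensorEquiv x M N).toLinearMap LinearMap.id =
    (fiberTensorEquiv x M (N ⊗[R] P)).toLinearMap ∘ₗ
      TensorProduct.map LinearMap.id (fiberTensorEquiv x N P).toLinearMap ∘ₗ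
      (TensorProduct.assoc k (Fiber x M) (Fiber x N) (Fiber x P)).toLinearMap := by
  refine TensorProduct.ext_threefold fun v w z => ?_
  obtain ⟨m, rfl⟩ := Submodule.Quotient.mk_surjective _ v
  obtain ⟨n, rfl⟩ := Submodule.Quotient.mk_surjective _ w
  obtain ⟨p, rfl⟩ := Submodule.Quotient.mk_surjective _ z
  rfl

lemma fiberTensor_leftUnit :
    (TensorProduct.lid k (Fiber x M)).toLinearMap =
    fiberMap x (TensorProduct.lid R M).toLinearMap ∘ₗ
      (fiberTensorEquiv x R M).toLinearMap ∘ₗ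
      TensorProduct.map (fiberUnitEquiv x).toLinearMap LinearMap.id := by
  refine TensorProduct.ext' fun c v => ?_
  obtain ⟨m, rfl⟩ := Submodule.Quotient.mk_surjective _ v
  exact congrArg Submodule.Quotient.mk (algebraMap_smul R c m).symm

lemma fiberTensor_rightUnit :
    (TensorProduct.rid k (Fiber x M)).toLinearMap =
    fiberMap x (TensorProduct.rid R M).toLinearMap ∘ₗ
      (fiberTensorEquiv x M R).toLinearMap ∘ₗ
      TensorProduct.map LinearMap.id (fiberUnitEquiv x).toLinearMap := by
  refine TensorProduct.ext' fun v c => ?_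
  obtain ⟨m, rfl⟩ := Submodule.Quotient.mk_surjective _ v
  exact congrArg Submodule.Quotient.mk (algebraMap_smul R c m).symm

end Tensor

variable [MulSemiringAction (GLInf k) R] [IsGLAlgebra k R]

/-- The functor `Mod_R ⥤ Vec_k`, `M ↦ M/𝔪M`. -/
def fiberFunctor : ModR k R ⥤ ModuleCat.{u} k where
  obj M := ModuleCat.of k (Fiber x M.obj.carrier)
  map f := ModuleCat.ofHom (fiberMap x f.hom.lin)
  map_id _ := ModuleCat.hom_ext (fiberMap_id x _)
  map_comp f g := ModuleCat.hom_ext (fiberMap_comp x _ _ f.hom.lin g.hom.lin)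

/-- The isomorphism `M/𝔪M ⊗_k N/𝔪N ≅ (M ⊗_R N)/𝔪(M ⊗_R N)` in `Vec_k`. -/
def fiberTensorIso (M N : ModR k R) :
    (fiberFunctor x).obj M ⊗ (fiberFunctor x).obj N ≅ (fiberFunctor x).obj (M ⊗ N) where
  hom := ModuleCat.ofHom (fiberTensorEquiv x M.obj.carrier N.obj.carrier).toLinearMap
  inv := ModuleCat.ofHom (fiberTensorEquiv x M.obj.carrier N.obj.carrier).symm.toLinearMap
  hom_inv_id := ModuleCat.hom_ext (LinearEquiv.symm_comp _)
  inv_hom_id := ModuleCat.hom_ext (LinearEquiv.comp_symm _)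

/-- The isomorphism `k ≅ R/𝔪R` in `Vec_k`. -/
def fiberUnitIso : 𝟙_ (ModuleCat.{u} k) ≅ (fiberFunctor x).obj (𝟙_ (ModR k R)) where
  hom := ModuleCat.ofHom (fiberUnitEquiv x).toLinearMap
  inv := ModuleCat.ofHom (fiberUnitEquiv x).symm.toLinearMap
  hom_inv_id := ModuleCat.hom_ext (LinearEquiv.symm_comp _)
  inv_hom_id := ModuleCat.hom_ext (LinearEquiv.comp_symm _)

set_option maxHeartbeats 1000000 in
lemma fiberTensorIso_natural_left {M M' : ModR k R} (f : M ⟶ M') (N : ModR k R) :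
    (fiberFunctor x).map f ▷ (fiberFunctor x).obj N ≫ (fiberTensorIso x M' N).hom =
      (fiberTensorIso x M N).hom ≫ (fiberFunctor x).map (f ▷ N) := by
  apply ModuleCat.hom_ext
  have h := fiberTensor_natural x f.hom.lin (LinearMap.id (R := R) (M := N.obj.carrier))
  rw [fiberMap_id] at h
  exact h

set_option maxHeartbeats 1000000 in
lemma fiberTensorIso_natural_right {M M' : ModR k R} (N : ModR k R) (f : M ⟶ M') :
    (fiberFunctor x).obj N ◁ (fiberFunctor x).map f ≫ (fiberTensorIso x N M').hom =
      (fiberTensorIso x N M).hom ≫ (fiberFunctor x).map (N ◁ f) := by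
  apply ModuleCat.hom_ext
  have h := fiberTensor_natural x (LinearMap.id (R := R) (M := N.obj.carrier)) f.hom.lin
  rw [fiberMap_id] at h
  exact h

set_option maxHeartbeats 1000000 in
lemma fiberTensorIso_assoc (M N P : ModR k R) :
    (fiberTensorIso x M N).hom ▷ (fiberFunctor x).obj P ≫ (fiberTensorIso x (M ⊗ N) P).hom ≫
      (fiberFunctor x).map (α_ M N P).hom =
    (α_ _ _ _).hom ≫ (fiberFunctor x).obj M ◁ (fiberTensorIso x N P).hom ≫
      (fiberTensorIso x M (N ⊗ P)).hom := by
  apply ModuleCat.hom_ext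
  exact fiberTensor_assoc x M.obj.carrier N.obj.carrier P.obj.carrier

set_option maxHeartbeats 1000000 in
lemma fiberTensorIso_leftUnit (M : ModR k R) :
    (λ_ ((fiberFunctor x).obj M)).hom =
    (fiberUnitIso x).hom ▷ (fiberFunctor x).obj M ≫ (fiberTensorIso x (𝟙_ _) M).hom ≫
      (fiberFunctor x).map (λ_ M).hom := by
  apply ModuleCat.hom_ext
  exact fiberTensor_leftUnit x M.obj.carrier

set_option maxHeartbeats 1000000 in
lemma fiberTensorIso_rightUnit (M : ModR k R) :
    (ρ_ ((fiberFunctor x).obj M)).hom =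
    (fiberFunctor x).obj M ◁ (fiberUnitIso x).hom ≫ (fiberTensorIso x M (𝟙_ _)).hom ≫
      (fiberFunctor x).map (ρ_ M).hom := by
  apply ModuleCat.hom_ext
  exact fiberTensor_rightUnit x M.obj.carrier

/-- The monoidal structure of `M ↦ M/𝔪M`, given by `k ≅ R/𝔪R` and
`M/𝔪M ⊗_k N/𝔪N ≅ (M ⊗_R N)/𝔪(M ⊗_R N)`. -/
instance : (fiberFunctor x).Monoidal :=
  Functor.CoreMonoidal.toMonoidal
    { εIso := fiberUnitIso x
      μIso := fiberTensorIso x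
      μIso_hom_natural_left := fiberTensorIso_natural_left x
      μIso_hom_natural_right := fiberTensorIso_natural_right x
      associativity := fiberTensorIso_assoc x
      left_unitality := fiberTensorIso_leftUnit x
      right_unitality := fiberTensorIso_rightUnit x }

end Fiber


/-! ### Generic points and fiber functors -/

section Generic

variable {k : Type u} [Field k] {R : Type u} [CommRing R] [MulSemiringAction (GLInf k) R]

/-- The action of an element `g` of `GL` on `X = Spec(R)`: the point `𝔭` is sent to `g 𝔭`, that
is, to the preimage of `𝔭` under the automorphism of `R` given by `g⁻¹`. -/
def specAct (g : GLInf k) (p : PrimeSpectrum R) : PrimeSpectrum R :=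
  PrimeSpectrum.comap (MulSemiringAction.toRingHom (GLInf k) R g⁻¹) p

/-- A point of `X = Spec(R)` is `GL`-generic if the Zariski closure of its `GL`-orbit is `X`. -/
def IsGLGeneric (k : Type u) [Field k] [MulSemiringAction (GLInf k) R]
    (p : PrimeSpectrum R) : Prop :=
  closure (Set.range fun g : GLInf k => specAct g p) = Set.univ

/-- The point of `X = Spec(R)` underlying a `k`-point, i.e. the maximal ideal of the `k`-point. -/
def kPoint [Algebra k R] (x : R →ₐ[k] k) : PrimeSpectrum R :=
  ⟨RingHom.ker x, RingHom.ker_isPrime x⟩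

end Generic

/-- A fiber functor on `Mod_K` is a symmetric monoidal functor `Mod_K ⥤ Vec_k` that is exact
(it preserves finite limits and finite colimits), faithful, cocontinuous and `k`-linear. -/
structure IsFiberFunctor {k : Type u} [Field k] {K : Type u} [Field K] [Algebra k K]
    [MulSemiringAction (GLInf k) K] [IsGLField k K] (Φ : ModK k K ⥤ ModuleCat.{u} k)
    [Φ.Braided] : Prop where
  preservesFiniteLimits : Limits.PreservesFiniteLimits Φ
  preservesFiniteColimits : Limits.PreservesFiniteColimits Φ
  faithful : Φ.Faithful
  preservesColimits : Limits.PreservesColimitsOfSize.{u, u} Φ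
  additive : Φ.Additive
  linear : Φ.Linear k

end GLRep

end

/-! Mod_K is a localization of Mod_R. The right adjoint `polFunctor` of `extendModR` takes
polynomial vectors, and its counit is invertible: fractions over R have common denominators, and the
objects of Mod_K consist by definition of multiples of polynomial vectors. A functor on Mod_K is
thus the same as a functor on Mod_R that inverts the morphisms becoming invertible over K, which
have torsion kernel and cokernel. Once M ↦ M/𝔪M is known to invert them, the functor, its monoidal
structure and its uniqueness all come from the universal property; concretely the functor is
`genericFiber`, the fiber of the module of polynomial vectors.

The key is an equivariant generic freeness (`TensorFamily.isGenericallyFree_wordSpan`,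
`exists_isGenericallyFree`): finitely many elements of a polynomial module lie in a stable submodule
that becomes free after inverting a single f ≠ 0. Some translate of f does not vanish at a generic
point x, and the submodule is stable, so it is free near x (`IsGenericallyFree.isFreeAt`). Hence
taking the fiber at x is exact on Mod_R (`exists_eq_of_mem_smul_top`), it kills torsion modules
(`smul_top_eq_top_of_torsion`), and it does not kill a nonzero torsion-free module
(`eq_zero_of_smul_top_eq_top`). The first two facts give inversion and left exactness, and the first
and third give faithfulness. Cocontinuity holds because the adjunction of `fiberFunctor` with
`coindFunctor` descends to the localization.

For generic freeness, polarization in characteristic 0 writes each vector as a combination of values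
of finitely many GL-equivariant multilinear maps on 𝕍 (`IsPolynomial.exists_multilinear`). These are
evaluated on words in the basis vectors. Modulo words with fewer than D large letters, the words of
top degree D follow finitely many patterns. A pattern either is reducible to earlier ones, at the
cost of a leading coefficient, or is standard. The product of the leading coefficients is inverted.
Standard words are independent, since unipotent elements of GL can move the letters of any relation
arbitrarily far out and so turn it into a uniform reduction. The remaining words come from a family
of smaller degree, to which induction applies. -/

noncomputable section

namespace GLRep

/-! ### Polynomial functions of one scalar, as a substitute for Zariski closure. -/

section PolynomialFunctions

variable {k : Type u} [Field k] {U V : Type*} [AddCommMonoid U] [Module k U] [AddCommMonoid V]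
  [Module k V]

/-- A function of one scalar variable with values in a vector space is polynomial. -/
def IsPolyFun (φ : k → V) : Prop :=
  ∃ (m : ℕ) (c : ℕ → V), ∀ t, φ t = ∑ j ∈ Finset.range m, t ^ j • c j

lemma IsPolyFun.zero : IsPolyFun (fun _ : k => (0 : V)) := ⟨0, 0, by simp⟩

lemma IsPolyFun.monomial (n : ℕ) (v : V) : IsPolyFun (fun t : k => t ^ n • v) := by
  classical
  exact ⟨n + 1, fun j => if j = n then v else 0, fun t => by simp⟩

lemma IsPolyFun.add {φ ψ : k → V} (hφ : IsPolyFun φ) (hψ : IsPolyFun ψ) :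
    IsPolyFun (fun t => φ t + ψ t) := by
  obtain ⟨m, c, hc⟩ := hφ
  obtain ⟨n, d, hd⟩ := hψ
  refine ⟨m + n, fun j => (if j < m then c j else 0) + (if j < n then d j else 0), fun t => ?_⟩
  simp only [smul_add, Finset.sum_add_distrib, smul_ite, smul_zero, hc, hd]
  rw [← Finset.sum_filter, ← Finset.sum_filter]
  congr 2 <;> ext j <;> simp <;> omega

lemma IsPolyFun.sum {ι : Type*} (s : Finset ι) {φ : ι → k → V} (h : ∀ i ∈ s, IsPolyFun (φ i)) :
    IsPolyFun (fun t => ∑ i ∈ s, φ i t) := by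
  classical
  induction s using Finset.induction_on with
  | empty => simpa using IsPolyFun.zero
  | insert a s ha ih =>
    simp only [Finset.sum_insert ha]
    exact (h a (by simp)).add (ih fun i hi => h i (by simp [hi]))

lemma IsPolyFun.map {φ : k → V} (hφ : IsPolyFun φ) (f : V →ₗ[k] U) :
    IsPolyFun (fun t => f (φ t)) := by
  obtain ⟨m, c, hc⟩ := hφ
  exact ⟨m, fun j => f (c j), fun t => by simp [hc]⟩

/-- Composing with a linear functional on V/S gives a scalar polynomial with infinitely many roots,
hence zero; functionals separate the points of V/S. -/
lemma coeff_mem_of_forall_mem [Infinite k] (S : Submodule k V) (m : ℕ) (c : ℕ → V)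
    (h : ∀ t : k, t ≠ 0 → ∑ j ∈ Finset.range m, t ^ j • c j ∈ S) (j : ℕ) (hj : j < m) :
    c j ∈ S := by
  let _ : AddCommGroup V := Module.addCommMonoidToAddCommGroup k
  rw [← Submodule.Quotient.mk_eq_zero, ← Module.forall_dual_apply_eq_zero_iff k]
  intro φ
  let p : Polynomial k := ∑ j ∈ Finset.range m, Polynomial.monomial j (φ (S.mkQ (c j)))
  have hp : p = 0 := by
    refine Polynomial.eq_zero_of_infinite_isRoot p
      (Set.Infinite.mono ?_ (Set.infinite_univ.sdiff (Set.finite_singleton (0 : k))))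
    rintro t ⟨-, ht⟩
    have := congrArg φ ((Submodule.Quotient.mk_eq_zero S).2 (h t ht))
    change φ (S.mkQ _) = _ at this
    simp only [map_sum, map_smul, map_zero, smul_eq_mul] at this
    simp only [Set.mem_ofPred_eq, Polynomial.IsRoot.def, p, Polynomial.eval_finsetSum,
      Polynomial.eval_monomial]
    rw [← this]
    exact Finset.sum_congr rfl fun j _ => mul_comm _ _
  have := congrArg (fun q => Polynomial.coeff q j) hp
  simpa [p, Polynomial.finsetSum_coeff, Polynomial.coeff_monomial, hj] using this

/-- The limit t → 0. It lets degenerations of elements of GL be used although they are not in GL. -/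
lemma IsPolyFun.apply_zero_mem [Infinite k] {φ : k → V} (hφ : IsPolyFun φ) (S : Submodule k V)
    (h : ∀ t : k, t ≠ 0 → φ t ∈ S) : φ 0 ∈ S := by
  obtain ⟨m, c, hc⟩ := hφ
  rw [hc]
  refine S.sum_mem fun j hj => S.smul_mem _ ?_
  exact coeff_mem_of_forall_mem S m c (fun t ht => hc t ▸ h t ht) j (Finset.mem_range.1 hj)

/-- Here B is the set of arguments where the term t • b is chosen; the top power of t belongs to B =
ι. -/
lemma multilinear_add_smul {ι : Type*} [Fintype ι] [DecidableEq ι] {X : Type*} [AddCommMonoid X]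
    [Module k X] (x : MultilinearMap k (fun _ : ι => X) V) (a b : ι → X) (t : k) :
    x (fun j => a j + t • b j) = ∑ B : Finset ι, t ^ B.card • x (B.piecewise b a) := by
  have h : (fun j => a j + t • b j) = (fun j => t • b j) + a := by
    funext j; simp [add_comm]
  rw [h, x.map_add_univ]
  refine Finset.sum_congr rfl fun B _ => ?_
  have := x.map_piecewise_smul (fun _ => t) (B.piecewise b a) B
  rw [Finset.prod_const] at this
  rw [← this]
  congr 1
  funext j
  by_cases hj : j ∈ B <;> simp [hj]

lemma isPolyFun_multilinear {ι : Type*} [Fintype ι] {X : Type*} [AddCommMonoid X]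
    [Module k X] (x : MultilinearMap k (fun _ : ι => X) V) (a b : ι → X) :
    IsPolyFun (fun t : k => x (fun j => a j + t • b j)) := by
  classical
  simp only [multilinear_add_smul]
  exact IsPolyFun.sum _ fun B _ => IsPolyFun.monomial _ _

end PolynomialFunctions

/-! ### Shears: explicit elements of GL that degenerate to linear maps. -/

section Shear

variable {k : Type u} [Field k]

/-- The projection of `𝕍` onto the span of the basis vectors indexed by `E`. -/
def coordProj (k : Type u) [Field k] (E : Finset ℕ) : (ℕ →₀ k) →ₗ[k] (ℕ →₀ k) :=
  ∑ i ∈ E, Finsupp.lsingle i ∘ₗ Finsupp.lapply i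

lemma coordProj_eq_sum (E : Finset ℕ) (v : ℕ →₀ k) :
    coordProj k E v = ∑ i ∈ E, Finsupp.single i (v i) := by
  simp [coordProj]

lemma coordProj_apply (E : Finset ℕ) (v : ℕ →₀ k) (j : ℕ) :
    coordProj k E v j = if j ∈ E then v j else 0 := by
  simp [coordProj_eq_sum, Finsupp.finsetSum_apply, Finsupp.single_apply]

lemma coordProj_eq_self {E : Finset ℕ} {v : ℕ →₀ k} (h : v.support ⊆ E) :
    coordProj k E v = v := by
  ext j
  rw [coordProj_apply]
  split_ifs with hj
  · rfl
  · by_contra h0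
    exact hj (h (Finsupp.mem_support_iff.2 (Ne.symm h0)))

lemma coordProj_comp_self (E : Finset ℕ) : coordProj k E ∘ₗ coordProj k E = coordProj k E := by
  refine LinearMap.ext fun v => Finsupp.ext fun j => ?_
  simp only [LinearMap.comp_apply, coordProj_apply]
  split_ifs <;> rfl

/-- The linear map `f` is supported on the coordinates in `E`, and its image avoids them. -/
structure IsShear (E : Finset ℕ) (f : (ℕ →₀ k) →ₗ[k] (ℕ →₀ k)) : Prop where
  comp_proj : f ∘ₗ coordProj k E = f
  proj_comp : coordProj k E ∘ₗ f = 0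

variable {E : Finset ℕ} {f : (ℕ →₀ k) →ₗ[k] (ℕ →₀ k)}

lemma IsShear.smul (h : IsShear E f) (t : k) : IsShear E (t • f) :=
  ⟨by rw [LinearMap.smul_comp, h.1], by rw [LinearMap.comp_smul, h.2, smul_zero]⟩

lemma IsShear.comp_self (h : IsShear E f) : f ∘ₗ f = 0 := by
  nth_rw 1 [← h.1]
  rw [LinearMap.comp_assoc, h.2, LinearMap.comp_zero]

lemma IsShear.apply (h : IsShear E f) (v : ℕ →₀ k) :
    f v = ∑ i ∈ E, v i • f (Finsupp.single i 1) := by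
  conv_lhs => rw [← h.1, LinearMap.comp_apply, coordProj_eq_sum, map_sum]
  refine Finset.sum_congr rfl fun i _ => ?_
  rw [← map_smul, Finsupp.smul_single, smul_eq_mul, mul_one]

/-- The linear map `1 + (c - 1) P + f`, where `P` is the projection to the coordinates in `E`. -/
def shearMap (E : Finset ℕ) (c : k) (f : (ℕ →₀ k) →ₗ[k] (ℕ →₀ k)) :
    (ℕ →₀ k) →ₗ[k] (ℕ →₀ k) :=
  LinearMap.id + (c - 1) • coordProj k E + f

lemma IsShear.shearMap_comp (h : IsShear E f) {c : k} (hc : c ≠ 0) :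
    shearMap E c f ∘ₗ shearMap E c⁻¹ (-c⁻¹ • f) = LinearMap.id := by
  refine LinearMap.ext fun v => ?_
  have h1 : ∀ w, f (coordProj k E w) = f w := fun w => LinearMap.congr_fun h.1 w
  have h2 : ∀ w, coordProj k E (f w) = 0 := fun w => LinearMap.congr_fun h.2 w
  have h3 : ∀ w, f (f w) = 0 := fun w => LinearMap.congr_fun h.comp_self w
  have h4 : ∀ w, coordProj k E (coordProj k E w) = coordProj k E w :=
    fun w => LinearMap.congr_fun (coordProj_comp_self E) w
  simp only [shearMap, LinearMap.comp_apply, LinearMap.add_apply, LinearMap.smul_apply,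
    LinearMap.id_apply, map_add, map_smul, h1, h2, h3, h4]
  have : (c⁻¹ - 1) + (c - 1) + (c - 1) * (c⁻¹ - 1) = 0 := by field_simp; ring
  match_scalars
  · rfl
  · linear_combination this
  · ring

/-- The element `1 + (c - 1) P + f` of `GL`. -/
def shear (h : IsShear E f) {c : k} (hc : c ≠ 0) : GLInf k :=
  ⟨LinearEquiv.ofLinearMap (shearMap E c f) (shearMap E c⁻¹ (-c⁻¹ • f)) (h.shearMap_comp hc) (by
      have := (h.smul (-c⁻¹)).shearMap_comp (inv_ne_zero hc)
      rwa [inv_inv, smul_smul, neg_mul_neg, mul_inv_cancel₀ hc, one_smul] at this), by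
    -- The bound lies beyond E and beyond every coordinate occurring in the image of f.
    refine ⟨(E ∪ E.biUnion fun i => (f (Finsupp.single i 1)).support).sup id + 1,
      fun i hi => ?_⟩
    have hi' : i ∉ E ∪ E.biUnion fun i => (f (Finsupp.single i 1)).support := fun hmem => by
      have := Finset.le_sup (f := id) hmem
      simp only [id] at this
      omega
    simp only [Finset.mem_union, Finset.mem_biUnion, not_or, not_exists, not_and,
      Finsupp.mem_support_iff, not_not] at hi'
    have hf : ∀ v, f v i = 0 := fun v => by
      rw [h.apply, Finsupp.finsetSum_apply]
      exact Finset.sum_eq_zero fun j hj => by simp [hi'.2 j hj]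
    constructor
    · have h0 : coordProj k E (Finsupp.single i 1) = 0 := by
        rw [coordProj_eq_sum]
        exact Finset.sum_eq_zero fun j hj => by
          have hji : j ≠ i := fun e => hi'.1 (e ▸ hj)
          simp [hji]
      have h1 : f (Finsupp.single i 1) = 0 := by
        rw [← h.1, LinearMap.comp_apply, h0, map_zero]
      change shearMap E c f _ = _
      simp [shearMap, h0, h1]
    · intro v
      change shearMap E c f v i = _
      simp [shearMap, coordProj_apply, hi'.1, hf]⟩

lemma stdRep_shear (h : IsShear E f) {c : k} (hc : c ≠ 0) :
    stdRep k (shear h hc) = shearMap E c f := rfl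

end Shear

/-! ### Endomorphisms of 𝕍 acting on sums of tensor powers. -/

section TensorFunctor

variable {k : Type u} [Field k] {ι : Type u} (d : ι → ℕ)

/-- The action of an endomorphism of `𝕍` on a direct sum of tensor powers. -/
def tensorSumMap (f : (ℕ →₀ k) →ₗ[k] (ℕ →₀ k)) :
    (DirectSum ι fun i => ⨂[k]^(d i) (ℕ →₀ k)) →ₗ[k] DirectSum ι fun i => ⨂[k]^(d i) (ℕ →₀ k) :=
  DirectSum.lmap fun _ => PiTensorProduct.map fun _ => f

lemma directSum_tensorPowerRep (g : GLInf k) :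
    Representation.directSum (fun i => tensorPowerRep k (d i)) g = tensorSumMap d (stdRep k g) :=
  rfl

lemma tensorSumMap_lof [DecidableEq ι] (f : (ℕ →₀ k) →ₗ[k] (ℕ →₀ k)) (i : ι)
    (w : ⨂[k]^(d i) (ℕ →₀ k)) :
    tensorSumMap d f (DirectSum.lof k ι (fun i => ⨂[k]^(d i) (ℕ →₀ k)) i w) =
      DirectSum.lof k ι (fun i => ⨂[k]^(d i) (ℕ →₀ k)) i (PiTensorProduct.map (fun _ => f) w) :=
  DirectSum.lmap_lof _ _ _

lemma tensorSum_induction {p : (DirectSum ι fun i => ⨂[k]^(d i) (ℕ →₀ k)) → Prop}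
    [DecidableEq ι] (h0 : p 0) (hadd : ∀ v w, p v → p w → p (v + w))
    (hof : ∀ i (r : k) v, p (DirectSum.lof k ι (fun i => ⨂[k]^(d i) (ℕ →₀ k)) i
      (r • PiTensorProduct.tprod k v))) (w) : p w := by
  induction w using DirectSum.induction_on with
  | zero => exact h0
  | of i w =>
    induction w using PiTensorProduct.induction_on with
    | smul_tprod r v => exact hof i r v
    | add v w hv hw => rw [map_add]; exact hadd _ _ hv hw
  | add v w hv hw => exact hadd _ _ hv hw

lemma tensorSumMap_comp (f g : (ℕ →₀ k) →ₗ[k] (ℕ →₀ k)) (w) :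
    tensorSumMap d (f ∘ₗ g) w = tensorSumMap d f (tensorSumMap d g w) := by
  classical
  induction w using tensorSum_induction with
  | h0 => simp
  | hadd v w hv hw => simp only [map_add, hv, hw]
  | hof i r v => simp only [map_smul, tensorSumMap_lof, PiTensorProduct.map_tprod]; rfl

lemma isPolyFun_tensorSumMap (f g : (ℕ →₀ k) →ₗ[k] (ℕ →₀ k)) (w) :
    IsPolyFun (fun t : k => tensorSumMap d (f + t • g) w) := by
  classical
  induction w using tensorSum_induction with
  | h0 => simpa using IsPolyFun.zero
  | hadd v w hv hw => simpa only [map_add] using hv.add hw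
  | hof i r v =>
    simp only [tensorSumMap_lof, map_smul, PiTensorProduct.map_tprod, LinearMap.add_apply,
      LinearMap.smul_apply]
    exact ((isPolyFun_multilinear (PiTensorProduct.tprod k) _ _).map
      (DirectSum.lof k ι (fun i => ⨂[k]^(d i) (ℕ →₀ k)) i)).map (r • LinearMap.id)

lemma exists_tensorSumMap_coordProj (w : DirectSum ι fun i => ⨂[k]^(d i) (ℕ →₀ k)) :
    ∃ n, ∀ m, n ≤ m → tensorSumMap d (coordProj k (Finset.range m)) w = w := by
  classical
  induction w using tensorSum_induction with
  | h0 => exact ⟨0, fun m _ => map_zero _⟩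
  | hadd v w hv hw =>
    obtain ⟨n₁, h₁⟩ := hv
    obtain ⟨n₂, h₂⟩ := hw
    exact ⟨max n₁ n₂, fun m hm => by
      rw [map_add, h₁ m (le_trans (le_max_left _ _) hm), h₂ m (le_trans (le_max_right _ _) hm)]⟩
  | hof i r v =>
    refine ⟨(Finset.univ.biUnion fun j => (v j).support).sup id + 1, fun m hm => ?_⟩
    simp only [tensorSumMap_lof, map_smul, PiTensorProduct.map_tprod]
    congr 3
    funext j
    refine coordProj_eq_self fun a ha => Finset.mem_range.2 ?_
    have : a ∈ Finset.univ.biUnion fun j => (v j).support :=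
      Finset.mem_biUnion.2 ⟨j, Finset.mem_univ _, ha⟩
    have := Finset.le_sup (f := id) this
    simp only [id] at this
    omega

end TensorFunctor

/-! ### Unipotent one-parameter subgroups act polynomially. -/

section PolynomialAction

variable {k : Type u} [Field k]

lemma shearMap_one {E : Finset ℕ} (f : (ℕ →₀ k) →ₗ[k] (ℕ →₀ k)) :
    shearMap E 1 f = LinearMap.id + f := by
  simp [shearMap]

lemma shear_smul_zero {E : Finset ℕ} {f : (ℕ →₀ k) →ₗ[k] (ℕ →₀ k)} (h : IsShear E f) :
    shear (h.smul 0) one_ne_zero = 1 :=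
  Subtype.ext (LinearEquiv.ext fun v => by
    change shearMap E 1 ((0 : k) • f) v = v
    simp [shearMap_one])

variable {V : Type u} [AddCommMonoid V] [Module k V] {ρ : Representation k (GLInf k) V}

/-- On a sum of tensor powers the action of 1 + t f is visibly polynomial in t. The property passes
to a subquotient because the coefficients of the polynomial already lie in the subrepresentation. -/
lemma IsPolynomial.isPolyFun_shear [Infinite k] (hρ : IsPolynomial ρ) {E : Finset ℕ}
    {f : (ℕ →₀ k) →ₗ[k] (ℕ →₀ k)} (h : IsShear E f) (v : V) :
    IsPolyFun (fun t : k => ρ (shear (h.smul t) one_ne_zero) v) := by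
  obtain ⟨ι, d, S, p, hp⟩ := hρ
  obtain ⟨⟨s, hs⟩, rfl⟩ := hp v
  obtain ⟨m, c, hc⟩ := isPolyFun_tensorSumMap d LinearMap.id f s
  have hmem : ∀ t : k, tensorSumMap d (LinearMap.id + t • f) s ∈ S.toSubmodule := fun t => by
    have := S.apply_mem_toSubmodule (shear (h.smul t) one_ne_zero) hs
    rwa [directSum_tensorPowerRep, stdRep_shear, shearMap_one] at this
  have hcS : ∀ j < m, c j ∈ S.toSubmodule :=
    coeff_mem_of_forall_mem S.toSubmodule m c fun t _ => hc t ▸ hmem t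
  refine ⟨m, fun j => if hj : j < m then p ⟨c j, hcS j hj⟩ else 0, fun t => ?_⟩
  have h1 : ρ (shear (h.smul t) one_ne_zero) (p ⟨s, hs⟩) =
      p ⟨tensorSumMap d (LinearMap.id + t • f) s, hmem t⟩ := by
    refine (p.isIntertwining _ _ _ _).symm.trans (congrArg p (Subtype.ext ?_))
    change tensorSumMap d (stdRep k (shear (h.smul t) one_ne_zero)) s = _
    rw [stdRep_shear, shearMap_one]
  have h2 : (⟨tensorSumMap d (LinearMap.id + t • f) s, hmem t⟩ : S.toSubmodule) =
      ∑ j : Fin m, t ^ (j : ℕ) • ⟨c j, hcS j j.2⟩ := Subtype.ext (by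
    simp only [AddSubmonoidClass.coe_finsetSum, Submodule.coe_smul, hc]
    exact Finset.sum_range fun j => t ^ j • c j)
  refine h1.trans ?_
  rw [h2, Finset.sum_range]
  change p.toLinearMap _ = _
  rw [map_sum]
  exact Finset.sum_congr rfl fun j _ => by
    rw [map_smul]
    beta_reduce
    rw [dif_pos j.2]
    rfl

end PolynomialAction

/-! ### Subrepresentations of sums of tensor powers are stable under all of End(𝕍). -/

section Endomorphisms

variable {k : Type u} [Field k]

/-- The linear map `e_i ↦ e_{σ i}` for `i ∈ E`, `e_i ↦ 0` otherwise. -/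
def moveMap (k : Type u) [Field k] (E : Finset ℕ) (σ : ℕ → ℕ) : (ℕ →₀ k) →ₗ[k] (ℕ →₀ k) :=
  ∑ i ∈ E, Finsupp.lsingle (σ i) ∘ₗ Finsupp.lapply i

lemma moveMap_single (E : Finset ℕ) (σ : ℕ → ℕ) (i : ℕ) (r : k) :
    moveMap k E σ (Finsupp.single i r) = if i ∈ E then Finsupp.single (σ i) r else 0 := by
  simp only [moveMap, LinearMap.sum_apply, LinearMap.comp_apply, Finsupp.lsingle_apply,
    Finsupp.lapply_apply]
  split_ifs with h
  · rw [Finset.sum_eq_single_of_mem i h (fun j _ hj => by simp [hj.symm])]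
    simp
  · exact Finset.sum_eq_zero fun j hj => by
      have : i ≠ j := fun e => h (e ▸ hj)
      simp [this]

lemma coordProj_eq_moveMap (E : Finset ℕ) : coordProj k E = moveMap k E id := rfl

lemma moveMap_comp (E E' : Finset ℕ) (σ τ : ℕ → ℕ) :
    moveMap k E σ ∘ₗ moveMap k E' τ = moveMap k (E'.filter fun i => τ i ∈ E) (σ ∘ τ) := by
  refine Finsupp.lhom_ext fun i r => ?_
  simp only [LinearMap.comp_apply, moveMap_single, Finset.mem_filter]
  by_cases h1 : i ∈ E' <;> by_cases h2 : τ i ∈ E <;> simp [h1, h2, moveMap_single]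

lemma moveMap_congr {E E' : Finset ℕ} {σ τ : ℕ → ℕ} (h : E = E') (hσ : ∀ i ∈ E, σ i = τ i) :
    moveMap k E σ = moveMap k E' τ := by
  subst h
  exact Finset.sum_congr rfl fun i hi => by rw [hσ i hi]

lemma moveMap_empty (σ : ℕ → ℕ) : moveMap k ∅ σ = 0 := rfl

variable {ι : Type u} {d : ι → ℕ}
  (S : Subrepresentation (Representation.directSum fun i => tensorPowerRep k (d i)))

/-- For c ≠ 0 the map 1 + (c - 1) P + f is in GL. Its limit 1 - P + f at c = 0 agrees with f on
tensors supported on E, because P is the identity there. -/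
lemma tensorSumMap_mem_of_isShear [Infinite k] {E : Finset ℕ} {f : (ℕ →₀ k) →ₗ[k] (ℕ →₀ k)}
    (h : IsShear E f) {s} (hs : s ∈ S.toSubmodule) (hE : tensorSumMap d (coordProj k E) s = s) :
    tensorSumMap d f s ∈ S.toSubmodule := by
  have := (isPolyFun_tensorSumMap d (LinearMap.id + (-1 : k) • coordProj k E + f) (coordProj k E)
    s).apply_zero_mem S.toSubmodule fun c hc => by
      have := S.apply_mem_toSubmodule (shear h hc) hs
      rw [directSum_tensorPowerRep, stdRep_shear] at this
      have e : LinearMap.id + (-1 : k) • coordProj k E + f + c • coordProj k E =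
          shearMap E c f := LinearMap.ext fun v => by
        simp only [shearMap, LinearMap.add_apply, LinearMap.smul_apply]
        module
      rwa [e]
  rw [zero_smul, add_zero, ← hE, ← tensorSumMap_comp] at this
  have e : (LinearMap.id + (-1 : k) • coordProj k E + f) ∘ₗ coordProj k E = f :=
    LinearMap.ext fun v => by
      have h1 := LinearMap.congr_fun h.comp_proj v
      have h2 := LinearMap.congr_fun (coordProj_comp_self (k := k) E) v
      simp only [LinearMap.comp_apply] at h1 h2
      simp only [LinearMap.comp_apply, LinearMap.add_apply, LinearMap.smul_apply, h1, h2,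
        LinearMap.id_apply]
      module
  rwa [e] at this

/-- A general f is not a shear since its image may meet its source. On the finitely many coordinates
that matter it is a product of two shears: apply f followed by a shift to fresh coordinates, then
shift back. -/
lemma tensorSumMap_mem [Infinite k] (f : (ℕ →₀ k) →ₗ[k] (ℕ →₀ k)) {s}
    (hs : s ∈ S.toSubmodule) : tensorSumMap d f s ∈ S.toSubmodule := by
  obtain ⟨n, hn⟩ := exists_tensorSumMap_coordProj d s
  obtain ⟨m, hnm, hm⟩ : ∃ m, n ≤ m ∧ coordProj k (Finset.range m) ∘ₗ f ∘ₗ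
      coordProj k (Finset.range n) = f ∘ₗ coordProj k (Finset.range n) := by
    let B := (Finset.range n).biUnion fun i => (f (Finsupp.single i 1)).support
    refine ⟨max n (B.sup id + 1), le_max_left _ _, Finsupp.lhom_ext' fun i =>
      LinearMap.ext_ring ?_⟩
    simp only [LinearMap.comp_apply, Finsupp.lsingle_apply,
      coordProj_eq_moveMap (Finset.range n), moveMap_single]
    split_ifs with hi
    · refine coordProj_eq_self fun a ha => Finset.mem_range.2 ?_
      have : a ∈ B := Finset.mem_biUnion.2 ⟨i, hi, ha⟩
      have := Finset.le_sup (f := id) this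
      simp only [id] at this
      omega
    · simp
  -- The window [0, m) contains the support of s and that of its image; A shifts it to [m, 2m), and
  -- B shifts it back.
  let A := moveMap k (Finset.range m) (· + m)
  let B := moveMap k (Finset.Ico m (2 * m)) (· - m)
  have hA : IsShear (Finset.range m) (A ∘ₗ f ∘ₗ coordProj k (Finset.range n)) := by
    constructor
    · simp only [LinearMap.comp_assoc, coordProj_eq_moveMap, moveMap_comp]
      congr 2
      refine moveMap_congr ?_ fun _ _ => rfl
      ext i; simp; omega
    · rw [← LinearMap.comp_assoc, coordProj_eq_moveMap, moveMap_comp, Finset.filter_false_of_mem,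
        moveMap_empty, LinearMap.zero_comp]
      intro i hi; simp
  have hB : IsShear (Finset.Ico m (2 * m)) B := by
    constructor
    · rw [coordProj_eq_moveMap, moveMap_comp]
      refine moveMap_congr ?_ fun _ _ => rfl
      ext i; simp
    · rw [coordProj_eq_moveMap, moveMap_comp, Finset.filter_false_of_mem, moveMap_empty]
      intro i hi
      simp at hi ⊢
      omega
  have h1 := tensorSumMap_mem_of_isShear S hA hs (hn m hnm)
  have h2 := tensorSumMap_mem_of_isShear S hB h1 (by
    rw [← tensorSumMap_comp, ← LinearMap.comp_assoc, coordProj_eq_moveMap, moveMap_comp]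
    congr 2
    rw [Finset.filter_true_of_mem]
    · rfl
    · intro i hi
      simp at hi ⊢
      omega)
  rw [← tensorSumMap_comp, ← LinearMap.comp_assoc, moveMap_comp] at h2
  have h3 : moveMap k ({i ∈ Finset.range m | i + m ∈ Finset.Ico m (2 * m)})
      ((fun x => x - m) ∘ fun x => x + m) = coordProj k (Finset.range m) := by
    rw [coordProj_eq_moveMap]
    refine moveMap_congr ?_ fun i _ => by simp
    ext i; simp; omega
  rw [h3, hm, tensorSumMap_comp, hn n le_rfl] at h2
  exact h2

end Endomorphisms

/-! ### Polarization of multilinear maps. -/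

section Polarization

variable {k : Type*} [Field k] {X W : Type*} [AddCommMonoid X] [Module k X] [AddCommMonoid W]
  [Module k W]

/-- Toggling an element outside A is a sign-reversing involution on the sets containing A. -/
lemma sum_neg_one_pow_card_superset {n : ℕ} (A : Finset (Fin n)) (hA : A ≠ Finset.univ) :
    ∑ B : Finset (Fin n), (if A ⊆ B then (-1 : k) ^ B.card else 0) = 0 := by
  obtain ⟨j, hj⟩ : ∃ j, j ∉ A := by
    by_contra! h
    exact hA (Finset.eq_univ_of_forall h)
  have hAB : ∀ B, A ⊆ insert j B ↔ A ⊆ B := fun B => Finset.subset_insert_iff_of_notMem hj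
  have hAE : ∀ B, A ⊆ B.erase j ↔ A ⊆ B := fun B =>
    ⟨fun h => h.trans (Finset.erase_subset _ _), fun h => Finset.subset_erase.2 ⟨h, hj⟩⟩
  refine Finset.sum_involution (fun B _ => if j ∈ B then B.erase j else insert j B) ?_ ?_ ?_ ?_
  · intro B _
    by_cases hB : j ∈ B
    · simp only [if_pos hB, hAE]
      split_ifs
      · rw [← Finset.card_erase_add_one hB, pow_succ]; ring
      · simp
    · simp only [if_neg hB, hAB]
      split_ifs
      · rw [Finset.card_insert_of_notMem hB, pow_succ]; ring
      · simp
  · intro B _ _ he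
    by_cases hB : j ∈ B
    · rw [if_pos hB] at he; rw [← he] at hB; simp at hB
    · rw [if_neg hB] at he; apply hB; rw [← he]; simp
  · simp
  · intro B _
    by_cases hB : j ∈ B <;> simp [hB]

/-- By inclusion-exclusion over the diagonal values at partial sums of the f j, only the terms
indexed by surjective, hence bijective, maps of indices survive. -/
lemma sum_perm_mem {n : ℕ} (G : MultilinearMap k (fun _ : Fin n => X) W) (U : Submodule k W)
    (h : ∀ f, G (fun _ => f) ∈ U) (f : Fin n → X) :
    ∑ σ : Equiv.Perm (Fin n), G (fun j => f (σ j)) ∈ U := by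
  let _ : AddCommGroup W := Module.addCommMonoidToAddCommGroup k
  have key : ∑ B : Finset (Fin n), (-1 : k) ^ B.card • G (fun _ => ∑ j ∈ B, f j) =
      (-1 : k) ^ n • ∑ σ : Equiv.Perm (Fin n), G (fun j => f (σ j)) := by
    have h1 : ∀ B : Finset (Fin n), (-1 : k) ^ B.card • G (fun _ => ∑ j ∈ B, f j) =
        ∑ r : Fin n → Fin n, (if Finset.univ.image r ⊆ B then (-1 : k) ^ B.card else 0) •
          G (fun j => f (r j)) := by
      intro B
      rw [G.map_sum_finset (fun _ j => f j) (fun _ => B), Finset.smul_sum]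
      simp only [ite_smul, zero_smul]
      rw [← Finset.sum_filter]
      refine Finset.sum_congr ?_ fun _ _ => rfl
      ext r
      simp [Fintype.mem_piFinset, Finset.subset_iff]
    simp only [h1]
    rw [Finset.sum_comm, Finset.smul_sum]
    symm
    refine Finset.sum_of_injOn (fun σ => ⇑σ) (fun a _ b _ hab => DFunLike.coe_injective hab)
      (by simp [Set.MapsTo]) ?_ ?_
    · intro r _ hr
      rw [← Finset.sum_smul, sum_neg_one_pow_card_superset, zero_smul]
      intro hu
      apply hr
      have hs : Function.Surjective r := fun j => by
        have := Finset.mem_univ j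
        rw [← hu] at this
        simpa using this
      exact ⟨Equiv.ofBijective r ⟨Finite.injective_iff_surjective.2 hs, hs⟩, by simp, rfl⟩
    · intro σ _
      have : Finset.univ.image (⇑σ) = Finset.univ := by
        ext j; simp
      rw [← Finset.sum_smul, this, Finset.sum_eq_single Finset.univ]
      · simp
      · intro B _ hB
        rw [if_neg]
        exact fun h => hB (Finset.univ_subset_iff.1 h)
      · simp
  have h2 : (-1 : k) ^ n • ∑ σ : Equiv.Perm (Fin n), G (fun j => f (σ j)) ∈ U := by
    rw [← key]
    exact U.sum_mem fun B _ => U.smul_mem _ (h _)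
  have h3 := U.smul_mem ((-1 : k) ^ n) h2
  rwa [smul_smul, ← mul_pow, neg_one_mul, neg_neg, one_pow, one_smul] at h3

end Polarization

/-! ### Vectors of polynomial representations as values of equivariant multilinear maps. -/

section TensorFamily

variable {k : Type u} [Field k] {ι : Type u} (d : ι → ℕ)

/-- The multilinear map `(f₁, …, fₑ) ↦ f₁ ⊗ ⋯ ⊗ fₑ` on the summands of degree `e`. -/
def homogeneousMap (e : ℕ) (i : ι) :
    MultilinearMap k (fun _ : Fin e => (ℕ →₀ k) →ₗ[k] (ℕ →₀ k))
      ((⨂[k]^(d i) (ℕ →₀ k)) →ₗ[k] ⨂[k]^(d i) (ℕ →₀ k)) :=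
  if h : d i = e then
    (PiTensorProduct.mapMultilinear k (fun _ : Fin (d i) => ℕ →₀ k)
      (fun _ : Fin (d i) => ℕ →₀ k)).domDomCongr (finCongr h)
  else 0

lemma homogeneousMap_diag (e : ℕ) (i : ι) (f : (ℕ →₀ k) →ₗ[k] (ℕ →₀ k)) :
    homogeneousMap d e i (fun _ => f) = if d i = e then PiTensorProduct.map fun _ => f else 0 := by
  unfold homogeneousMap
  split_ifs <;> rfl

lemma map_homogeneousMap (e : ℕ) (i : ι) (g : (ℕ →₀ k) →ₗ[k] (ℕ →₀ k))
    (f : Fin e → (ℕ →₀ k) →ₗ[k] (ℕ →₀ k)) (w : ⨂[k]^(d i) (ℕ →₀ k)) :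
    PiTensorProduct.map (fun _ => g) (homogeneousMap d e i f w) =
      homogeneousMap d e i (fun j => g ∘ₗ f j) w := by
  unfold homogeneousMap
  split_ifs with h
  · exact (LinearMap.congr_fun (PiTensorProduct.map_comp (fun _ : Fin (d i) => g)
      (fun j => f (finCongr h j))) w).symm
  · simp

/-- The multilinear map `(f₁, …, fₑ) ↦ (f₁ ⊗ ⋯ ⊗ fₑ) s`, on the part of `s` of degree `e`. -/
def homogeneousPart (e : ℕ) (s : DirectSum ι fun i => ⨂[k]^(d i) (ℕ →₀ k)) :
    MultilinearMap k (fun _ : Fin e => (ℕ →₀ k) →ₗ[k] (ℕ →₀ k))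
      (DirectSum ι fun i => ⨂[k]^(d i) (ℕ →₀ k)) where
  toFun f := DirectSum.lmap (fun i => homogeneousMap d e i f) s
  map_update_add' f j a b := by
    refine DFinsupp.ext fun i => ?_
    erw [DFinsupp.add_apply]
    simp only [DirectSum.lmap_apply, MultilinearMap.map_update_add, LinearMap.add_apply]
  map_update_smul' f j c a := by
    refine DFinsupp.ext fun i => ?_
    erw [DFinsupp.smul_apply]
    simp only [DirectSum.lmap_apply, MultilinearMap.map_update_smul, LinearMap.smul_apply]

lemma homogeneousPart_apply (e : ℕ) (s : DirectSum ι fun i => ⨂[k]^(d i) (ℕ →₀ k))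
    (f : Fin e → (ℕ →₀ k) →ₗ[k] (ℕ →₀ k)) (i : ι) :
    homogeneousPart d e s f i = homogeneousMap d e i f (s i) :=
  DirectSum.lmap_apply _ _ _

lemma tensorSumMap_homogeneousPart (e : ℕ) (s : DirectSum ι fun i => ⨂[k]^(d i) (ℕ →₀ k))
    (g : (ℕ →₀ k) →ₗ[k] (ℕ →₀ k)) (f : Fin e → (ℕ →₀ k) →ₗ[k] (ℕ →₀ k)) :
    tensorSumMap d g (homogeneousPart d e s f) = homogeneousPart d e s (fun j => g ∘ₗ f j) := by
  refine DFinsupp.ext fun i => ?_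
  rw [homogeneousPart_apply, ← map_homogeneousMap, ← homogeneousPart_apply]
  exact DirectSum.lmap_apply _ _ _

lemma exists_sum_homogeneousPart (s : DirectSum ι fun i => ⨂[k]^(d i) (ℕ →₀ k)) :
    ∃ N, ∀ f : (ℕ →₀ k) →ₗ[k] (ℕ →₀ k),
      tensorSumMap d f s = ∑ e ∈ Finset.range N, homogeneousPart d e s fun _ => f := by
  classical
  refine ⟨(DFinsupp.support s).sup d + 1, fun f => DFinsupp.ext fun i => ?_⟩
  erw [DFinsupp.finsetSum_apply]
  simp only [homogeneousPart_apply, homogeneousMap_diag]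
  by_cases hi : s i = 0
  · refine (DirectSum.lmap_apply _ _ _).trans ?_
    simp [hi]
  · have : d i < (DFinsupp.support s).sup d + 1 :=
      Nat.lt_succ_of_le (Finset.le_sup (DFinsupp.mem_support_iff.2 hi))
    rw [Finset.sum_eq_single (d i) (fun b _ hb => by rw [if_neg hb.symm]; rfl)
      (fun h => absurd (Finset.mem_range.2 this) h), if_pos rfl]
    exact DirectSum.lmap_apply _ _ _

/-- Replacing f by t f scales the part of degree e by t ^ e, so the homogeneous parts are
coefficients of a polynomial in t with values in S. -/
lemma homogeneousPart_mem [Infinite k]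
    (S : Subrepresentation (Representation.directSum fun i => tensorPowerRep k (d i))) {s}
    (hs : s ∈ S.toSubmodule) {N : ℕ} (hN : ∀ f : (ℕ →₀ k) →ₗ[k] (ℕ →₀ k),
      tensorSumMap d f s = ∑ e ∈ Finset.range N, homogeneousPart d e s fun _ => f) (e : ℕ)
    (he : e < N) (f : (ℕ →₀ k) →ₗ[k] (ℕ →₀ k)) :
    homogeneousPart d e s (fun _ => f) ∈ S.toSubmodule := by
  refine coeff_mem_of_forall_mem S.toSubmodule N
    (fun e => homogeneousPart d e s fun _ => f) (fun t _ => ?_) e he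
  have := tensorSumMap_mem S (t • f) hs
  rw [hN] at this
  convert this using 2 with e
  have := (homogeneousPart d e s).map_smul_univ (fun _ => t) (fun _ => f)
  simpa using this.symm

/-- The rank one map `w ↦ w_i v`. -/
def rankOne (k : Type u) [Field k] (i : ℕ) : (ℕ →₀ k) →ₗ[k] (ℕ →₀ k) →ₗ[k] (ℕ →₀ k) :=
  LinearMap.smulRightₗ (Finsupp.lapply i)

lemma coordProj_eq_sum_rankOne (n : ℕ) :
    coordProj k (Finset.range n) = ∑ i : Fin n, rankOne k i (Finsupp.single (i : ℕ) 1) := by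
  rw [coordProj, Finset.sum_range]
  refine Finset.sum_congr rfl fun i _ => LinearMap.ext fun v => ?_
  simp [rankOne]

variable {M : Type u} [AddCommMonoid M] [Module k M] {ρ : Representation k (GLInf k) M}

/-- Lift m to s in a subrepresentation S of a sum of tensor powers. The diagonal values of each
homogeneous part lie in S, hence so do its symmetrizations by polarization. Feeding these with rank
one maps gives maps multilinear in vectors of 𝕍, and they are equivariant because g composed with w
↦ w_i v is w ↦ w_i (g v). -/
lemma IsPolynomial.exists_multilinear [CharZero k] (hρ : IsPolynomial ρ) (m : M) :
    ∃ (A : Type) (_ : Fintype A) (d : A → ℕ)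
      (x : ∀ a, MultilinearMap k (fun _ : Fin (d a) => ℕ →₀ k) M),
      (∀ g a v, ρ g (x a v) = x a fun j => stdRep k g (v j)) ∧
      m ∈ Submodule.span k (Set.range fun p : Σ a, Fin (d a) → ℕ →₀ k => x p.1 p.2) := by
  obtain ⟨ι, d, S, p, hp⟩ := hρ
  obtain ⟨⟨s, hs⟩, rfl⟩ := hp m
  obtain ⟨N, hN⟩ := exists_sum_homogeneousPart d s
  obtain ⟨n, hn⟩ := exists_tensorSumMap_coordProj d s
  let H (e : ℕ) (a : Fin e → Fin n) :
      MultilinearMap k (fun _ : Fin e => ℕ →₀ k) (DirectSum ι fun i => ⨂[k]^(d i) (ℕ →₀ k)) :=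
    (∑ σ : Equiv.Perm (Fin e), (homogeneousPart d e s).domDomCongr σ).compLinearMap
      fun j => rankOne k (a j)
  have hH : ∀ e a v, H e a v =
      ∑ σ : Equiv.Perm (Fin e), homogeneousPart d e s fun j => rankOne k (a (σ j)) (v (σ j)) := by
    intro e a v
    simp [H]
  have hHS : ∀ e < N, ∀ a v, H e a v ∈ S.toSubmodule := fun e he a v => by
    rw [hH]
    exact sum_perm_mem (homogeneousPart d e s) S.toSubmodule
      (homogeneousPart_mem d S hs hN e he) fun j => rankOne k (a j) (v j)
  let x (q : Σ e : Fin N, Fin e → Fin n) : MultilinearMap k (fun _ : Fin q.1 => ℕ →₀ k) M :=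
    p.toLinearMap.compMultilinearMap
      ((H q.1 q.2).codRestrict S.toSubmodule (hHS q.1 q.1.2 q.2))
  refine ⟨Σ e : Fin N, Fin e → Fin n, inferInstance, fun q => q.1, x, fun g q v => ?_, ?_⟩
  · refine (p.isIntertwining _ _ g _).symm.trans (congrArg p (Subtype.ext ?_))
    change tensorSumMap d (stdRep k g) (H q.1 q.2 v) = H q.1 q.2 fun j => stdRep k g (v j)
    simp only [hH, map_sum, tensorSumMap_homogeneousPart]
    refine Finset.sum_congr rfl fun σ _ => congrArg _ (funext fun j => LinearMap.ext fun w => ?_)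
    simp [rankOne]
  -- The projection onto the first n coordinates fixes s and is a sum of rank one maps. Expanding
  -- each homogeneous part along this sum recovers it up to the factor e!, since all permutations
  -- contribute equally; this is where characteristic 0 is needed.
  · have h1 : ∀ e, homogeneousPart d e s (fun _ => coordProj k (Finset.range n)) =
        (Nat.factorial e : k)⁻¹ • ∑ a : Fin e → Fin n,
          H e a fun j => Finsupp.single (a j : ℕ) 1 := by
      intro e
      have h2 : ∑ a : Fin e → Fin n, H e a (fun j => Finsupp.single (a j : ℕ) 1) =
          (Nat.factorial e : k) •
            homogeneousPart d e s (fun _ => coordProj k (Finset.range n)) := by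
        simp only [hH]
        rw [Finset.sum_comm, coordProj_eq_sum_rankOne]
        have h3 : ∀ σ : Equiv.Perm (Fin e), ∑ a : Fin e → Fin n, homogeneousPart d e s (fun j =>
            rankOne k (a (σ j)) (Finsupp.single (a (σ j) : ℕ) 1)) = homogeneousPart d e s
            (fun _ => ∑ i : Fin n, rankOne k i (Finsupp.single (i : ℕ) 1)) := by
          intro σ
          rw [MultilinearMap.map_sum]
          exact Equiv.sum_comp (Equiv.arrowCongr σ.symm (Equiv.refl (Fin n))) (fun a =>
            homogeneousPart d e s fun j => rankOne k (a j) (Finsupp.single (a j : ℕ) 1))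
        rw [Finset.sum_congr rfl fun σ _ => h3 σ, Finset.sum_const, Finset.card_univ,
          Fintype.card_perm, Fintype.card_fin, Nat.cast_smul_eq_nsmul]
      rw [h2, smul_smul, inv_mul_cancel₀ (Nat.cast_ne_zero.2 (Nat.factorial_ne_zero e)), one_smul]
    have h4 : (⟨s, hs⟩ : S.toSubmodule) = ∑ e : Fin N, (Nat.factorial e : k)⁻¹ •
        ∑ a : Fin e → Fin n, (H e a).codRestrict S.toSubmodule (hHS e e.2 a)
          fun j => Finsupp.single (a j : ℕ) 1 := Subtype.ext (by
      simp only [AddSubmonoidClass.coe_finsetSum, Submodule.coe_smul,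
        MultilinearMap.codRestrict_apply_coe, ← h1]
      rw [← Finset.sum_range fun e =>
        homogeneousPart d e s fun _ => coordProj k (Finset.range n), ← hN, hn n le_rfl])
    rw [h4]
    change p.toLinearMap _ ∈ _
    simp only [map_sum, map_smul]
    refine Submodule.sum_mem _ fun e _ => Submodule.smul_mem _ _ (Submodule.sum_mem _ fun a _ =>
      Submodule.subset_span ⟨⟨⟨e, a⟩, fun j => Finsupp.single (a j : ℕ) 1⟩, rfl⟩)

end TensorFamily

/-! ### Freeness after inverting one element. -/

section GenericFreeness

variable {R M : Type*} [CommRing R] [AddCommGroup M] [Module R M]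

/-- The elements of a module that are multiplied into a submodule by a power of `f`. -/
def powSaturation (f : R) (N : Submodule R M) : Submodule R M where
  carrier := {m | ∃ c : ℕ, f ^ c • m ∈ N}
  zero_mem' := ⟨0, by simp⟩
  add_mem' := by
    rintro a b ⟨c, hc⟩ ⟨d, hd⟩
    refine ⟨c + d, ?_⟩
    rw [smul_add]
    refine N.add_mem ?_ ?_
    · rw [add_comm, pow_add, mul_smul]; exact N.smul_mem _ hc
    · rw [pow_add, mul_smul]; exact N.smul_mem _ hd
  smul_mem' := by
    rintro r a ⟨c, hc⟩
    exact ⟨c, by rw [smul_comm]; exact N.smul_mem _ hc⟩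

lemma le_powSaturation (f : R) (N : Submodule R M) : N ≤ powSaturation f N :=
  fun m hm => ⟨0, by simpa using hm⟩

lemma powSaturation_mono (f : R) {N N' : Submodule R M} (h : N ≤ N') :
    powSaturation f N ≤ powSaturation f N' :=
  fun _ ⟨c, hc⟩ => ⟨c, h hc⟩

lemma mem_powSaturation_of_smul_mem {f : R} {N : Submodule R M} {m : M}
    (h : f • m ∈ powSaturation f N) : m ∈ powSaturation f N := by
  obtain ⟨c, hc⟩ := h
  exact ⟨c + 1, by rwa [pow_succ, mul_smul]⟩

lemma powSaturation_dvd {f g : R} (h : f ∣ g) (N : Submodule R M) :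
    powSaturation f N ≤ powSaturation g N := by
  rintro m ⟨c, hc⟩
  obtain ⟨a, rfl⟩ := h
  exact ⟨c, by rw [mul_pow, mul_comm, mul_smul]; exact N.smul_mem _ hc⟩

lemma powSaturation_idem (f : R) (N : Submodule R M) :
    powSaturation f (powSaturation f N) ≤ powSaturation f N := by
  rintro m ⟨c, d, hd⟩
  exact ⟨d + c, by rwa [pow_add, mul_smul]⟩

/-- A submodule is generically free if, after inverting a single nonzero element `f`, it becomes
free on elements of the submodule. -/
def IsGenericallyFree (N : Submodule R M) : Prop :=
  ∃ f : R, f ≠ 0 ∧ ∃ (B : Type) (y : B → M), (∀ b, y b ∈ N) ∧ LinearIndependent R y ∧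
    N ≤ powSaturation f (Submodule.span R (Set.range y))

lemma isGenericallyFree_bot [Nontrivial R] : IsGenericallyFree (⊥ : Submodule R M) :=
  ⟨1, one_ne_zero, PEmpty, PEmpty.elim, fun b => b.elim, linearIndependent_empty_type, bot_le⟩

/-- Extensions of generically free modules: `hind` and `hspan` say that y becomes a basis of N/N'
over R[1/f], and it is completed by a basis for N'. -/
lemma IsGenericallyFree.extend [IsDomain R] {N N' : Submodule R M} (hN' : IsGenericallyFree N')
    (hle : N' ≤ N) {f : R} (hf : f ≠ 0) {B : Type} (y : B → M) (hy : ∀ b, y b ∈ N)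
    (hind : ∀ r : B →₀ R, Finsupp.linearCombination R y r ∈ N' → r = 0)
    (hspan : N ≤ powSaturation f (Submodule.span R (Set.range y) ⊔ N')) :
    IsGenericallyFree N := by
  obtain ⟨f', hf', B', y', hy', hind', hspan'⟩ := hN'
  refine ⟨f * f', mul_ne_zero hf hf', B ⊕ B', Sum.elim y y', ?_, ?_, ?_⟩
  · rintro (b | b)
    · exact hy b
    · exact hle (hy' b)
  · refine LinearIndependent.sum_type (linearIndependent_iff.2 fun l hl => hind l (hl ▸ N'.zero_mem))
      hind' (Submodule.disjoint_def.2 fun z hz hz' => ?_)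
    obtain ⟨l, rfl⟩ := (Finsupp.mem_span_range_iff_exists_finsupp).1 hz
    have : Submodule.span R (Set.range y') ≤ N' :=
      Submodule.span_le.2 (by rintro _ ⟨b, rfl⟩; exact hy' b)
    have := hind l (this hz')
    subst this
    simp
  · have h1 : Submodule.span R (Set.range y) ⊔ N' ≤
        powSaturation (f * f') (Submodule.span R (Set.range (Sum.elim y y'))) := by
      rw [Set.Sum.elim_range, Submodule.span_union]
      refine sup_le (le_sup_left.trans (le_powSaturation _ _)) ?_
      exact hspan'.trans ((powSaturation_dvd (Dvd.intro_left f rfl) _).trans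
        (powSaturation_mono _ le_sup_right))
    exact hspan.trans ((powSaturation_dvd (Dvd.intro f' rfl) _).trans
      ((powSaturation_mono _ h1).trans (powSaturation_idem _ _)))

end GenericFreeness

/-! ### Families of multilinear maps evaluated on words, and their behaviour under shears. -/

section TensorFamilies

variable (k : Type u) [Field k]

/-- The basis vectors of `𝕍` given by the letters of a word. -/
def basisWord {ι : Type*} (I : ι → ℕ) : ι → ℕ →₀ k := fun j => Finsupp.single (I j) 1

/-- A finite family of multilinear maps from `𝕍` to `M`. -/
structure TensorFamily (M : Type*) [AddCommGroup M] [Module k M] where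
  /-- The index set. -/
  A : Type
  [fintypeA : Fintype A]
  /-- The index sets of the arguments. -/
  ι : A → Type
  [fintypeι : ∀ a, Fintype (ι a)]
  /-- The multilinear maps. -/
  x : ∀ a, MultilinearMap k (fun _ : ι a => ℕ →₀ k) M

attribute [instance] TensorFamily.fintypeA TensorFamily.fintypeι

variable {k}

lemma multilinear_expand {M ι : Type*} [AddCommGroup M] [Module k M] [Fintype ι]
    [DecidableEq ι] (x : MultilinearMap k (fun _ : ι => ℕ →₀ k) M) (v : ι → ℕ →₀ k) :
    x v = ∑ I ∈ Fintype.piFinset fun j => (v j).support,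
      (∏ j, v j (I j)) • x (basisWord k I) := by
  have h : v = fun j => ∑ i ∈ (v j).support, v j i • Finsupp.single i (1 : k) := by
    funext j
    conv_lhs => rw [← Finsupp.sum_single (v j)]
    exact Finset.sum_congr rfl fun i _ => by simp
  conv_lhs => rw [h, x.map_sum_finset]
  exact Finset.sum_congr rfl fun I _ => x.map_smul_univ _ _

variable {R : Type u} [CommRing R] [Algebra k R] [MulSemiringAction (GLInf k) R]

namespace TensorFamily

variable {M : EquivariantModule k (GLInf k) R} (F : TensorFamily k M.carrier)

/-- The `R`-span of the values on words with letters `≥ n`. -/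
def wordSpan (n : ℕ) : Submodule R M.carrier :=
  Submodule.span R {m | ∃ (a : F.A) (I : F.ι a → ℕ), (∀ j, n ≤ I j) ∧ m = F.x a (basisWord k I)}

/-- The `R`-span of the values on words with letters `≥ n`, of which fewer than `D` are `≥ n'`. -/
def lowSpan (n D n' : ℕ) : Submodule R M.carrier :=
  Submodule.span R {m | ∃ (a : F.A) (I : F.ι a → ℕ), (∀ j, n ≤ I j) ∧
    (Finset.univ.filter fun j => n' ≤ I j).card < D ∧ m = F.x a (basisWord k I)}

/-- The family is equivariant for the unipotent elements of `GL` that fix `e_i` for `i < n`. -/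
def IsEquivariant (n : ℕ) : Prop :=
  ∀ (E : Finset ℕ) (f : (ℕ →₀ k) →ₗ[k] (ℕ →₀ k)) (h : IsShear E f),
    (∀ i < n, f (Finsupp.single i 1) = 0) → ∀ (a : F.A) (v : F.ι a → ℕ →₀ k),
      M.ρ (shear h one_ne_zero) (F.x a v) = F.x a fun j => v j + f (v j)

variable {F}

lemma lowSpan_le_wordSpan (n D n' : ℕ) : F.lowSpan n D n' ≤ F.wordSpan n :=
  Submodule.span_mono fun _ ⟨a, I, h, _, e⟩ => ⟨a, I, h, e⟩

lemma lowSpan_mono (n D : ℕ) {n₁ n₂ : ℕ} (h : n₁ ≤ n₂) : F.lowSpan n D n₁ ≤ F.lowSpan n D n₂ :=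
  Submodule.span_mono fun _ ⟨a, I, h1, h2, e⟩ => ⟨a, I, h1, lt_of_le_of_lt
    (Finset.card_le_card fun j => by
      simp only [Finset.mem_filter, Finset.mem_univ, true_and]; omega) h2, e⟩

lemma mem_lowSpan {n D n' : ℕ} (a : F.A) (v : F.ι a → ℕ →₀ k)
    (hn : ∀ j, ∀ i ∈ (v j).support, n ≤ i) (B : Finset (F.ι a)) (hB : B.card < D)
    (hv : ∀ j ∉ B, ∀ i ∈ (v j).support, i < n') : F.x a v ∈ F.lowSpan n D n' := by
  classical
  rw [multilinear_expand]
  refine Submodule.sum_mem _ fun I hI => ?_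
  rw [Fintype.mem_piFinset] at hI
  rw [← algebraMap_smul R]
  refine Submodule.smul_mem _ _ (Submodule.subset_span ⟨a, I, fun j => hn j _ (hI j), ?_, rfl⟩)
  refine lt_of_le_of_lt (Finset.card_le_card fun j hj => ?_) hB
  by_contra hjB
  have := hv j hjB _ (hI j)
  simp only [Finset.mem_filter, Finset.mem_univ, true_and] at hj
  omega

lemma basisWord_support {ι : Type*} {I : ι → ℕ} {j : ι} {i : ℕ}
    (h : i ∈ (basisWord k I j).support) : i = I j := by
  rw [basisWord, Finsupp.mem_support_iff, Finsupp.single_apply] at h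
  by_contra hne
  exact h (if_neg fun e => hne e.symm)

/-- Letters below n₁ are fixed, so letters that are at least n₂ can only appear at the fewer than D
positions whose letter was already at least n₁. -/
lemma shear_mem_lowSpan {n D n₁ n₂ : ℕ} (hF : F.IsEquivariant n) (h₁ : n ≤ n₁) (h₂ : n₁ ≤ n₂)
    {E : Finset ℕ} {f : (ℕ →₀ k) →ₗ[k] (ℕ →₀ k)} (h : IsShear E f)
    (hf : ∀ i < n₁, f (Finsupp.single i 1) = 0) (hf' : ∀ v, ∀ i ∈ (f v).support, n₂ ≤ i)
    {m : M.carrier} (hm : m ∈ F.lowSpan n D n₁) :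
    M.ρ (shear h one_ne_zero) m ∈ F.lowSpan n D n₂ := by
  induction hm using Submodule.span_induction with
  | zero => rw [map_zero]; exact Submodule.zero_mem _
  | add x y _ _ hx hy => rw [map_add]; exact Submodule.add_mem _ hx hy
  | smul r x _ hx => rw [M.ρ_smul]; exact Submodule.smul_mem _ _ hx
  | mem x hx =>
    obtain ⟨a, I, h1, h2, rfl⟩ := hx
    rw [hF E f h (fun i hi => hf i (lt_of_lt_of_le hi h₁))]
    refine mem_lowSpan a _ (fun j i hi => ?_) _ h2 fun j hj i hi => ?_
    · rcases Finset.mem_union.1 (Finsupp.support_add hi) with hi | hi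
      · rw [basisWord_support hi]; exact h1 j
      · exact (h₁.trans h₂).trans (hf' _ i hi)
    · simp only [Finset.mem_filter, Finset.mem_univ, true_and, not_le] at hj
      rw [basisWord, hf _ hj, add_zero] at hi
      have := basisWord_support (k := k) (I := I) hi
      omega

/-- Apply the group element 1 + c f to a relation between words of degree D. Modulo words with fewer
than D letters that are at least n₂, only the term with f in every argument survives, with a factor
c ^ D. The coefficients are moved as well, but they return to r as c → 0. So a relation may be
transported along f without disturbing its coefficients. -/
lemma sum_shift_mem_lowSpan [Infinite k] [IsGLAlgebra k R] {n D n₁ n₂ : ℕ}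
    (hF : F.IsEquivariant n)
    (h₁ : n ≤ n₁) (h₂ : n₁ ≤ n₂) {E : Finset ℕ} {f : (ℕ →₀ k) →ₗ[k] (ℕ →₀ k)} (h : IsShear E f)
    (hf : ∀ i < n₁, f (Finsupp.single i 1) = 0) (hf' : ∀ v, ∀ i ∈ (f v).support, n₂ ≤ i)
    {T : Type*} (s : Finset T) (a : T → F.A) (I : ∀ t, F.ι (a t) → ℕ)
    (hD : ∀ t ∈ s, Fintype.card (F.ι (a t)) = D) (hI : ∀ t ∈ s, ∀ j, n₁ ≤ I t j ∧ I t j < n₂)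
    (r : T → R) (hr : ∑ t ∈ s, r t • F.x (a t) (basisWord k (I t)) ∈ F.lowSpan n D n₁) :
    ∑ t ∈ s, r t • F.x (a t) (fun j => f (basisWord k (I t) j)) ∈ F.lowSpan n D n₂ := by
  classical
  let φ : k → M.carrier := fun c => ∑ t ∈ s,
    (shear (h.smul c) one_ne_zero • r t) • F.x (a t) (fun j => f (basisWord k (I t) j))
  have hφ : IsPolyFun φ := IsPolyFun.sum s fun t _ =>
    ((IsGLAlgebra.isPolynomial (k := k) (R := R)).isPolyFun_shear h (r t)).map
      ((LinearMap.toSpanSingleton R M.carrier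
        (F.x (a t) (fun j => f (basisWord k (I t) j)))).restrictScalars k)
  -- The translated coefficients are polynomial in c because R is a polynomial representation, so it
  -- suffices to treat c ≠ 0, where c ^ D can be cancelled.
  have h0 := hφ.apply_zero_mem ((F.lowSpan n D n₂).restrictScalars k) fun c hc => ?_
  · have h1 := shear_smul_zero h
    simp only [φ, h1, one_smul] at h0
    exact h0
  · have h3 := shear_mem_lowSpan hF h₁ h₂ (h.smul c) (fun i hi => by simp [hf i hi])
      (fun v i hi => hf' v i (Finsupp.support_smul hi)) hr
    have h4 : ∀ t ∈ s, M.ρ (shear (h.smul c) one_ne_zero) (F.x (a t) (basisWord k (I t))) -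
        c ^ D • F.x (a t) (fun j => f (basisWord k (I t) j)) ∈ F.lowSpan n D n₂ := by
      intro t ht
      rw [hF E _ (h.smul c) (fun i hi => by simp [hf i (lt_of_lt_of_le hi h₁)])]
      simp only [LinearMap.smul_apply]
      rw [multilinear_add_smul, ← Finset.add_sum_erase _ _ (Finset.mem_univ Finset.univ),
        Finset.card_univ, hD t ht, Finset.piecewise_univ, add_sub_cancel_left]
      refine Submodule.sum_mem _ fun B hB => ?_
      rw [← algebraMap_smul R]
      refine Submodule.smul_mem _ _ (mem_lowSpan _ _ (fun j i hi => ?_) B ?_ fun j hj i hi => ?_)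
      · by_cases hj : j ∈ B
        · rw [Finset.piecewise_eq_of_mem _ _ _ hj] at hi
          exact (h₁.trans h₂).trans (hf' _ i hi)
        · rw [Finset.piecewise_eq_of_notMem _ _ _ hj] at hi
          rw [basisWord_support hi]
          exact h₁.trans (hI t ht j).1
      · rw [← hD t ht]
        exact Finset.card_lt_univ_of_notMem (Finset.exists_of_ssubset
          ((Finset.ssubset_univ_iff).2 (Finset.mem_erase.1 hB).1)).choose_spec.2
      · rw [Finset.piecewise_eq_of_notMem _ _ _ hj] at hi
        rw [basisWord_support hi]
        exact (hI t ht j).2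
    rw [map_sum] at h3
    have h5 : c ^ D • φ c ∈ F.lowSpan n D n₂ := by
      have := Submodule.sub_mem _ h3 (Submodule.sum_mem _ fun t ht =>
        Submodule.smul_mem _ (shear (h.smul c) one_ne_zero • r t) (h4 t ht))
      convert this using 1
      simp only [φ, Finset.smul_sum]
      rw [← Finset.sum_sub_distrib]
      refine Finset.sum_congr rfl fun t _ => ?_
      rw [M.ρ_smul, ← smul_sub, sub_sub_cancel, smul_comm]
    have h6 := ((F.lowSpan n D n₂).restrictScalars k).smul_mem (c ^ D)⁻¹ h5
    rwa [smul_smul, inv_mul_cancel₀ (pow_ne_zero _ hc), one_smul] at h6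

open scoped Classical in
variable (F) in
/-- The family obtained by substituting basis vectors `e_i` with `n ≤ i < n'` in all but fewer
than `D` of the arguments. -/
abbrev specialize (n D n' : ℕ) : TensorFamily k M.carrier where
  A := Σ (a : F.A) (B : {B : Finset (F.ι a) // B.card < D}),
    ({j // j ∉ B.1} → {i : Fin n' // n ≤ i})
  ι b := {j // j ∈ b.2.1.1}
  x b := (F.x b.1).domDomRestrict (fun j => j ∈ b.2.1.1)
    (basisWord k fun j => ((b.2.2 j).1 : ℕ))

open scoped Classical in
lemma specialize_x (n D n' : ℕ) (a : F.A) (B : {B : Finset (F.ι a) // B.card < D})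
    (u : {j // j ∉ B.1} → {i : Fin n' // n ≤ i}) (v : {j // j ∈ B.1} → ℕ →₀ k) :
    (F.specialize n D n').x ⟨a, B, u⟩ v = F.x a fun j => if h : j ∈ B.1 then v ⟨j, h⟩ else
      basisWord k (fun j => ((u j).1 : ℕ)) ⟨j, h⟩ := rfl

/-- The substituted basis vectors have index below n' and are fixed by the shears in question.
Equivariance under all of GL is lost here, which is why `IsEquivariant` carries a bound. -/
lemma specialize_isEquivariant {n D n' : ℕ} (h : n ≤ n') (hF : F.IsEquivariant n) :
    (F.specialize n D n').IsEquivariant n' := by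
  classical
  rintro E f hE hf ⟨a, B, u⟩ v
  refine (congrArg _ (specialize_x n D n' a B u v)).trans ?_
  rw [hF E f hE fun i hi => hf i (lt_of_lt_of_le hi h)]
  refine Eq.trans ?_ (specialize_x n D n' a B u _).symm
  congr 1
  funext j
  split_ifs
  · rfl
  · rw [basisWord, hf _ (u _).1.2, add_zero]

/-- The step that makes the induction on the degree work: the lower terms are the word span of a
family whose maps have fewer than D arguments, since all small letters are frozen. -/
lemma wordSpan_specialize {n D n' : ℕ} (h : n ≤ n') :
    (F.specialize n D n').wordSpan n' = F.lowSpan n D n' := by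
  classical
  refine le_antisymm (Submodule.span_le.2 ?_) (Submodule.span_le.2 ?_)
  · rintro _ ⟨⟨a, B, u⟩, I, hI, rfl⟩
    refine (specialize_x n D n' a B u _) ▸ ?_
    refine mem_lowSpan _ _ (fun j i hi => ?_) B.1 B.2 fun j hj i hi => ?_
    · split_ifs at hi with hj
      · rw [basisWord_support hi]; exact h.trans (hI _)
      · rw [basisWord_support hi]; exact (u _).2
    · rw [dif_neg hj] at hi
      rw [basisWord_support hi]; exact (u _).1.2
  · rintro _ ⟨a, I, hI, hD, rfl⟩
    let B := Finset.univ.filter fun j => n' ≤ I j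
    have hB : ∀ j, j ∈ B ↔ n' ≤ I j := fun j => by simp [B]
    let u : {j // j ∉ B} → {i : Fin n' // n ≤ i} := fun j =>
      ⟨⟨I j, not_le.1 fun hj => j.2 ((hB _).2 hj)⟩, hI j⟩
    refine Submodule.subset_span ⟨⟨a, ⟨B, hD⟩, u⟩, fun j => I j.1, fun j => (hB j.1).1 j.2,
      (Eq.trans ?_ (specialize_x n D n' a ⟨B, hD⟩ u _).symm)⟩
    congr 1
    funext j
    split_ifs <;> rfl

end TensorFamily

end TensorFamilies

/-! ### Reductions, standard words, and generic freeness by induction on the degree. -/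

section StandardWords

variable {k : Type u} [Field k] {R : Type u} [CommRing R] [Algebra k R]
  [MulSemiringAction (GLInf k) R]

/-- An injective sequence of `D` letters that contains the set `C`, if there is one. -/
def letterEnum (D : ℕ) (C : Finset ℕ) : Fin D → ℕ :=
  open scoped Classical in
  -- The default is reached only if C has more than D elements, which never happens for the letters
  -- of a word of degree D.
  if h : ∃ J : Fin D → ℕ, Function.Injective J ∧ ∀ c ∈ C, ∃ p, J p = c then h.choose else 0

lemma letterEnum_spec {D : ℕ} {C : Finset ℕ} (hC : C.card ≤ D) :
    Function.Injective (letterEnum D C) ∧ ∀ c ∈ C, ∃ p, letterEnum D C p = c := by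
  have h : ∃ J : Fin D → ℕ, Function.Injective J ∧ ∀ c ∈ C, ∃ p, J p = c := by
    obtain ⟨t, hCt, ht⟩ := Infinite.exists_superset_card_eq C D hC
    let e := (t.equivFinOfCardEq ht).symm
    exact ⟨fun p => e p, Subtype.val_injective.comp e.injective,
      fun c hc => ⟨e.symm ⟨c, hCt hc⟩, by simp⟩⟩
  unfold letterEnum
  rw [dif_pos h]
  exact h.choose_spec

namespace TensorFamily

variable {M : EquivariantModule k (GLInf k) R} (F : TensorFamily k M.carrier)

/-- Words in `D` letters, in the arguments of the maps of degree `D`. -/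
abbrev TopWord (D : ℕ) : Type :=
  Σ a : {a : F.A // Fintype.card (F.ι a) = D}, F.ι a.1 → Fin D

variable {F}

/-- A word, with its letters replaced according to `J`. -/
def TopWord.eval {D : ℕ} (w : F.TopWord D) (J : Fin D → ℕ) : M.carrier :=
  F.x w.1.1 (basisWord k fun j => J (w.2 j))

/-- The set of letters of a word. -/
def TopWord.letters {D : ℕ} (w : F.TopWord D) : Finset (Fin D) := Finset.univ.image w.2

/-- The position of a word in a fixed enumeration. -/
def TopWord.rank {D : ℕ} (w : F.TopWord D) : ℕ :=
  open scoped Classical in (Fintype.equivFin (F.TopWord D) w : ℕ)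

lemma TopWord.rank_injective (D : ℕ) :
    Function.Injective (TopWord.rank : F.TopWord D → ℕ) := by
  classical
  intro a b h
  exact (Fintype.equivFin (F.TopWord D)).injective (Fin.ext (by unfold rank at h; convert h))

/-- The coefficients `s` express, modulo lower terms, the word `w` by earlier words with the
same letters. -/
structure IsReduction (n : ℕ) {D : ℕ} (n' : ℕ) (w : F.TopWord D) (s : F.TopWord D → R) :
    Prop where
  ne_zero : s w ≠ 0
  le : ∀ v, s v ≠ 0 → v.rank ≤ w.rank ∧ v.letters = w.letters
  mem : ∀ J : Fin D → ℕ, (∀ p, n' ≤ J p) →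
    open scoped Classical in ∑ v, s v • v.eval J ∈ F.lowSpan n D n'

lemma IsReduction.mono {n D n' n'' : ℕ} {w : F.TopWord D} {s : F.TopWord D → R}
    (h : IsReduction n n' w s) (hn : n' ≤ n'') : IsReduction n n'' w s :=
  ⟨h.1, h.2, fun J hJ => lowSpan_mono n D hn (h.3 J fun p => hn.trans (hJ p))⟩

variable (F) in
-- There are finitely many patterns, and a reduction stays valid when the bound grows, so one bound
-- serves every pattern that is reducible at all.
lemma exists_stable_bound (n D : ℕ) : ∃ n₁, n ≤ n₁ ∧ ∀ w : F.TopWord D,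
    (∃ n' s, IsReduction n n' w s) → ∃ s, IsReduction n n₁ w s := by
  classical
  have h : ∀ w : F.TopWord D, ∃ n', (∃ n' s, IsReduction n n' w s) → ∃ s, IsReduction n n' w s :=
    fun w => by
      by_cases hw : ∃ n' s, IsReduction n n' w s
      · obtain ⟨n', hs⟩ := hw
        exact ⟨n', fun _ => hs⟩
      · exact ⟨0, fun h => absurd h hw⟩
  choose N hN using h
  refine ⟨n + Finset.univ.sup N, Nat.le_add_right _ _, fun w hw => ?_⟩
  obtain ⟨s, hs⟩ := hN w hw
  exact ⟨s, hs.mono ((Finset.le_sup (Finset.mem_univ w)).trans (Nat.le_add_left _ _))⟩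

/-- A word is standard if it has no reduction. -/
def IsStandard (n n₁ : ℕ) {D : ℕ} (w : F.TopWord D) : Prop := ¬ ∃ s, IsReduction n n₁ w s

variable (F) in
/-- Standard words, with a choice of a finite set `C` of letters. -/
abbrev StandardIndex (n D n₁ : ℕ) : Type :=
  {b : Finset ℕ × F.TopWord D // b.2.letters.image (letterEnum D b.1) = b.1 ∧
    IsStandard n n₁ b.2}

/-- The element given by a standard word. -/
def StandardIndex.elem {n D n₁ : ℕ} (b : F.StandardIndex n D n₁) : M.carrier :=
  b.1.2.eval fun p => n₁ + letterEnum D b.1.1 p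

lemma card_le_of_image_letterEnum {D : ℕ} {w : F.TopWord D} {C : Finset ℕ}
    (h : w.letters.image (letterEnum D C) = C) : C.card ≤ D := by
  rw [← h]
  exact Finset.card_image_le.trans ((Finset.card_le_univ _).trans (by simp))

/-- A reduction rewrites s w • w through patterns of smaller rank modulo lower terms, and s w
divides f. These patterns have the same letters, hence the same set C and the same enumeration, so
induction on the rank applies. -/
lemma eval_mem_powSaturation [IsDomain R] {n D n₁ : ℕ} {f : R}
    (hf : ∀ w : F.TopWord D, ¬ IsStandard n n₁ w → ∃ s, IsReduction n n₁ w s ∧ s w ∣ f)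
    (C : Finset ℕ) (r : ℕ) (w : F.TopWord D) (hr : w.rank = r)
    (hw : w.letters.image (letterEnum D C) = C) :
    w.eval (fun p => n₁ + letterEnum D C p) ∈ powSaturation f
      (Submodule.span R (Set.range (StandardIndex.elem (F := F) (n := n) (D := D) (n₁ := n₁))) ⊔
        F.lowSpan n D n₁) := by
  classical
  induction r using Nat.strong_induction_on generalizing w with
  | _ r ih =>
    by_cases hs : IsStandard n n₁ w
    · exact le_powSaturation _ _ (Submodule.mem_sup_left
        (Submodule.subset_span ⟨⟨(C, w), hw, hs⟩, rfl⟩))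
    · obtain ⟨s, hs, a, rfl⟩ := hf w hs
      refine mem_powSaturation_of_smul_mem ?_
      have h1 := hs.mem (fun p => n₁ + letterEnum D C p) fun p => Nat.le_add_right _ _
      rw [← Finset.add_sum_erase _ _ (Finset.mem_univ w)] at h1
      have h2 := le_powSaturation (s w * a) _ (Submodule.mem_sup_right (S := Submodule.span R
        (Set.range (StandardIndex.elem (F := F) (n := n) (D := D) (n₁ := n₁)))) h1)
      have e : (s w * a) • w.eval (fun p => n₁ + letterEnum D C p) =
          a • s w • w.eval (fun p => n₁ + letterEnum D C p) := by rw [mul_comm, mul_smul]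
      rw [e]
      refine Submodule.smul_mem _ a ?_
      refine (Submodule.add_mem_iff_left _ (Submodule.sum_mem _ fun v hv => ?_)).1 h2
      by_cases hv0 : s v = 0
      · rw [hv0, zero_smul]; exact Submodule.zero_mem _
      · obtain ⟨hle, hlet⟩ := hs.le v hv0
        refine Submodule.smul_mem _ _ (ih v.rank ?_ v rfl (by rw [hlet]; exact hw))
        rw [← hr]
        exact lt_of_le_of_ne hle fun h => (Finset.mem_erase.1 hv).1 (TopWord.rank_injective D h)

lemma wordSpan_le_powSaturation [IsDomain R] {n D n₁ : ℕ} {f : R}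
    (hcard : ∀ a, Fintype.card (F.ι a) ≤ D)
    (hf : ∀ w : F.TopWord D, ¬ IsStandard n n₁ w → ∃ s, IsReduction n n₁ w s ∧ s w ∣ f) :
    F.wordSpan n ≤ powSaturation f
      (Submodule.span R (Set.range (StandardIndex.elem (F := F) (n := n) (D := D) (n₁ := n₁))) ⊔
        F.lowSpan n D n₁) := by
  classical
  refine Submodule.span_le.2 ?_
  rintro _ ⟨a, I, hI, rfl⟩
  by_cases hlow : (Finset.univ.filter fun j => n₁ ≤ I j).card < D
  · exact le_powSaturation _ _ (Submodule.mem_sup_right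
      (Submodule.subset_span ⟨a, I, hI, hlow, rfl⟩))
  -- A word with at least D large letters has exactly D arguments and all its letters are large.
  -- Subtracting n₁ from them gives C, and the enumeration of C turns the word into a pattern.
  · have hle := (Finset.card_filter_le Finset.univ fun j => n₁ ≤ I j)
    rw [Finset.card_univ] at hle
    have ha : Fintype.card (F.ι a) = D := le_antisymm (hcard a) ((not_lt.1 hlow).trans hle)
    have hall : ∀ j, n₁ ≤ I j := by
      have : Finset.univ.filter (fun j => n₁ ≤ I j) = Finset.univ :=
        Finset.eq_univ_of_card _ (le_antisymm (by simpa using hle)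
          (by rw [ha]; exact not_lt.1 hlow))
      intro j
      have hj := Finset.mem_univ j
      rw [← this] at hj
      exact (Finset.mem_filter.1 hj).2
    let C : Finset ℕ := Finset.univ.image fun j => I j - n₁
    have hC : C.card ≤ D := Finset.card_image_le.trans (by rw [Finset.card_univ, ha])
    choose ω hω using fun j => (letterEnum_spec hC).2 (I j - n₁)
      (Finset.mem_image_of_mem _ (Finset.mem_univ j))
    have := eval_mem_powSaturation hf C _ ⟨⟨a, ha⟩, ω⟩ rfl (by
      rw [TopWord.letters, Finset.image_image]
      exact Finset.image_congr fun j _ => hω j)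
    have e : TopWord.eval (F := F) ⟨⟨a, ha⟩, ω⟩ (fun p => n₁ + letterEnum D C p) =
        F.x a (basisWord k I) := by
      unfold TopWord.eval
      congr 2
      funext j
      have := hall j
      have := hω j
      dsimp only
      omega
    exact e ▸ this

/-- From a nontrivial relation, keep the words with a letter set C of minimal size: a shear sending
the letters in C to arbitrary far letters J and killing all others annihilates every other word. The
transported relation holds for all far J with fixed coefficients, so it is a reduction of its word
of largest rank, contradicting standardness. -/
lemma linearCombination_elem_eq_zero [Infinite k] [IsGLAlgebra k R] {n D n₁ : ℕ}
    (hF : F.IsEquivariant n) (hn : n ≤ n₁)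
    (hst : ∀ w : F.TopWord D, (∃ n' s, IsReduction n n' w s) → ∃ s, IsReduction n n₁ w s)
    (r : F.StandardIndex n D n₁ →₀ R)
    (hr : Finsupp.linearCombination R StandardIndex.elem r ∈ F.lowSpan n D n₁) : r = 0 := by
  classical
  by_contra hr0
  have hne : r.support.Nonempty := Finsupp.support_nonempty_iff.2 hr0
  obtain ⟨b₁, hb₁, hmin⟩ := Finset.exists_min_image r.support (fun b => b.1.1.card) hne
  set C := b₁.1.1 with hCdef
  have hC : C.card ≤ D := card_le_of_image_letterEnum b₁.2.1
  obtain ⟨hinj, hsurj⟩ := letterEnum_spec hC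
  obtain ⟨b₀, hb₀, hmax⟩ := Finset.exists_max_image (r.support.filter fun b => b.1.1 = C)
    (fun b => b.1.2.rank) ⟨b₁, Finset.mem_filter.2 ⟨hb₁, rfl⟩⟩
  obtain ⟨hb₀, hb₀C⟩ := Finset.mem_filter.1 hb₀
  let N : ℕ := (r.support.biUnion fun b => b.1.1).sup id
  have hN : ∀ b ∈ r.support, ∀ c ∈ b.1.1, c ≤ N := fun b hb c hc =>
    Finset.le_sup (f := id) (Finset.mem_biUnion.2 ⟨b, hb, hc⟩)
  have hletters : ∀ b : F.StandardIndex n D n₁, ∀ j, letterEnum D b.1.1 (b.1.2.2 j) ∈ b.1.1 := by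
    intro b j
    have : letterEnum D b.1.1 (b.1.2.2 j) ∈ b.1.2.letters.image (letterEnum D b.1.1) :=
      Finset.mem_image_of_mem _ (Finset.mem_image_of_mem _ (Finset.mem_univ j))
    rwa [b.2.1] at this
  -- Beyond every letter that occurs in the relation, so the targets of the shear are fresh.
  let n₂ := n₁ + N + 1
  have hlet_eq : ∀ b ∈ r.support, b.1.1 = C → b.1.2.letters = b₀.1.2.letters := by
    intro b _ hbC
    have h1 := b.2.1
    have h2 := b₀.2.1
    rw [hbC] at h1
    rw [hb₀C] at h2
    exact Finset.image_injective hinj (h1.trans h2.symm)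
  let s : F.TopWord D → R := fun w =>
    if h : w.letters.image (letterEnum D C) = C ∧ IsStandard n n₁ w then r ⟨(C, w), h⟩ else 0
  have hs_eq : ∀ b : F.StandardIndex n D n₁, b.1.1 = C → s b.1.2 = r b := by
    rintro ⟨⟨C', w⟩, hb⟩ h
    change C' = C at h
    clear_value C
    subst h
    exact dif_pos hb
  have hred : IsReduction n n₂ b₀.1.2 s := by
    refine ⟨?_, fun w hw => ?_, fun J hJ => ?_⟩
    · rw [hs_eq b₀ hb₀C]
      exact Finsupp.mem_support_iff.1 hb₀
    · by_cases h : w.letters.image (letterEnum D C) = C ∧ IsStandard n n₁ w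
      · have hw' := hs_eq ⟨(C, w), h⟩ rfl
        rw [hw'] at hw
        have hmem := Finsupp.mem_support_iff.2 hw
        exact ⟨hmax _ (Finset.mem_filter.2 ⟨hmem, rfl⟩), hlet_eq _ hmem rfl⟩
      · exact absurd (dif_neg h) hw
    · let E : Finset ℕ := C.map (addLeftEmbedding n₁)
      -- Injectivity of the enumeration lets σ realize any J, even a non-injective one; the default
      -- 0 does not matter, as only the letters in E are moved.
      let σ : ℕ → ℕ := Function.extend (fun p => n₁ + letterEnum D C p) J 0
      have hσ : ∀ p, σ (n₁ + letterEnum D C p) = J p :=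
        Function.Injective.extend_apply (f := fun p => n₁ + letterEnum D C p)
          (fun a b h => hinj (Nat.add_left_cancel h)) J 0
      have hE : ∀ i, n₁ + i ∈ E ↔ i ∈ C := fun i => by simp [E]
      have hEico : ∀ i ∈ E, n₁ ≤ i ∧ i < n₂ := fun i hi => by
        obtain ⟨c, hc, rfl⟩ := Finset.mem_map.1 hi
        have := hN b₁ hb₁ c hc
        simp only [addLeftEmbedding_apply]
        omega
      have hσE : ∀ i ∈ E, n₂ ≤ σ i := fun i hi => by
        obtain ⟨c, hc, rfl⟩ := Finset.mem_map.1 hi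
        obtain ⟨p, rfl⟩ := hsurj c hc
        exact (hσ p).symm ▸ hJ p
      have hshear : IsShear (Finset.Ico n₁ n₂) (moveMap k E σ) := by
        constructor
        · rw [coordProj_eq_moveMap, moveMap_comp]
          refine moveMap_congr ?_ fun _ _ => rfl
          ext i
          simp only [id, Finset.mem_filter, Finset.mem_Ico]
          exact ⟨fun h => h.2, fun h => ⟨hEico i h, h⟩⟩
        · rw [coordProj_eq_moveMap, moveMap_comp, Finset.filter_false_of_mem, moveMap_empty]
          intro i hi
          have := hσE i hi
          simp only [Finset.mem_Ico, not_and, not_lt]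
          omega
      have hsupp : ∀ v, ∀ i ∈ (moveMap k E σ v).support, n₂ ≤ i := by
        intro v i hi
        by_contra hlt
        rw [Finsupp.mem_support_iff] at hi
        apply hi
        simp only [moveMap, LinearMap.sum_apply, LinearMap.comp_apply, Finsupp.finsetSum_apply,
          Finsupp.lsingle_apply]
        refine Finset.sum_eq_zero fun j hj => ?_
        rw [Finsupp.single_apply, if_neg]
        intro h
        have := hσE j hj
        omega
      have h3 := sum_shift_mem_lowSpan (D := D) hF hn (by omega : n₁ ≤ n₂) hshear (fun i hi => by
          rw [moveMap_single, if_neg]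
          intro h
          have := (hEico i h).1
          omega) hsupp r.support (fun b => b.1.2.1.1)
        (fun b j => n₁ + letterEnum D b.1.1 (b.1.2.2 j)) (fun b _ => b.1.2.1.2)
        (fun b hb j => ⟨Nat.le_add_right _ _, by
          have := hN b hb _ (hletters b j)
          omega⟩) r hr
      convert h3 using 1
      symm
      -- Since C has minimal size, a different letter set contains a letter outside C, and the shear
      -- kills the corresponding argument.
      have hzero : ∀ b ∈ r.support, b.1.1 ≠ C → F.x b.1.2.1.1 (fun j => moveMap k E σ
          (basisWord k (fun j => n₁ + letterEnum D b.1.1 (b.1.2.2 j)) j)) = 0 := by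
        intro b hb hbC
        obtain ⟨c, hc, hcC⟩ : ∃ c ∈ b.1.1, c ∉ C := by
          by_contra! h
          exact hbC (Finset.eq_of_subset_of_card_le h (hmin b hb))
        rw [← b.2.1] at hc
        obtain ⟨p, hp, rfl⟩ := Finset.mem_image.1 hc
        obtain ⟨j, -, rfl⟩ := Finset.mem_image.1 hp
        refine (F.x b.1.2.1.1).map_coord_zero j ?_
        rw [basisWord, moveMap_single, if_neg]
        rwa [hE]
      have hone : ∀ b ∈ r.support, b.1.1 = C → F.x b.1.2.1.1 (fun j => moveMap k E σ
          (basisWord k (fun j => n₁ + letterEnum D b.1.1 (b.1.2.2 j)) j)) = b.1.2.eval J := by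
        intro b hb hbC
        unfold TopWord.eval
        congr 1
        funext j
        have := hletters b j
        rw [hbC] at this
        rw [basisWord, hbC, moveMap_single, if_pos ((hE _).2 this), hσ]
        rfl
      rw [← Finset.sum_filter_add_sum_filter_not r.support (fun b => b.1.1 = C),
        Finset.sum_eq_zero (s := r.support.filter fun b => ¬ b.1.1 = C) fun b hb => by
          obtain ⟨hb, hbC⟩ := Finset.mem_filter.1 hb
          rw [hzero b hb hbC, smul_zero], add_zero]
      refine Finset.sum_of_injOn (fun b => b.1.2) ?_ (by simp [Set.MapsTo]) ?_ ?_
      · intro b hb b' hb' h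
        have h1 := (Finset.mem_filter.1 hb).2
        have h2 := (Finset.mem_filter.1 hb').2
        exact Subtype.ext (Prod.ext (h1.trans h2.symm) h)
      · intro w _ hw
        by_cases hw0 : s w = 0
        · rw [hw0, zero_smul]
        · exfalso
          by_cases h : w.letters.image (letterEnum D C) = C ∧ IsStandard n n₁ w
          · have hw' := hs_eq ⟨(C, w), h⟩ rfl
            rw [hw'] at hw0
            exact hw ⟨⟨(C, w), h⟩, by
              simpa using hw0, rfl⟩
          · exact hw0 (dif_neg h)
      · intro b hb
        obtain ⟨hb, hbC⟩ := Finset.mem_filter.1 hb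
        rw [hone b hb hbC, hs_eq b hbC]
  -- The reduction was found with bound n₂; stability of n₁ yields one with bound n₁, where `b₀` is
  -- standard.
  exact b₀.2.2 (hst _ ⟨n₂, s, hred⟩)

/-- Standard words form a basis modulo the lower terms after inverting f, and the lower terms are
generically free by induction. Although there are infinitely many words, only finitely many patterns
are reduced, which is why one f suffices. -/
theorem isGenericallyFree_wordSpan [Infinite k] [IsGLAlgebra k R] [IsDomain R] (D : ℕ)
    (F : TensorFamily k M.carrier) (n : ℕ) (hcard : ∀ a, Fintype.card (F.ι a) < D)
    (hF : F.IsEquivariant n) : IsGenericallyFree (F.wordSpan n) := by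
  classical
  induction D generalizing F n with
  | zero =>
    have : F.wordSpan n = ⊥ := by
      rw [wordSpan, Submodule.span_eq_bot]
      rintro _ ⟨a, -⟩
      exact absurd (hcard a) (Nat.not_lt_zero _)
    rw [this]
    exact isGenericallyFree_bot
  | succ D ih =>
    obtain ⟨n₁, hn, hst⟩ := F.exists_stable_bound n D
    have hlow : IsGenericallyFree (F.lowSpan n D n₁) := by
      rw [← wordSpan_specialize hn]
      refine ih _ n₁ ?_ (specialize_isEquivariant hn hF)
      rintro ⟨a, B, u⟩
      have : Fintype.card {j // j ∈ B.1} = B.1.card := Fintype.card_coe _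
      exact this ▸ B.2
    choose! s hs using fun (w : F.TopWord D) (hw : ¬ IsStandard n n₁ w) => not_not.1 hw
    -- The product of the leading coefficients of the chosen reductions, nonzero because R is a
    -- domain.
    let f : R := ∏ w ∈ Finset.univ.filter fun w => ¬ IsStandard n n₁ w, s w w
    refine hlow.extend (lowSpan_le_wordSpan n D n₁) (f := f)
      (Finset.prod_ne_zero_iff.2 fun w hw => (hs w (Finset.mem_filter.1 hw).2).ne_zero)
      (StandardIndex.elem (F := F) (n := n) (D := D) (n₁ := n₁)) (fun b => ?_)
      (linearCombination_elem_eq_zero hF hn hst)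
      (wordSpan_le_powSaturation (fun a => Nat.le_of_lt_succ (hcard a)) fun w hw =>
        ⟨s w, hs w hw, Finset.dvd_prod_of_mem (fun w => s w w)
          (Finset.mem_filter.2 ⟨Finset.mem_univ w, hw⟩)⟩)
    exact Submodule.subset_span ⟨b.1.2.1.1, fun j => n₁ + letterEnum D b.1.1 (b.1.2.2 j),
      fun j => hn.trans (Nat.le_add_right _ _), rfl⟩

end TensorFamily

end StandardWords

/-! ### Stable submodules and quotients. -/

section Subobjects

variable {k : Type u} [Field k] {G : Type u} [Group G] {R : Type u} [CommRing R] [Algebra k R]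
  [MulSemiringAction G R]

namespace EquivariantModule

variable {M N : EquivariantModule k G R}

/-- A stable submodule of an equivariant module. -/
def sub (M : EquivariantModule k G R) (P : Submodule R M.carrier)
    (hP : ∀ g, ∀ m ∈ P, M.ρ g m ∈ P) : EquivariantModule k G R where
  carrier := P
  ρ :=
    { toFun := fun g => ((M.ρ g).restrict (p := P.restrictScalars k) (q := P.restrictScalars k)
        (hP g))
      map_one' := LinearMap.ext fun m => Subtype.ext (LinearMap.congr_fun (map_one M.ρ) m.1)
      map_mul' := fun g h => LinearMap.ext fun m =>
        Subtype.ext (LinearMap.congr_fun (map_mul M.ρ g h) m.1) }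
  ρ_smul g r m := Subtype.ext (M.ρ_smul g r m.1)

/-- The inclusion of a stable submodule. -/
def subι (P : Submodule R M.carrier) (hP : ∀ g, ∀ m ∈ P, M.ρ g m ∈ P) : M.sub P hP ⟶ M :=
  Hom.mk P.subtype fun _ _ => rfl

/-- The quotient by a stable submodule. -/
def quot (M : EquivariantModule k G R) (P : Submodule R M.carrier)
    (hP : ∀ g, ∀ m ∈ P, M.ρ g m ∈ P) : EquivariantModule k G R where
  carrier := M.carrier ⧸ P
  ρ :=
    { toFun := fun g => ((P.restrictScalars k).mapQ (P.restrictScalars k) (M.ρ g) (hP g))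
      map_one' := LinearMap.ext fun m => by
        obtain ⟨m, rfl⟩ := Submodule.Quotient.mk_surjective _ m
        exact congrArg (Submodule.Quotient.mk (p := P)) (by simp)
      map_mul' := fun g h => LinearMap.ext fun m => by
        obtain ⟨m, rfl⟩ := Submodule.Quotient.mk_surjective _ m
        exact congrArg (Submodule.Quotient.mk (p := P)) (by simp) }
  ρ_smul g r m := by
    obtain ⟨m, rfl⟩ := Submodule.Quotient.mk_surjective _ m
    exact congrArg (Submodule.Quotient.mk (p := P)) (M.ρ_smul g r m)

lemma ker_stable (f : M ⟶ N) (g : G) (m) (hm : m ∈ LinearMap.ker f.lin) :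
    M.ρ g m ∈ LinearMap.ker f.lin := by
  rw [LinearMap.mem_ker] at hm ⊢
  rw [f.comm, hm, map_zero]

lemma range_stable (f : M ⟶ N) (g : G) (m) (hm : m ∈ LinearMap.range f.lin) :
    N.ρ g m ∈ LinearMap.range f.lin := by
  obtain ⟨m, rfl⟩ := hm
  exact ⟨M.ρ g m, f.comm g m⟩

end EquivariantModule

end Subobjects

section PolynomialSubobjects

variable {k : Type u} [Field k] {R : Type u} [CommRing R] [Algebra k R]
  [MulSemiringAction (GLInf k) R] {M : EquivariantModule k (GLInf k) R}

lemma isPolynomial_sub (hM : IsPolynomial M.ρ) (P : Submodule R M.carrier)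
    (hP : ∀ g, ∀ m ∈ P, M.ρ g m ∈ P) : IsPolynomial (M.sub P hP).ρ :=
  hM.of_injective (P.subtype.restrictScalars k) (fun _ _ => rfl) P.subtype_injective

lemma isPolynomial_quot (hM : IsPolynomial M.ρ) (P : Submodule R M.carrier)
    (hP : ∀ g, ∀ m ∈ P, M.ρ g m ∈ P) : IsPolynomial (M.quot P hP).ρ :=
  hM.of_surjective (P.mkQ.restrictScalars k) (fun _ _ => rfl) P.mkQ_surjective

/-- Join the equivariant families attached to the finitely many elements. Every value of the joint
family expands in words, so the span of all words is stable and contains the given elements. -/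
lemma exists_isGenericallyFree [CharZero k] [IsDomain R] [IsGLAlgebra k R]
    (hM : IsPolynomial M.ρ) (s : Finset M.carrier) :
    ∃ N : Submodule R M.carrier, (∀ g, ∀ m ∈ N, M.ρ g m ∈ N) ∧ (∀ m ∈ s, m ∈ N) ∧
      IsGenericallyFree N := by
  choose A hA d x hx hmem using fun m => hM.exists_multilinear m
  let F : TensorFamily k M.carrier :=
    { A := Σ i : Fin s.card, A (s.equivFin.symm i)
      ι := fun a => Fin (d _ a.2)
      x := fun a => x _ a.2 }
  have hall : ∀ (a : F.A) v, F.x a v ∈ F.wordSpan 0 := fun a v => by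
    classical
    rw [multilinear_expand]
    refine Submodule.sum_mem _ fun I _ => ?_
    rw [← algebraMap_smul R]
    exact Submodule.smul_mem _ _ (Submodule.subset_span ⟨a, I, fun _ => Nat.zero_le _, rfl⟩)
  refine ⟨F.wordSpan 0, fun g m hm => ?_, fun m hm => ?_, ?_⟩
  · induction hm using Submodule.span_induction with
    | zero => rw [map_zero]; exact Submodule.zero_mem _
    | add x y _ _ hx hy => rw [map_add]; exact Submodule.add_mem _ hx hy
    | smul r x _ hx => rw [M.ρ_smul]; exact Submodule.smul_mem _ _ hx
    | mem m hm =>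
      obtain ⟨a, I, -, rfl⟩ := hm
      rw [hx]
      exact hall a _
  · obtain ⟨i, hi⟩ := s.equivFin.symm.surjective ⟨m, hm⟩
    have h1 : (s.equivFin.symm i : M.carrier) = m := congrArg Subtype.val hi
    have h2 := hmem (s.equivFin.symm i)
    rw [h1] at h2
    refine (Submodule.span_le (p := (F.wordSpan 0).restrictScalars k)).2 ?_ h2
    rintro _ ⟨⟨a, v⟩, rfl⟩
    subst h1
    exact hall ⟨i, a⟩ v
  · refine TensorFamily.isGenericallyFree_wordSpan (Finset.univ.sup (fun a : F.A => d _ a.2) + 1)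
      F 0 (fun a => ?_) fun E f h _ a v => ?_
    · rw [Fintype.card_fin]
      exact Nat.lt_succ_of_le (Finset.le_sup (f := fun a : F.A => d _ a.2) (Finset.mem_univ a))
    · rw [hx]
      congr 1
      funext j
      rw [stdRep_shear, shearMap_one]
      rfl

end PolynomialSubobjects

/-! ### Freeness near a generic point and its consequences for fibers. -/

section FreeAt

variable {k : Type u} [Field k] {R : Type u} [CommRing R] [Algebra k R]

/-- A submodule that becomes free on a principal open neighbourhood of the point `x`. -/
def IsFreeAt (x : R →ₐ[k] k) {M : Type*} [AddCommGroup M] [Module R M] (N : Submodule R M) :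
    Prop :=
  ∃ f : R, x f ≠ 0 ∧ ∃ (B : Type) (y : B → M), (∀ b, y b ∈ N) ∧ LinearIndependent R y ∧
    N ≤ powSaturation f (Submodule.span R (Set.range y))

lemma mem_smul_top_iff {R M : Type*} [CommRing R] [AddCommGroup M] [Module R M] {I : Ideal R}
    {z : M} : z ∈ (I • ⊤ : Submodule R M) ↔
      ∃ a : M →₀ R, (∀ i, a i ∈ I) ∧ Finsupp.linearCombination R id a = z := by
  have := Submodule.mem_ideal_smul_span_iff_exists_sum I (id : M → M) z
  rw [Set.range_id, Submodule.span_univ] at this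
  rw [this]
  exact ⟨fun ⟨a, h, e⟩ => ⟨a, h, e⟩, fun ⟨a, h, e⟩ => ⟨a, h, e⟩⟩

/-- An element not vanishing at x is invertible modulo 𝔪, with inverse the scalar 1 / x(f). -/
lemma mem_ker_smul_top_of_unit {M : Type*} [AddCommGroup M] [Module R M] (x : R →ₐ[k] k) {f : R}
    (hf : x f ≠ 0) {m : M} (hm : f • m ∈ (RingHom.ker x • ⊤ : Submodule R M)) :
    m ∈ (RingHom.ker x • ⊤ : Submodule R M) := by
  have h1 : 1 - algebraMap k R (x f)⁻¹ * f ∈ RingHom.ker x := by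
    rw [RingHom.mem_ker, map_sub, map_one, map_mul, AlgHom.commutes]
    simp [hf]
  have h2 : m = (1 - algebraMap k R (x f)⁻¹ * f) • m + algebraMap k R (x f)⁻¹ • f • m := by
    rw [sub_smul, one_smul, mul_smul]; abel
  rw [h2]
  exact Submodule.add_mem _ (Submodule.smul_mem_smul h1 Submodule.mem_top)
    (Submodule.smul_mem _ _ hm)

/-- Finitely many elements of a submodule that is free at `x`, multiplied by a common element
that does not vanish at `x`, are combinations of the basis. -/
lemma IsFreeAt.exists_coeff {M : Type*} [AddCommGroup M] [Module R M] {x : R →ₐ[k] k}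
    {P : Submodule R M} (h : IsFreeAt x P) (s : Finset M) (hs : ∀ m ∈ s, m ∈ P) :
    ∃ f : R, x f ≠ 0 ∧ ∃ (B : Type) (y : B → M) (β : M → B →₀ R), (∀ b, y b ∈ P) ∧
      LinearIndependent R y ∧ (∀ m ∈ s, f • m = Finsupp.linearCombination R y (β m)) := by
  classical
  obtain ⟨f, hf, B, y, hy, hind, hspan⟩ := h
  choose! c hc using fun m (hm : m ∈ s) => hspan (hs m hm)
  have h1 : ∀ m ∈ s, ∃ β : B →₀ R, f ^ (∑ m ∈ s, c m) • m = Finsupp.linearCombination R y β := by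
    intro m hm
    rw [← Finset.sum_erase_add _ _ hm, pow_add, mul_smul]
    obtain ⟨β, hβ⟩ := (Finsupp.mem_span_range_iff_exists_finsupp).1
      (Submodule.smul_mem _ (f ^ (∑ m ∈ s.erase m, c m)) (hc m hm))
    exact ⟨β, hβ.symm⟩
  choose! β hβ using h1
  exact ⟨f ^ (∑ m ∈ s, c m), by rw [map_pow]; exact pow_ne_zero _ hf, B, y, β, hy, hind, hβ⟩

variable [MulSemiringAction (GLInf k) R]

/-- The locus f ≠ 0 is open and nonempty, so the dense orbit meets it. -/
lemma IsGLGeneric.exists_smul_ne_zero [IsDomain R] {x : R →ₐ[k] k}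
    (hx : IsGLGeneric k (kPoint x)) {f : R} (hf : f ≠ 0) : ∃ g : GLInf k, x (g • f) ≠ 0 := by
  have hne : ((PrimeSpectrum.basicOpen f : TopologicalSpace.Opens (PrimeSpectrum R)) :
      Set (PrimeSpectrum R)).Nonempty := by
    rw [Set.nonempty_iff_ne_empty]
    intro h
    exact hf ((PrimeSpectrum.basicOpen_eq_bot_iff f).1 (TopologicalSpace.Opens.ext h)).eq_zero
  obtain ⟨_, hp, g, rfl⟩ := (dense_iff_closure_eq.2 hx).inter_open_nonempty _
    (PrimeSpectrum.basicOpen f).isOpen hne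
  exact ⟨g⁻¹, fun h => hp h⟩

variable {M N : EquivariantModule k (GLInf k) R}

/-- Translate f and the basis by some g for which g f does not vanish at x; stability of P keeps
everything inside P. -/
lemma IsGenericallyFree.isFreeAt [IsDomain R] {x : R →ₐ[k] k}
    (hx : IsGLGeneric k (kPoint x)) {P : Submodule R M.carrier} (h : IsGenericallyFree P)
    (hP : ∀ g, ∀ m ∈ P, M.ρ g m ∈ P) : IsFreeAt x P := by
  obtain ⟨f, hf, B, y, hy, hind, hspan⟩ := h
  obtain ⟨g, hg⟩ := hx.exists_smul_ne_zero hf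
  refine ⟨g • f, hg, B, fun b => M.ρ g (y b), fun b => hP g _ (hy b), ?_, fun m hm => ?_⟩
  · rw [linearIndependent_iff'] at hind ⊢
    intro s r hr i hi
    have h1 : ∑ i ∈ s, (g⁻¹ • r i) • y i = 0 := by
      have := congrArg (M.ρ g⁻¹) hr
      rw [map_sum, map_zero] at this
      rw [← this]
      refine Finset.sum_congr rfl fun i _ => ?_
      rw [M.ρ_smul, ← Module.End.mul_apply, ← map_mul, inv_mul_cancel, map_one,
        Module.End.one_apply]
    have := congrArg (g • ·) (hind s _ h1 i hi)
    simpa using this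
  · obtain ⟨c, hc⟩ := hspan (hP g⁻¹ m hm)
    refine ⟨c, ?_⟩
    have h1 : ∀ z ∈ Submodule.span R (Set.range y),
        M.ρ g z ∈ Submodule.span R (Set.range fun b => M.ρ g (y b)) := by
      intro z hz
      induction hz using Submodule.span_induction with
      | zero => rw [map_zero]; exact Submodule.zero_mem _
      | add x y _ _ hx hy => rw [map_add]; exact Submodule.add_mem _ hx hy
      | smul r x _ hx => rw [M.ρ_smul]; exact Submodule.smul_mem _ _ hx
      | mem m hm =>
        obtain ⟨b, rfl⟩ := hm
        exact Submodule.subset_span ⟨b, rfl⟩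
    have h2 := h1 _ hc
    rwa [M.ρ_smul, smul_pow', ← Module.End.mul_apply, ← map_mul, mul_inv_cancel, map_one,
        Module.End.one_apply] at h2

variable [CharZero k] [IsDomain R] [IsGLAlgebra k R] {x : R →ₐ[k] k}

lemma exists_isFreeAt (hx : IsGLGeneric k (kPoint x))
    (hM : IsPolynomial M.ρ) (s : Finset M.carrier) :
    ∃ P : Submodule R M.carrier, (∀ g, ∀ m ∈ P, M.ρ g m ∈ P) ∧ (∀ m ∈ s, m ∈ P) ∧
      IsFreeAt x P := by
  obtain ⟨P, h1, h2, h3⟩ := exists_isGenericallyFree hM s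
  exact ⟨P, h1, h2, h3.isFreeAt hx h1⟩

/-- Passing to the fiber at a generic point is exact. -/
lemma exists_eq_of_mem_smul_top (hx : IsGLGeneric k (kPoint x))
    (hN : IsPolynomial N.ρ) (φ : M ⟶ N) {m : M.carrier}
    (hm : φ.lin m ∈ (RingHom.ker x • ⊤ : Submodule R N.carrier)) :
    ∃ m' ∈ (RingHom.ker x • ⊤ : Submodule R M.carrier), φ.lin m' = φ.lin m := by
  classical
  obtain ⟨a, ha, hsum⟩ := mem_smul_top_iff.1 hm
  let L := LinearMap.range φ.lin
  -- Local freeness is applied to the cokernel N/L: the claim amounts to L ∩ 𝔪N = 𝔪L, a vanishing of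
  -- Tor₁ for N/L.
  obtain ⟨P, -, hsP, hfree⟩ := exists_isFreeAt hx
    (isPolynomial_quot hN L (EquivariantModule.range_stable φ)) (a.support.image L.mkQ)
  obtain ⟨f, hf, B, y, β, -, hind, hβ⟩ := hfree.exists_coeff _ hsP
  obtain ⟨w, hw⟩ : ∃ w : B → N.carrier, ∀ b, L.mkQ (w b) = y b :=
    ⟨fun b => (L.mkQ_surjective (y b)).choose, fun b => (L.mkQ_surjective (y b)).choose_spec⟩
  have h1 : ∀ n ∈ a.support, ∃ m', φ.lin m' =
      f • n - Finsupp.linearCombination R w (β (L.mkQ n)) := by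
    intro n hn
    have : f • n - Finsupp.linearCombination R w (β (L.mkQ n)) ∈ L := by
      rw [← Submodule.Quotient.mk_eq_zero]
      change L.mkQ _ = 0
      rw [map_sub, map_smul, Finsupp.apply_linearCombination]
      have h2 := hβ _ (Finset.mem_image_of_mem L.mkQ hn)
      have h3 : L.mkQ ∘ w = y := funext hw
      rw [h3]
      exact sub_eq_zero.2 h2
    exact this
  choose! μ hμ using h1
  -- Since ∑ a n • n lies in L, its coordinates in the free quotient vanish. Correcting each f • n
  -- by its lifted coordinates therefore leaves the sum f • φ(m) unchanged, while each corrected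
  -- term lies in the image of φ.
  have h2 : ∑ n ∈ a.support, a n • β (L.mkQ n) = 0 := by
    have h3 : Finsupp.linearCombination R y (∑ n ∈ a.support, a n • β (L.mkQ n)) = 0 := by
      rw [map_sum]
      have h4 : ∀ n ∈ a.support, Finsupp.linearCombination R y (a n • β (L.mkQ n)) =
          f • L.mkQ (a n • n) := fun n hn => by
        have h2 := hβ _ (Finset.mem_image_of_mem L.mkQ hn)
        rw [map_smul, ← h2]
        exact smul_comm (a n) f (L.mkQ n)
      rw [Finset.sum_congr rfl h4]
      have h5 : L.mkQ (Finsupp.linearCombination R id a) = 0 :=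
        (Submodule.Quotient.mk_eq_zero _).2 (hsum ▸ ⟨m, rfl⟩)
      rw [Finsupp.linearCombination_apply, Finsupp.sum, map_sum] at h5
      have h6 := congrArg (f • ·) h5
      simp only [Finset.smul_sum, smul_zero] at h6
      exact h6
    exact linearIndependent_iff.1 hind _ h3
  have h3 : φ.lin (∑ n ∈ a.support, a n • μ n) = f • φ.lin m := by
    rw [map_sum, ← hsum, Finsupp.linearCombination_apply, Finsupp.sum, Finset.smul_sum]
    have h4 : ∀ n ∈ a.support, φ.lin (a n • μ n) = f • a n • n -
        Finsupp.linearCombination R w (a n • β (L.mkQ n)) := fun n hn => by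
      rw [map_smul, hμ n hn, smul_sub, map_smul, smul_comm]
    rw [Finset.sum_congr rfl h4, Finset.sum_sub_distrib, ← map_sum, h2, map_zero, sub_zero]
    rfl
  have h4 : ∑ n ∈ a.support, a n • μ n ∈ (RingHom.ker x • ⊤ : Submodule R M.carrier) :=
    Submodule.sum_mem _ fun n _ => Submodule.smul_mem_smul (ha n) Submodule.mem_top
  -- The bracket is in the kernel of φ, so the image is still φ(m). Modulo 𝔪 the scalar inverts f,
  -- so f times this witness lies in 𝔪M.
  refine ⟨m - algebraMap k R (x f)⁻¹ • (f • m - ∑ n ∈ a.support, a n • μ n),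
    mem_ker_smul_top_of_unit x hf ?_, ?_⟩
  · have h5 : f • (m - algebraMap k R (x f)⁻¹ • (f • m - ∑ n ∈ a.support, a n • μ n)) =
        (1 - algebraMap k R (x f)⁻¹ * f) • f • m +
          (f * algebraMap k R (x f)⁻¹) • ∑ n ∈ a.support, a n • μ n := by
      module
    rw [h5]
    refine Submodule.add_mem _ (Submodule.smul_mem_smul ?_ Submodule.mem_top)
      (Submodule.smul_mem _ _ h4)
    rw [RingHom.mem_ker, map_sub, map_one, map_mul, AlgHom.commutes]
    simp [hf]
  · rw [map_sub, map_smul, map_sub, map_smul, h3, sub_self, smul_zero, sub_zero]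

/-- The fiber of a torsion module at a generic point vanishes. -/
lemma smul_top_eq_top_of_torsion (hx : IsGLGeneric k (kPoint x))
    (hM : IsPolynomial M.ρ)
    (htors : ∀ m : M.carrier, ∃ r : R, r ≠ 0 ∧ r • m = 0) :
    (RingHom.ker x • ⊤ : Submodule R M.carrier) = ⊤ := by
  classical
  refine eq_top_iff.2 fun m _ => ?_
  obtain ⟨P, -, hsP, hfree⟩ := exists_isFreeAt hx hM {m}
  obtain ⟨f, hf, B, y, β, -, hind, hβ⟩ := hfree.exists_coeff _ hsP
  -- A torsion element cannot be part of a basis, so f • m = 0.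
  have : IsEmpty B := ⟨fun b => by
    obtain ⟨r, hr, hrb⟩ := htors (y b)
    have := linearIndependent_iff.1 hind (Finsupp.single b r) (by simpa using hrb)
    exact hr (by simpa using this)⟩
  refine mem_ker_smul_top_of_unit x hf ?_
  rw [hβ m (by simp), Subsingleton.elim (β m) 0, map_zero]
  exact Submodule.zero_mem _

/-- A torsion-free module whose fiber at a generic point vanishes is zero. -/
lemma eq_zero_of_smul_top_eq_top (hx : IsGLGeneric k (kPoint x))
    (hM : IsPolynomial M.ρ)
    (hfree : ∀ (r : R) (m : M.carrier), r • m = 0 → r = 0 ∨ m = 0)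
    (htop : (RingHom.ker x • ⊤ : Submodule R M.carrier) = ⊤) (m : M.carrier) : m = 0 := by
  classical
  by_contra hm
  obtain ⟨P, hP, hsP, hPfree⟩ := exists_isFreeAt hx hM {m}
  obtain ⟨f, hf, B, y, hy, hind, hspan⟩ := id hPfree
  have hf0 : f ≠ 0 := fun h => hf (by rw [h, map_zero])
  obtain ⟨c, hc⟩ := hspan (hsP m (by simp))
  obtain ⟨β, hβ⟩ := (Finsupp.mem_span_range_iff_exists_finsupp).1 hc
  have hβ0 : β ≠ 0 := by
    rintro rfl
    rcases hfree _ _ (hβ.symm.trans (by simp)) with h | h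
    · exact pow_ne_zero _ hf0 h
    · exact hm h
  obtain ⟨b, -⟩ := Finsupp.support_nonempty_iff.2 hβ0
  -- Exactness moves the relation from M = 𝔪M into P, so the basis vector y b lies in 𝔪P.
  obtain ⟨z, hz, hzb⟩ := exists_eq_of_mem_smul_top hx hM (EquivariantModule.subι P hP)
    (m := ⟨y b, hy b⟩) (by rw [htop]; exact Submodule.mem_top)
  have hzb : z = ⟨y b, hy b⟩ := P.subtype_injective hzb
  rw [hzb] at hz
  obtain ⟨a, ha, hsum⟩ : ∃ a : P →₀ R, (∀ i, a i ∈ RingHom.ker x) ∧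
      Finsupp.linearCombination R id a = ⟨y b, hy b⟩ := mem_smul_top_iff.1 hz
  choose c' hc' using fun p : P => hspan p.2
  obtain ⟨f', hf', hf''⟩ : ∃ C, x (f ^ C) ≠ 0 ∧ ∀ p ∈ a.support, c' p ≤ C :=
    ⟨a.support.sup c', by rw [map_pow]; exact pow_ne_zero _ hf, fun p hp => Finset.le_sup hp⟩
  have h1 : ∀ p ∈ a.support, ∃ β : B →₀ R,
      Finsupp.linearCombination R y β = f ^ f' • (p : M.carrier) := by
    intro p hp
    obtain ⟨e, he⟩ := Nat.exists_eq_add_of_le (hf'' p hp)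
    rw [he, add_comm, pow_add, mul_smul]
    exact (Finsupp.mem_span_range_iff_exists_finsupp).1 (Submodule.smul_mem _ _ (hc' p))
  choose! γ hγ using h1
  have h2 : Finsupp.linearCombination R y (Finsupp.single b (f ^ f')) =
      Finsupp.linearCombination R y (∑ p ∈ a.support, a p • γ p) := by
    rw [map_sum, Finsupp.linearCombination_single]
    have h3 := congrArg (fun p : P => f ^ f' • (p : M.carrier)) hsum
    simp only [Finsupp.linearCombination_apply, Finsupp.sum, AddSubmonoidClass.coe_finsetSum,
      Finset.smul_sum] at h3
    rw [← h3]
    refine Finset.sum_congr rfl fun p hp => ?_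
    rw [map_smul, hγ p hp, smul_comm]
    rfl
  -- The coefficient at b, evaluated at x, is a power of x(f) on one side and 0 on the other.
  have h3 := congrArg (fun l : B →₀ R => x (l b)) (hind h2)
  simp only [Finsupp.single_eq_same, Finsupp.finsetSum_apply, Finsupp.smul_apply, smul_eq_mul,
    map_sum, map_mul] at h3
  rw [Finset.sum_eq_zero fun p _ => by rw [(RingHom.mem_ker).1 (ha p), zero_mul]] at h3
  exact hf' h3

end FreeAt

/-! ### Polynomiality of direct sums. -/

section DirectSum

variable {k : Type u} [Field k] {I : Type u} {V : I → Type u} [∀ i, AddCommMonoid (V i)]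
  [∀ i, Module k (V i)]

lemma directSum_rep_apply (ρ : ∀ i, Representation k (GLInf k) (V i)) (g : GLInf k)
    (v : DirectSum I V) (i : I) : Representation.directSum ρ g v i = ρ i g (v i) :=
  DirectSum.lmap_apply (fun i => ρ i g) v i

lemma directSum_rep_lof [DecidableEq I] (ρ : ∀ i, Representation k (GLInf k) (V i)) (g : GLInf k)
    (i : I) (v : V i) : Representation.directSum ρ g (DirectSum.lof k I V i v) =
      DirectSum.lof k I V i (ρ i g v) :=
  DirectSum.lmap_lof (fun i => ρ i g) i v

lemma IsPolynomial.directSum {ρ : ∀ i, Representation k (GLInf k) (V i)}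
    (h : ∀ i, IsPolynomial (ρ i)) : IsPolynomial (Representation.directSum ρ) := by
  classical
  choose J d S p hp using h
  have h1 : IsPolynomial (Representation.directSum fun i => (S i).toRepresentation) := by
    let W : ∀ i, J i → Type u := fun i j => ⨂[k]^(d i j) (ℕ →₀ k)
    let F : (DirectSum I fun i => (S i).toSubmodule) →ₗ[k]
        DirectSum (Σ i, J i) fun a => W a.1 a.2 :=
      (DirectSum.sigmaLuncurry k (δ := W)) ∘ₗ
        DirectSum.lmap fun i => (S i).toSubmodule.subtype
    have hF : ∀ v i j, F v ⟨i, j⟩ = (v i : DirectSum (J i) (W i)) j := fun v i j =>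
      (DirectSum.sigmaLuncurry_apply k _ i j).trans
        (congrArg (fun w : DirectSum (J i) (W i) => w j) (DirectSum.lmap_apply _ v i))
    refine isPolynomial_of_injective_directSum (ι := Σ i, J i) (fun a => d a.1 a.2) F
      (fun g v => DFinsupp.ext fun ⟨i, j⟩ => ?_) fun v w h => ?_
    · rw [hF]
      refine Eq.trans ?_ (directSum_rep_apply (I := Σ i, J i) (V := fun a => W a.1 a.2)
        (fun a => tensorPowerRep k (d a.1 a.2)) g (F v) ⟨i, j⟩).symm
      rw [hF, directSum_rep_apply (fun i => (S i).toRepresentation)]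
      exact directSum_rep_apply (fun j => tensorPowerRep k (d i j)) g (v i).1 j
    · refine DFinsupp.ext fun i => Subtype.ext (DFinsupp.ext fun j => ?_)
      have := congrArg (fun z : DirectSum (Σ i, J i) fun a => W a.1 a.2 => z ⟨i, j⟩) h
      rwa [hF, hF] at this
  refine h1.of_surjective (DirectSum.lmap fun i => (p i).toLinearMap)
    (fun g v => DFinsupp.ext fun i => ?_) ((DirectSum.lmap_surjective _).2 hp)
  simp only [Representation.directSum, MonoidHom.coe_mk, OneHom.coe_mk, DirectSum.lmap_apply]
  exact (p i).isIntertwining _ _ g (v i)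

/-- The direct sum of all cyclic subrepresentations maps onto V. -/
lemma isPolynomial_of_forall_isPolynomialVector {V : Type u} [AddCommGroup V] [Module k V]
    {ρ : Representation k (GLInf k) V} (h : ∀ v, IsPolynomialVector ρ v) : IsPolynomial ρ := by
  classical
  let A : V → Type u := fun v => (generatedSubrep ρ v).toSubmodule
  let F : DirectSum V A →ₗ[k] V :=
    DirectSum.toModule k V V fun v => (generatedSubrep ρ v).toSubmodule.subtype
  have hF : ∀ v (a : A v), F (DirectSum.lof k V A v a) = a.1 := fun v a =>
    DirectSum.toModule_lof k v a
  have key : ∀ g, F ∘ₗ Representation.directSum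
      (fun v => (generatedSubrep ρ v).toRepresentation) g = ρ g ∘ₗ F := fun g =>
    DirectSum.linearMap_ext _ fun v => LinearMap.ext fun a => by
      refine (congrArg F (directSum_rep_lof (V := A) _ g v a)).trans ((hF _ _).trans ?_)
      exact congrArg (ρ g) (hF v a).symm
  exact (IsPolynomial.directSum h).of_surjective F (fun g v => LinearMap.congr_fun (key g) v)
    fun v => ⟨DirectSum.lof k V A v ⟨v, mem_generatedSubrep ρ v⟩, hF _ _⟩

end DirectSum

/-! ### The module of polynomial vectors. -/

section PolynomialPart

variable {k : Type u} [Field k] {R : Type u} [CommRing R] [Algebra k R]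
  [MulSemiringAction (GLInf k) R] [IsGLAlgebra k R]

/-- The submodule of polynomial vectors of an equivariant module. -/
def polVectors (N : EquivariantModule k (GLInf k) R) : Submodule R N.carrier where
  carrier := {n | IsPolynomialVector N.ρ n}
  zero_mem' := isPolynomialVector_zero
  add_mem' := IsPolynomialVector.add
  smul_mem' r _ hn :=
    IsPolynomialVector.bilin
      ((IsGLAlgebra.isPolynomial (k := k) (R := R)).isPolynomialVector r) hn
      (Algebra.lsmul k k N.carrier).toLinearMap
      (fun g r m => (N.ρ_smul g r m).symm)

lemma IsPolynomialVector.of_injective {V W : Type u} [AddCommGroup V] [Module k V]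
    [AddCommGroup W] [Module k W] {ρ : Representation k (GLInf k) V}
    {σ : Representation k (GLInf k) W} (f : V →ₗ[k] W) (hf : ∀ g v, f (ρ g v) = σ g (f v))
    (hi : Function.Injective f) {v : V} (hv : IsPolynomialVector σ (f v)) :
    IsPolynomialVector ρ v := by
  have hmem : ∀ w : (generatedSubrep ρ v).toSubmodule,
      f w ∈ (generatedSubrep σ (f v)).toSubmodule := by
    rintro ⟨w, hw⟩
    induction hw using Submodule.span_induction with
    | zero => simp
    | add x y _ _ hx hy => simpa using Submodule.add_mem _ hx hy
    | smul r x _ hx => simpa using Submodule.smul_mem _ r hx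
    | mem m hm =>
      obtain ⟨g, rfl⟩ := hm
      exact Submodule.subset_span ⟨g, (hf g v).symm⟩
  exact IsPolynomial.of_injective hv
    ((f ∘ₗ (generatedSubrep ρ v).toSubmodule.subtype).codRestrict _ hmem)
    (fun g w => Subtype.ext (hf g w)) fun a b h => Subtype.ext (hi (congrArg Subtype.val h))

lemma polVectors_stable (N : EquivariantModule k (GLInf k) R) (g : GLInf k) (n : N.carrier)
    (hn : n ∈ polVectors N) : N.ρ g n ∈ polVectors N := by
  let A := generatedSubrep N.ρ n
  have hA : IsPolynomial A.toRepresentation := hn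
  exact IsPolynomialVector.of_map (σ := N.ρ) hA A.toSubmodule.subtype
    (fun _ _ => rfl) (A.toRepresentation g ⟨n, mem_generatedSubrep N.ρ n⟩)

/-- The polynomial vectors of an equivariant module, as an object of `Mod_R`. -/
def polPart (N : EquivariantModule k (GLInf k) R) : ModR k R where
  obj := N.sub (polVectors N) (polVectors_stable N)
  property := isPolynomial_of_forall_isPolynomialVector fun v =>
    IsPolynomialVector.of_injective (σ := N.ρ) ((polVectors N).subtype.restrictScalars k)
      (fun _ _ => rfl) (polVectors N).subtype_injective (show IsPolynomialVector N.ρ v.1 from v.2)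

/-- A morphism from a polynomial module to an arbitrary equivariant module factors through the
polynomial vectors. -/
def polPartLift {M : ModR k R} {N : EquivariantModule k (GLInf k) R} (f : M.obj ⟶ N) :
    M ⟶ polPart N :=
  ObjectProperty.homMk (EquivariantModule.Hom.mk (f.lin.codRestrict (polVectors N) fun m =>
    show IsPolynomialVector N.ρ (f.lin m) from
      IsPolynomialVector.of_map M.property (f.lin.restrictScalars k) f.comm m)
      fun g m => Subtype.ext (f.comm g m))

end PolynomialPart

section PolPartEquiv

variable {k : Type u} [Field k] {R : Type u} [CommRing R] [Algebra k R]
  [MulSemiringAction (GLInf k) R] [IsGLAlgebra k R]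

/-- The inclusion of the polynomial vectors. -/
def polPartι (N : EquivariantModule k (GLInf k) R) : (polPart N).obj ⟶ N :=
  EquivariantModule.subι (polVectors N) (polVectors_stable N)

/-- The universal property of the polynomial vectors. -/
def polPartEquiv (M : ModR k R) (N : EquivariantModule k (GLInf k) R) :
    (M.obj ⟶ N) ≃ (M ⟶ polPart N) where
  toFun := polPartLift
  invFun f := f.hom ≫ polPartι N
  left_inv _ := rfl
  right_inv _ := rfl

end PolPartEquiv

/-! ### Restriction of scalars and the adjunction between Mod_R and Mod_K. -/

section Restriction

variable {k : Type u} [Field k] {R : Type u} [CommRing R] [Algebra k R]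
  [MulSemiringAction (GLInf k) R] [IsGLAlgebra k R]
  {K : Type u} [Field K] [Algebra k K] [MulSemiringAction (GLInf k) K] [IsGLField k K]
  [Algebra R K] [IsScalarTower k R K] [SMulDistribClass (GLInf k) R K]

/-- Restriction of scalars of the underlying module of a semi-linear representation. -/
abbrev restrictModule (R : Type u) [CommRing R] [Algebra R K] [Algebra k R]
    (N : EquivariantModule k (GLInf k) K) :
    Module R N.carrier := Module.compHom N.carrier (algebraMap R K)

/-- Restriction of scalars of a semi-linear representation. -/
def restrictScalarsObj (R : Type u) [CommRing R] [Algebra k R] [MulSemiringAction (GLInf k) R]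
    [Algebra R K] [IsScalarTower k R K] [SMulDistribClass (GLInf k) R K]
    (N : EquivariantModule k (GLInf k) K) : EquivariantModule k (GLInf k) R where
  carrier := N.carrier
  module := restrictModule R N
  isScalarTower :=
    letI := restrictModule R N
    ⟨fun c r n => by
      change algebraMap R K (c • r) • n = c • algebraMap R K r • n
      have h : algebraMap R K (c • r) = c • algebraMap R K r := by
        rw [Algebra.algebraMap_eq_smul_one, smul_assoc, ← Algebra.algebraMap_eq_smul_one]
      rw [h, smul_assoc]⟩
  ρ := N.ρ
  ρ_smul g r n := by
    change N.ρ g (algebraMap R K r • n) = algebraMap R K (g • r) • N.ρ g n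
    rw [N.ρ_smul]
    congr 1
    rw [Algebra.algebraMap_eq_smul_one, smul_distrib_smul, smul_one,
      Algebra.algebraMap_eq_smul_one]

/-- Restriction of scalars of a morphism of semi-linear representations. -/
def restrictScalarsMap (R : Type u) [CommRing R] [Algebra k R] [MulSemiringAction (GLInf k) R]
    [Algebra R K] [IsScalarTower k R K] [SMulDistribClass (GLInf k) R K]
    {M N : EquivariantModule k (GLInf k) K} (f : M ⟶ N) :
    restrictScalarsObj R M ⟶ restrictScalarsObj R N :=
  EquivariantModule.Hom.mk
    (M := restrictScalarsObj R M) (N := restrictScalarsObj R N)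
    { toFun := f.lin
      map_add' := map_add f.lin
      map_smul' := fun r m => f.lin.map_smul (algebraMap R K r) m } f.comm

/-- Extension of scalars is left adjoint to restriction of scalars. -/
def extendRestrictEquiv (M : EquivariantModule k (GLInf k) R)
    (N : EquivariantModule k (GLInf k) K) :
    (extendObj K M ⟶ N) ≃ (M ⟶ restrictScalarsObj R N) :=
  letI := restrictModule R N
  haveI : IsScalarTower R K N.carrier := ⟨fun r a n => by
    rw [Algebra.smul_def, mul_smul]; rfl⟩
  { toFun := fun φ => EquivariantModule.Hom.mk (N := restrictScalarsObj R N)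
      (((show K ⊗[R] M.carrier →ₗ[K] N.carrier from φ.lin).restrictScalars R) ∘ₗ TensorProduct.mk R K M.carrier 1) fun g m => by
        have h := φ.comm g ((1 : K) ⊗ₜ[R] m)
        refine Eq.trans ?_ h
        change φ.lin ((1 : K) ⊗ₜ[R] M.ρ g m) = φ.lin ((g • (1 : K)) ⊗ₜ[R] M.ρ g m)
        rw [smul_one]
    invFun := fun ψ => EquivariantModule.Hom.mk (M := extendObj K M)
      (LinearMap.liftBaseChange K (show M.carrier →ₗ[R] N.carrier from ψ.lin)) fun g =>
        EquivariantModule.tensorρ_induction (fieldAsModule k R K) M g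
          (LinearMap.liftBaseChange K (show M.carrier →ₗ[R] N.carrier from ψ.lin)).toAddMonoidHom
          ((N.ρ g).toAddMonoidHom.comp (LinearMap.liftBaseChange K
            (show M.carrier →ₗ[R] N.carrier from ψ.lin)).toAddMonoidHom) fun a m => by
          change (g • (show K from a)) • (show N.carrier from ψ.lin (M.ρ g m)) =
            N.ρ g ((show K from a) • (show N.carrier from ψ.lin m))
          rw [N.ρ_smul, ψ.comm]
          rfl
    left_inv := fun φ => EquivariantModule.hom_ext (baseChange_ext K fun m => one_smul K _)
    right_inv := fun ψ => EquivariantModule.hom_ext (LinearMap.ext fun m =>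
      one_smul K (show N.carrier from ψ.lin m)) }

end Restriction

section Adjunction

variable (k : Type u) [Field k] (R : Type u) [CommRing R] [Algebra k R]
  [MulSemiringAction (GLInf k) R] [IsGLAlgebra k R]
  (K : Type u) [Field K] [Algebra k K] [MulSemiringAction (GLInf k) K] [IsGLField k K]
  [Algebra R K] [IsScalarTower k R K] [SMulDistribClass (GLInf k) R K]

/-- The functor `Mod_K ⥤ Mod_R` of polynomial vectors. -/
def polFunctor : ModK k K ⥤ ModR k R where
  obj N := polPart (restrictScalarsObj R N.obj)
  map f := polPartLift (polPartι _ ≫ restrictScalarsMap R f.hom)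
  map_id _ := rfl
  map_comp _ _ := rfl

/-- Extension of scalars `Mod_R ⥤ Mod_K` is left adjoint to the functor of polynomial vectors. -/
def extendPolAdjunction : extendModR (k := k) (R := R) K ⊣ polFunctor k R K :=
  Adjunction.mkOfHomEquiv
    { homEquiv := fun M N =>
        ((isKModule k K).fullyFaithfulι.homEquiv (X := (extendModR K).obj M) (Y := N)).trans
          ((extendRestrictEquiv M.obj N.obj).trans
            (polPartEquiv M (restrictScalarsObj R N.obj)))
      homEquiv_naturality_left_symm := fun _ _ => ObjectProperty.hom_ext _
        (EquivariantModule.hom_ext (baseChange_ext K fun _ => rfl))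
      homEquiv_naturality_right := fun _ _ => ObjectProperty.hom_ext _
        (EquivariantModule.hom_ext (LinearMap.ext fun _ => rfl)) }

end Adjunction

/-! ### The right adjoint of the fiber functor. -/

section Coinduction

variable {k : Type u} [Field k] {R : Type u} [CommRing R] [Algebra k R]
  [MulSemiringAction (GLInf k) R] [IsGLAlgebra k R] (x : R →ₐ[k] k)

/-- The `R`-module of all functions `GL → V`, where `r ∈ R` acts at `g ∈ GL` by the value of `r` at
the point `g⁻¹ x`. -/
abbrev coindModule (V : Type u) [AddCommGroup V] [Module k V] : Module R (GLInf k → V) :=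
  { smul := fun r f g => x (g • r) • f g
    one_smul := fun f => funext fun g => by
      change x (g • (1 : R)) • f g = f g
      rw [smul_one, map_one, one_smul]
    mul_smul := fun r s f => funext fun g => by
      change x (g • (r * s)) • f g = x (g • r) • x (g • s) • f g
      rw [MulSemiringAction.smul_mul, map_mul, mul_smul]
    smul_zero := fun r => funext fun g => smul_zero _
    smul_add := fun r f f' => funext fun g => smul_add _ _ _
    add_smul := fun r s f => funext fun g => by
      change x (g • (r + s)) • f g = x (g • r) • f g + x (g • s) • f g
      rw [smul_add, map_add, add_smul]
    zero_smul := fun f => funext fun g => by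
      change x (g • (0 : R)) • f g = 0
      rw [smul_zero, map_zero, zero_smul] }

/-- The equivariant module of all functions `GL → V`, where `r ∈ R` acts at `g ∈ GL` by the value
of `r` at the point `g⁻¹ x`. -/
def coindObj (V : ModuleCat.{u} k) : EquivariantModule k (GLInf k) R where
  carrier := GLInf k → V
  module := coindModule x V
  isScalarTower :=
    letI := coindModule x V
    { smul_assoc := fun c r f => funext fun g => by
        change x (g • (c • r)) • f g = c • x (g • r) • f g
        rw [smul_comm, map_smul, smul_assoc] }
  ρ :=
    { toFun := fun h =>
        { toFun := fun f g => f (g * h)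
          map_add' := fun _ _ => rfl
          map_smul' := fun _ _ => rfl }
      map_one' := LinearMap.ext fun f => funext fun g => congrArg f (mul_one g)
      map_mul' := fun a b => LinearMap.ext fun f => funext fun g =>
        congrArg f (mul_assoc g a b).symm }
  ρ_smul h r f := funext fun g => by
    change x ((g * h) • r) • f (g * h) = x (g • h • r) • f (g * h)
    rw [mul_smul]

/-- The value at `1 ∈ GL`, as a linear map. -/
def coindEval {M : EquivariantModule k (GLInf k) R} {V : ModuleCat.{u} k}
    (φ : M ⟶ coindObj x V) : M.carrier →ₗ[k] V where
  toFun m := (φ.lin m : GLInf k → V) 1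
  map_add' m n := congrFun (map_add φ.lin m n) 1
  map_smul' c m := congrFun (map_smul (φ.lin.restrictScalars k) c m) 1

/-- The map to the module of functions `GL → V` given by a map on the fiber. -/
def coindLift {M : EquivariantModule k (GLInf k) R} {V : ModuleCat.{u} k}
    (ψ : Fiber x M.carrier →ₗ[k] V) : M ⟶ coindObj x V :=
  EquivariantModule.Hom.mk (N := coindObj x V)
    { toFun := fun m g => ψ (Submodule.Quotient.mk (M.ρ g m))
      map_add' := fun m n => funext fun g => by
        change ψ _ = ψ _ + ψ _
        rw [map_add, Submodule.Quotient.mk_add, map_add]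
      map_smul' := fun r m => funext fun g => by
        change ψ _ = x (g • r) • ψ _
        rw [M.ρ_smul, Submodule.Quotient.mk_smul, fiber_smul, map_smul] }
    fun h m => funext fun g => by
      change ψ (Submodule.Quotient.mk (M.ρ g (M.ρ h m))) = ψ (Submodule.Quotient.mk (M.ρ (g * h) m))
      rw [map_mul]
      rfl

lemma coindEval_eq_zero {M : EquivariantModule k (GLInf k) R} {V : ModuleCat.{u} k}
    (φ : M ⟶ coindObj x V) {m : M.carrier}
    (hm : m ∈ (RingHom.ker x • ⊤ : Submodule R M.carrier)) : coindEval x φ m = 0 := by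
  refine Submodule.smul_induction_on hm (fun r hr m _ => ?_) fun m n hm hn => ?_
  · have h : coindEval x φ (r • m) = x ((1 : GLInf k) • r) • coindEval x φ m :=
      congrFun (map_smul φ.lin r m) 1
    rw [h, one_smul, (RingHom.mem_ker).1 hr, zero_smul]
  · rw [map_add, hm, hn, add_zero]

/-- The universal property of the module of functions `GL → V`. -/
def coindEquiv (M : EquivariantModule k (GLInf k) R) (V : ModuleCat.{u} k) :
    (Fiber x M.carrier →ₗ[k] V) ≃ (M ⟶ coindObj x V) where
  toFun ψ := coindLift x ψ
  invFun φ := Submodule.liftQ ((RingHom.ker x • ⊤ : Submodule R M.carrier).restrictScalars k)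
    (coindEval x φ) fun _ hm => coindEval_eq_zero x φ hm
  left_inv ψ := LinearMap.ext fun v => by
    obtain ⟨m, rfl⟩ := Submodule.Quotient.mk_surjective _ v
    change ψ (Submodule.Quotient.mk (M.ρ 1 m)) = ψ (Submodule.Quotient.mk m)
    rw [map_one]
    rfl
  right_inv φ := EquivariantModule.hom_ext (LinearMap.ext fun m => funext fun g => by
    change (φ.lin (M.ρ g m) : GLInf k → V) 1 = (φ.lin m : GLInf k → V) g
    rw [φ.comm]
    exact congrArg (φ.lin m) (one_mul g))

/-- The functor `Vec_k ⥤ Mod_R`, `V ↦ Map(GL, V)^pol`. -/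
def coindFunctor : ModuleCat.{u} k ⥤ ModR k R where
  obj V := polPart (coindObj x V)
  map {V W} f := polPartLift (polPartι _ ≫ EquivariantModule.Hom.mk (M := coindObj x V)
    (N := coindObj x W)
    { toFun := fun φ g => f.hom (φ g)
      map_add' := fun _ _ => funext fun _ => map_add f.hom _ _
      map_smul' := fun _ _ => funext fun _ => map_smul f.hom _ _ }
    fun _ _ => rfl)
  map_id _ := rfl
  map_comp _ _ := rfl

/-- The fiber functor `M ↦ M/𝔪M` on `Mod_R` has a right adjoint. -/
def fiberCoindAdjunction : fiberFunctor x ⊣ coindFunctor x :=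
  Adjunction.mkOfHomEquiv
    { homEquiv := fun M V => ModuleCat.homEquiv.trans
        ((coindEquiv x M.obj V).trans (polPartEquiv M (coindObj x V)))
      homEquiv_naturality_left_symm := fun f g => ModuleCat.hom_ext (LinearMap.ext fun v => by
        obtain ⟨m, rfl⟩ := Submodule.Quotient.mk_surjective _ v
        rfl)
      homEquiv_naturality_right := fun _ _ => rfl }

end Coinduction

namespace EquivariantModule

variable {k : Type u} [Field k] {G : Type u} [Group G] {R : Type u} [CommRing R] [Algebra k R]
  [MulSemiringAction G R] {M N : EquivariantModule k G R}

lemma bijective_of_isIso (f : M ⟶ N) [IsIso f] : Function.Bijective f.lin := by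
  refine Function.bijective_iff_has_inverse.2 ⟨(inv f).lin, fun m => ?_, fun n => ?_⟩
  · exact LinearMap.congr_fun (congrArg Hom.lin (IsIso.hom_inv_id f)) m
  · exact LinearMap.congr_fun (congrArg Hom.lin (IsIso.inv_hom_id f)) n

lemma isIso_of_bijective [SMulCommClass G k R] (f : M ⟶ N) (hf : Function.Bijective f.lin) : IsIso f :=
  (mkIso (LinearEquiv.ofBijective f.lin hf) f.comm).isIso_hom

end EquivariantModule

/-! ### Mod_K as a localization of Mod_R, and inversion of its morphisms by the fiber. -/

section Localization

variable {k : Type u} [Field k] {R : Type u} [CommRing R] [Algebra k R]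
  [MulSemiringAction (GLInf k) R] [IsGLAlgebra k R]
  {K : Type u} [Field K] [Algebra k K] [MulSemiringAction (GLInf k) K] [IsGLField k K]
  [Algebra R K] [IsScalarTower k R K] [SMulDistribClass (GLInf k) R K]

section Denominators

variable [IsFractionRing R K] {M N : Type*} [AddCommGroup M] [Module R M]

lemma exists_smul_eq_one_tmul (z : K ⊗[R] M) :
    ∃ r ∈ nonZeroDivisors R, ∃ m : M, r • z = (1 : K) ⊗ₜ[R] m := by
  obtain ⟨⟨m, r⟩, h⟩ := IsLocalizedModule.surj (nonZeroDivisors R) (TensorProduct.mk R K M 1) z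
  exact ⟨r, r.2, m, h⟩

lemma exists_smul_eq_zero_of_one_tmul {m : M} (h : (1 : K) ⊗ₜ[R] m = 0) :
    ∃ r ∈ nonZeroDivisors R, r • m = 0 := by
  obtain ⟨r, h⟩ := (IsLocalizedModule.eq_zero_iff (nonZeroDivisors R)
    (TensorProduct.mk R K M 1)).1 h
  exact ⟨r, r.2, h⟩

end Denominators

lemma algebraMap_smul_tmul {M : Type*} [AddCommGroup M] [Module R M] (r : R) (z : K ⊗[R] M) :
    algebraMap R K r • z = r • z := algebraMap_smul K r z

variable [IsFractionRing R K] [IsDomain R]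

/-- Clearing denominators reduces an element of the kernel to a pure tensor 1 ⊗ n, which the counit
sends to n. Surjectivity is the defining condition of Mod_K. -/
lemma counit_bijective (N : ModK k K) :
    Function.Bijective ((extendPolAdjunction k R K).counit.app N).hom.lin := by
  let N' := restrictScalarsObj R N.obj
  let f : K ⊗[R] (polVectors N') →ₗ[K] N.obj.carrier :=
    ((extendPolAdjunction k R K).counit.app N).hom.lin
  have hf : ∀ (a : K) (n : polVectors N'), f (a ⊗ₜ n) = a • (show N.obj.carrier from n.1) :=
    fun _ _ => rfl
  constructor
  · refine (injective_iff_map_eq_zero f).2 fun z hz => ?_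
    obtain ⟨r, hr, n, h⟩ := exists_smul_eq_one_tmul z
    have hr0 : algebraMap R K r ≠ 0 := IsFractionRing.to_map_ne_zero_of_mem_nonZeroDivisors hr
    have hn : n = 0 := by
      have h1 := congrArg f h
      rw [← algebraMap_smul_tmul, map_smul, hz, smul_zero, hf, one_smul] at h1
      exact Subtype.ext h1.symm
    rw [hn, TensorProduct.tmul_zero, ← algebraMap_smul_tmul] at h
    exact (smul_eq_zero.1 h).resolve_left hr0
  · intro n
    obtain ⟨a, y, hy, rfl⟩ := N.property n
    exact ⟨a ⊗ₜ[R] (⟨y, hy⟩ : polVectors N'), rfl⟩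

instance : IsIso (extendPolAdjunction k R K).counit := by
  have : ∀ N, IsIso ((extendPolAdjunction k R K).counit.app N) := fun N => by
    rw [← ObjectProperty.isIso_hom_iff]
    exact EquivariantModule.isIso_of_bijective _ (counit_bijective N)
  exact NatIso.isIso_of_isIso_app _

instance : (polFunctor k R K).Full := (extendPolAdjunction k R K).fullyFaithfulROfIsIsoCounit.full

instance : (polFunctor k R K).Faithful :=
  (extendPolAdjunction k R K).fullyFaithfulROfIsIsoCounit.faithful

variable (k R K) in
/-- The morphisms of `Mod_R` that become isomorphisms in `Mod_K`. -/
abbrev genericIso : MorphismProperty (ModR k R) :=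
  (MorphismProperty.isomorphisms (ModK k K)).inverseImage (extendModR K)

instance : (extendModR (k := k) (R := R) K).IsLocalization (genericIso k R K) :=
  (extendPolAdjunction k R K).isLocalization

variable {M N : ModR k R} {f : M ⟶ N}

lemma exists_smul_eq_zero_of_isIso (hf : IsIso ((extendModR K).map f)) {m : M.obj.carrier}
    (hm : f.hom.lin m = 0) : ∃ r : R, r ≠ 0 ∧ r • m = 0 := by
  have h1 : Function.Bijective (f.hom.lin.baseChange K) := by
    rw [← ObjectProperty.isIso_hom_iff] at hf
    exact EquivariantModule.bijective_of_isIso ((extendModR K).map f).hom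
  have h2 : (1 : K) ⊗ₜ[R] m = 0 := h1.1 (by
    rw [LinearMap.baseChange_tmul, hm, TensorProduct.tmul_zero, map_zero])
  obtain ⟨r, hr, h⟩ := exists_smul_eq_zero_of_one_tmul h2
  exact ⟨r, nonZeroDivisors.ne_zero hr, h⟩

/-- The cokernel is torsion: clear the denominators of a preimage of 1 ⊗ n, then kill the remaining
torsion difference. -/
lemma exists_smul_mem_range_of_isIso (hf : IsIso ((extendModR K).map f)) (n : N.obj.carrier) :
    ∃ r : R, r ≠ 0 ∧ r • n ∈ LinearMap.range f.hom.lin := by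
  have h1 : Function.Bijective (f.hom.lin.baseChange K) := by
    rw [← ObjectProperty.isIso_hom_iff] at hf
    exact EquivariantModule.bijective_of_isIso ((extendModR K).map f).hom
  obtain ⟨z, hz⟩ := h1.2 ((1 : K) ⊗ₜ[R] n)
  obtain ⟨s, hs, m, h⟩ := exists_smul_eq_one_tmul z
  have h2 : (1 : K) ⊗ₜ[R] (f.hom.lin m - s • n) = 0 := by
    have h3 := congrArg (f.hom.lin.baseChange K) h
    rw [← algebraMap_smul_tmul, map_smul, hz, LinearMap.baseChange_tmul, algebraMap_smul_tmul,
      ← TensorProduct.tmul_smul] at h3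
    rw [TensorProduct.tmul_sub, h3, sub_self]
  obtain ⟨r, hr, h3⟩ := exists_smul_eq_zero_of_one_tmul h2
  refine ⟨r * s, mul_ne_zero (nonZeroDivisors.ne_zero hr) (nonZeroDivisors.ne_zero hs), r • m, ?_⟩
  rw [smul_sub, sub_eq_zero] at h3
  rw [map_smul, h3, mul_smul]

variable [CharZero k] {x : R →ₐ[k] k}

/-- Kernel and cokernel of f are torsion, so their fibers at x vanish. Right exactness then gives
surjectivity, and exactness at the generic point gives injectivity. -/
lemma fiberMap_bijective_of_isIso (hx : IsGLGeneric k (kPoint x))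
    (hf : IsIso ((extendModR K).map f)) : Function.Bijective (fiberMap x f.hom.lin) := by
  constructor
  · refine (injective_iff_map_eq_zero _).2 fun v hv => ?_
    obtain ⟨m, rfl⟩ := Submodule.Quotient.mk_surjective _ v
    have hm : f.hom.lin m ∈ (RingHom.ker x • ⊤ : Submodule R N.obj.carrier) :=
      (Submodule.Quotient.mk_eq_zero _).1 hv
    obtain ⟨m', hm', h⟩ := exists_eq_of_mem_smul_top hx N.property f.hom hm
    let P := LinearMap.ker f.hom.lin
    have htop := smul_top_eq_top_of_torsion (M := M.obj.sub P (EquivariantModule.ker_stable f.hom))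
      hx (isPolynomial_sub M.property P _) fun p => by
        obtain ⟨r, hr, h⟩ := exists_smul_eq_zero_of_isIso hf p.2
        exact ⟨r, hr, Subtype.ext h⟩
    have hd : m - m' ∈ P := by rw [LinearMap.mem_ker, map_sub, h, sub_self]
    have hd' : m - m' ∈ (RingHom.ker x • ⊤ : Submodule R M.obj.carrier) := by
      have h1 : (⟨m - m', hd⟩ : P) ∈ (RingHom.ker x • ⊤ : Submodule R P) := by
        have h2 : (RingHom.ker x • ⊤ : Submodule R P) = ⊤ := htop
        rw [h2]; exact Submodule.mem_top
      have h3 := Submodule.mem_map_of_mem (f := P.subtype) h1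
      rw [Submodule.map_smul''] at h3
      exact Submodule.smul_mono le_rfl le_top h3
    refine (Submodule.Quotient.mk_eq_zero _).2 ?_
    rw [← sub_add_cancel m m']
    exact Submodule.add_mem _ hd' hm'
  · intro v
    obtain ⟨n, rfl⟩ := Submodule.Quotient.mk_surjective _ v
    let L := LinearMap.range f.hom.lin
    have htop := smul_top_eq_top_of_torsion
      (M := N.obj.quot L (EquivariantModule.range_stable f.hom)) hx
      (isPolynomial_quot N.property L _) fun q => by
        obtain ⟨n, rfl⟩ := L.mkQ_surjective q
        obtain ⟨r, hr, h⟩ := exists_smul_mem_range_of_isIso hf n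
        exact ⟨r, hr, (Submodule.Quotient.mk_eq_zero L).2 h⟩
    have h1 : L.mkQ n ∈ Submodule.map L.mkQ (RingHom.ker x • ⊤ : Submodule R N.obj.carrier) := by
      have h2 : (RingHom.ker x • ⊤ : Submodule R (N.obj.carrier ⧸ L)) = ⊤ := htop
      rw [Submodule.map_smul'', Submodule.map_top, Submodule.range_mkQ, h2]
      exact Submodule.mem_top
    obtain ⟨n', hn', h⟩ := h1
    obtain ⟨m, hm⟩ := (Submodule.Quotient.eq L).1 h.symm
    refine ⟨Submodule.Quotient.mk m, (Submodule.Quotient.eq _).2 ?_⟩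
    rw [hm, sub_sub_cancel_left]
    exact Submodule.neg_mem _ hn'

lemma genericIso_isInvertedBy (hx : IsGLGeneric k (kPoint x)) :
    (genericIso k R K).IsInvertedBy (fiberFunctor x) := fun _ _ f hf =>
  (LinearEquiv.ofBijective (fiberMap x f.hom.lin)
    (fiberMap_bijective_of_isIso hx hf)).toModuleIso.isIso_hom

end Localization

/-! ### Biproducts and kernels in Mod_R. -/

section Biproducts

variable {k : Type u} [Field k] {R : Type u} [CommRing R] [Algebra k R]
  [MulSemiringAction (GLInf k) R] [IsGLAlgebra k R]

open Limits

/-- The direct sum of two objects of `Mod_R`. -/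
def prodModR (M N : ModR k R) : ModR k R where
  obj :=
    { carrier := M.obj.carrier × N.obj.carrier
      ρ := M.obj.ρ.prod N.obj.ρ
      ρ_smul := fun g r m => Prod.ext (M.obj.ρ_smul g r m.1) (N.obj.ρ_smul g r m.2) }
  property := IsPolynomial.prod M.property N.property

/-- The direct sum of two objects of `Mod_R`, as a bicone. -/
def prodBicone (M N : ModR k R) : BinaryBicone M N where
  pt := prodModR M N
  fst := ObjectProperty.homMk (EquivariantModule.Hom.mk (M := (prodModR M N).obj)
    (LinearMap.fst R M.obj.carrier N.obj.carrier) fun _ _ => rfl)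
  snd := ObjectProperty.homMk (EquivariantModule.Hom.mk (M := (prodModR M N).obj)
    (LinearMap.snd R M.obj.carrier N.obj.carrier) fun _ _ => rfl)
  inl := ObjectProperty.homMk (EquivariantModule.Hom.mk (N := (prodModR M N).obj)
    (LinearMap.inl R M.obj.carrier N.obj.carrier)
    fun g _ => Prod.ext rfl (map_zero (N.obj.ρ g)).symm)
  inr := ObjectProperty.homMk (EquivariantModule.Hom.mk (N := (prodModR M N).obj)
    (LinearMap.inr R M.obj.carrier N.obj.carrier)
    fun g _ => Prod.ext (map_zero (M.obj.ρ g)).symm rfl)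
  inl_fst := rfl
  inl_snd := rfl
  inr_fst := rfl
  inr_snd := rfl

instance : HasBinaryBiproducts (ModR k R) where
  has_binary_biproduct M N := HasBinaryBiproduct.mk
    { bicone := prodBicone M N
      isBilimit := isBinaryBilimitOfTotal _ (ObjectProperty.hom_ext _
        (EquivariantModule.hom_ext (LinearMap.ext fun m =>
          Prod.ext (add_zero m.1) (zero_add m.2)))) }

/-- The zero object of `Mod_R`. -/
def zeroModR : ModR k R where
  obj := { carrier := PUnit.{u + 1}, ρ := 1, ρ_smul := fun _ _ _ => rfl }
  property := isPolynomial_of_forall_isPolynomialVector fun _ => isPolynomialVector_zero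

instance : HasZeroObject (ModR k R) :=
  ⟨zeroModR, (IsZero.iff_id_eq_zero _).2 rfl⟩

instance : HasFiniteProducts (ModR k R) :=
  have : HasTerminal (ModR k R) := HasZeroObject.hasTerminal
  hasFiniteProducts_of_has_binary_and_terminal

/-- The kernel of a morphism of `Mod_R`. -/
def kerModR {M N : ModR k R} (f : M ⟶ N) : ModR k R where
  obj := M.obj.sub (LinearMap.ker f.hom.lin) (EquivariantModule.ker_stable f.hom)
  property := isPolynomial_sub M.property _ _

/-- The inclusion of the kernel of a morphism of `Mod_R`. -/
def kerModRι {M N : ModR k R} (f : M ⟶ N) : kerModR f ⟶ M :=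
  ObjectProperty.homMk (EquivariantModule.subι _ _)

lemma kerModRι_comp {M N : ModR k R} (f : M ⟶ N) : kerModRι f ≫ f = 0 :=
  ObjectProperty.hom_ext _ (EquivariantModule.hom_ext (LinearMap.ext fun m => m.2))

/-- The kernel of a morphism of `Mod_R` is a limit. -/
def kerModRIsLimit {M N : ModR k R} (f : M ⟶ N) :
    IsLimit (KernelFork.ofι (kerModRι f) (kerModRι_comp f)) :=
  KernelFork.IsLimit.ofι _ _
    (fun {L} g hg => ObjectProperty.homMk (EquivariantModule.Hom.mk (M := L.obj)
      (N := (kerModR f).obj)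
      (g.hom.lin.codRestrict (LinearMap.ker f.hom.lin) fun l =>
        show f.hom.lin (g.hom.lin l) = 0 from
          LinearMap.congr_fun (congrArg (fun h : L ⟶ N => h.hom.lin) hg) l)
      fun a l => Subtype.ext (g.hom.comm a l)))
    (fun _ _ => rfl)
    (fun g hg m hm => by
      subst hm
      rfl)

instance : HasKernels (ModR k R) where
  has_limit f := ⟨_, kerModRIsLimit f⟩

instance : HasEqualizers (ModR k R) := Preadditive.hasEqualizers_of_hasKernels

end Biproducts

/-! ### Left exactness of the fiber functor at a generic point. -/

section Exactness

open Limits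

variable {k : Type u} [Field k] {R : Type u} [CommRing R] [Algebra k R]
  [MulSemiringAction (GLInf k) R] [IsGLAlgebra k R]

section Additive

variable (x : R →ₐ[k] k)

instance : (fiberFunctor x).Additive where
  map_add {M N f g} := ModuleCat.hom_ext (LinearMap.ext fun v => by
    obtain ⟨m, rfl⟩ := Submodule.Quotient.mk_surjective _ v
    rfl)

instance : (fiberFunctor x).Linear k where
  map_smul f c := ModuleCat.hom_ext (LinearMap.ext fun v => by
    obtain ⟨m, rfl⟩ := Submodule.Quotient.mk_surjective _ v
    rfl)

end Additive

variable [IsDomain R] [CharZero k] {x : R →ₐ[k] k}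

lemma fiberMap_kerModRι_injective (hx : IsGLGeneric k (kPoint x)) {M N : ModR k R} (f : M ⟶ N) :
    Function.Injective (fiberMap x (kerModRι f).hom.lin) := by
  refine (injective_iff_map_eq_zero _).2 fun v hv => ?_
  obtain ⟨p, rfl⟩ := Submodule.Quotient.mk_surjective _ v
  obtain ⟨p', hp', h⟩ := exists_eq_of_mem_smul_top hx M.property (kerModRι f).hom
    ((Submodule.Quotient.mk_eq_zero _).1 hv)
  have h1 : p' = p := (LinearMap.ker f.hom.lin).subtype_injective h
  exact (Submodule.Quotient.mk_eq_zero _).2 (h1 ▸ hp')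

lemma fiberMap_kerModRι_exact (hx : IsGLGeneric k (kPoint x)) {M N : ModR k R} (f : M ⟶ N) :
    Function.Exact (fiberMap x (kerModRι f).hom.lin) (fiberMap x f.hom.lin) := by
  intro v
  constructor
  · intro hv
    obtain ⟨m, rfl⟩ := Submodule.Quotient.mk_surjective _ v
    obtain ⟨m', hm', h⟩ := exists_eq_of_mem_smul_top hx N.property f.hom
      ((Submodule.Quotient.mk_eq_zero _).1 hv)
    have hd : m - m' ∈ LinearMap.ker f.hom.lin := by
      rw [LinearMap.mem_ker, map_sub, h, sub_self]
    refine ⟨Submodule.Quotient.mk (⟨m - m', hd⟩ : LinearMap.ker f.hom.lin),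
      (Submodule.Quotient.eq _).2 ?_⟩
    change m - m' - m ∈ _
    rw [sub_sub_cancel_left]
    exact Submodule.neg_mem _ hm'
  · rintro ⟨v, rfl⟩
    obtain ⟨p, rfl⟩ := Submodule.Quotient.mk_surjective _ v
    have h : f.hom.lin p.1 = 0 := p.2
    exact congrArg (Submodule.Quotient.mk (p := (RingHom.ker x • ⊤ : Submodule R N.obj.carrier))) h

/-- An additive functor that preserves kernels preserves finite limits; kernels are handled by
exactness at x. -/
lemma preservesFiniteLimits_fiberFunctor (hx : IsGLGeneric k (kPoint x)) :
    PreservesFiniteLimits (fiberFunctor x) := by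
  have hker : ∀ {M N : ModR k R} (f : M ⟶ N),
      PreservesLimit (parallelPair f 0) (fiberFunctor x) := fun {M N} f => by
    refine preservesLimit_of_preserves_limit_cone (kerModRIsLimit f) ?_
    refine (isLimitMapConeForkEquiv' (fiberFunctor x) (kerModRι_comp f)).symm ?_
    exact ModuleCat.isLimitKernelFork _ _ (fiberMap_kerModRι_exact hx f)
      (fiberMap_kerModRι_injective hx f)
  exact Functor.preservesFiniteLimits_of_preservesKernels _

end Exactness

/-! ### Compatibility with the symmetries. -/

section Braided

open Functor.LaxMonoidal

/-- On objects in the image of L the compatibility is transported from G and L through the monoidal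
isomorphism e; essential surjectivity and naturality extend it to all objects. -/
lemma braided_of_comp {C D E : Type*} [Category* C] [Category* D] [Category* E]
    [MonoidalCategory C] [MonoidalCategory D] [MonoidalCategory E]
    [BraidedCategory C] [BraidedCategory D] [BraidedCategory E]
    (L : C ⥤ D) [L.Braided] [L.EssSurj] (F : D ⥤ E) [F.Monoidal] (G : C ⥤ E) [G.Braided]
    (e : L ⋙ F ≅ G) [NatTrans.IsMonoidal e.hom] (X Y : D) :
    μ F X Y ≫ F.map (β_ X Y).hom = (β_ (F.obj X) (F.obj Y)).hom ≫ μ F Y X := by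
  have h1 : ∀ M N : C, μ F (L.obj M) (L.obj N) ≫ F.map (β_ (L.obj M) (L.obj N)).hom =
      (β_ _ _).hom ≫ μ F (L.obj N) (L.obj M) := fun M N => by
    have hμ : ∀ M N : C, μ F (L.obj M) (L.obj N) ≫ F.map (μ L M N) ≫ e.hom.app (M ⊗ N) =
        (e.hom.app M ⊗ₘ e.hom.app N) ≫ μ G M N := fun M N => by
      have := NatTrans.IsMonoidal.tensor (τ := e.hom) M N
      rwa [Functor.LaxMonoidal.comp_μ, Category.assoc] at this
    have hiso : IsIso (F.map (μ L N M) ≫ e.hom.app (N ⊗ M)) := inferInstance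
    rw [← cancel_mono (F.map (μ L N M) ≫ e.hom.app (N ⊗ M)), Category.assoc, Category.assoc, hμ,
      ← F.map_comp_assoc, ← Functor.LaxBraided.braided, F.map_comp, Category.assoc]
    have hn : F.map (L.map (β_ M N).hom) ≫ e.hom.app (N ⊗ M) =
      e.hom.app (M ⊗ N) ≫ G.map (β_ M N).hom := e.hom.naturality (β_ M N).hom
    rw [hn, reassoc_of% (hμ M N), Functor.LaxBraided.braided]
    exact (BraidedCategory.braiding_naturality_assoc (e.hom.app M) (e.hom.app N) (μ G N M))
  let i := L.objObjPreimageIso X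
  let j := L.objObjPreimageIso Y
  rw [← cancel_epi (F.map i.hom ⊗ₘ F.map j.hom), μ_natural_assoc, ← F.map_comp,
    BraidedCategory.braiding_naturality, F.map_comp, reassoc_of% h1,
    BraidedCategory.braiding_naturality_assoc, μ_natural]

end Braided

section Instances

variable {k : Type u} [Field k] {R : Type u} [CommRing R] [Algebra k R]
  [MulSemiringAction (GLInf k) R] [IsGLAlgebra k R]

section Extension

variable (K : Type u) [Field K] [Algebra k K] [MulSemiringAction (GLInf k) K] [IsGLField k K]
  [Algebra R K] [IsScalarTower k R K] [SMulDistribClass (GLInf k) R K]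

lemma extendTensorIso_braiding (M N : EquivariantModule k (GLInf k) R) :
    (extendTensorIso K M N).hom ≫ (β_ (extendObj K M) (extendObj K N)).hom =
      (extendFunctor K).map (β_ M N).hom ≫ (extendTensorIso K N M).hom :=
  EquivariantModule.hom_ext (baseChange_ext₂ K fun _ _ => rfl)

/-- Extension of scalars is symmetric monoidal. -/
abbrev extendModRBraided : (extendModR (k := k) (R := R) K).Braided where
  braided M N := ObjectProperty.hom_ext _
    -- The tensorator is the inverse of `extendTensorIso`, so the required square is the inverse of
    -- the one already checked.
    (CommSq.horiz_inv (f := (extendCoreMonoidal K).μIso M.obj N.obj |>.symm)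
      (i := (extendCoreMonoidal K).μIso N.obj M.obj |>.symm)
      ⟨extendTensorIso_braiding K M.obj N.obj⟩).w

instance : (polFunctor k R K).Additive where
  map_add := rfl

instance : (polFunctor k R K).Linear k where
  map_smul _ _ := rfl

end Extension

variable (x : R →ₐ[k] k)

/-- The functor `M ↦ M/𝔪M` is symmetric monoidal. -/
abbrev fiberFunctorBraided : (fiberFunctor x).Braided where
  braided M N := ModuleCat.hom_ext (TensorProduct.ext' fun v w => by
    obtain ⟨m, rfl⟩ := Submodule.Quotient.mk_surjective _ v
    obtain ⟨n, rfl⟩ := Submodule.Quotient.mk_surjective _ w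
    rfl)

end Instances

/-! ### The fiber functor on Mod_K. -/

section GenericFiber

open Limits

variable {k : Type u} [Field k] {R : Type u} [CommRing R] [Algebra k R]
  [MulSemiringAction (GLInf k) R] [IsGLAlgebra k R]
  (K : Type u) [Field K] [Algebra k K] [MulSemiringAction (GLInf k) K] [IsGLField k K]
  [Algebra R K] [IsScalarTower k R K] [SMulDistribClass (GLInf k) R K]

/-- The functor `Mod_K ⥤ Vec_k` given by the fiber of the module of polynomial vectors. -/
def genericFiber (x : R →ₐ[k] k) : ModK k K ⥤ ModuleCat.{u} k :=
  polFunctor k R K ⋙ fiberFunctor x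

instance (x : R →ₐ[k] k) : (genericFiber K x).Additive :=
  inferInstanceAs (polFunctor k R K ⋙ fiberFunctor x).Additive

instance (x : R →ₐ[k] k) : (genericFiber K x).Linear k :=
  inferInstanceAs ((polFunctor k R K ⋙ fiberFunctor x).Linear k)

variable {K} in
set_option linter.unusedSectionVars false in
lemma polFunctor_eq_zero_of_smul_eq_zero [IsFractionRing R K] (N : ModK k K) (r : R)
    (n : ((polFunctor k R K).obj N).obj.carrier) (h : r • n = 0) : r = 0 ∨ n = 0 := by
  have h1 : algebraMap R K r • (show N.obj.carrier from n.1) = 0 := congrArg Subtype.val h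
  rcases smul_eq_zero.1 h1 with h1 | h1
  · exact Or.inl ((IsFractionRing.to_map_eq_zero_iff (K := K)).1 h1)
  · exact Or.inr (Subtype.ext h1)

variable [IsDomain R] [CharZero k] {x : R →ₐ[k] k}

/-- Taking polynomial vectors is a right adjoint, and the fiber at x is left exact. -/
lemma preservesFiniteLimits_genericFiber (hx : IsGLGeneric k (kPoint x)) :
    PreservesFiniteLimits (genericFiber K x) := by
  have h1 : PreservesLimitsOfSize.{0, 0} (polFunctor k R K) :=
    (extendPolAdjunction k R K).rightAdjoint_preservesLimits
  have h2 : PreservesFiniteLimits (polFunctor k R K) :=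
    PreservesLimitsOfSize.preservesFiniteLimits _
  have h3 := preservesFiniteLimits_fiberFunctor hx
  exact comp_preservesFiniteLimits _ _

variable [IsFractionRing R K]

instance : (extendModR (k := k) (R := R) K).EssSurj :=
  Localization.essSurj _ (genericIso k R K)

/-- The functor `genericFiber` extends the fiber functor on `Mod_R` along extension of scalars. -/
def genericFiberIso (hx : IsGLGeneric k (kPoint x)) :
    extendModR K ⋙ genericFiber K x ≅ fiberFunctor x :=
  -- As the counit is invertible, `extendModR` inverts the unit M → (K ⊗ M)^pol, and hence so does
  -- the fiber at x.
  have : ∀ M : ModR k R, IsIso ((fiberFunctor x).map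
      ((extendPolAdjunction k R K).unit.app M)) := fun M =>
    genericIso_isInvertedBy (K := K) hx _ (by
      change IsIso ((extendModR K).map ((extendPolAdjunction k R K).unit.app M))
      infer_instance)
  (NatIso.ofComponents (F := fiberFunctor x) (G := extendModR K ⋙ genericFiber K x)
    (fun M => @asIso _ _ _ _ ((fiberFunctor x).map ((extendPolAdjunction k R K).unit.app M))
      (this M)) fun {M N} f => by
      change (fiberFunctor x).map f ≫ (fiberFunctor x).map _ =
        (fiberFunctor x).map _ ≫ (fiberFunctor x).map ((polFunctor k R K).map ((extendModR K).map f))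
      rw [← Functor.map_comp, ← Functor.map_comp]
      exact congrArg (fiberFunctor x).map ((extendPolAdjunction k R K).unit.naturality f)).symm

/-- The isomorphism `genericFiberIso`, as a lifting along the localization `Mod_R ⥤ Mod_K`. -/
abbrev genericFiberLifting (hx : IsGLGeneric k (kPoint x)) :
    Localization.Lifting (extendModR K) (genericIso k R K) (fiberFunctor x) (genericFiber K x) :=
  ⟨genericFiberIso K hx⟩

/-- The monoidal structure of `genericFiber`. -/
abbrev genericFiberMonoidal (hx : IsGLGeneric k (kPoint x)) : (genericFiber K x).Monoidal :=
  letI := genericFiberLifting K hx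
  Localization.Monoidal.functorMonoidalOfComp (extendModR K) (genericIso k R K)
    (genericFiber K x) (fiberFunctor x)

lemma genericFiberIso_isMonoidal (hx : IsGLGeneric k (kPoint x)) :
    letI := genericFiberMonoidal K hx
    NatTrans.IsMonoidal (genericFiberIso K hx).hom :=
  letI := genericFiberLifting K hx
  Localization.Monoidal.lifting_isMonoidal (extendModR K) (genericIso k R K)
    (genericFiber K x) (fiberFunctor x)

/-- The functor `genericFiber` is symmetric monoidal. -/
abbrev genericFiberBraided (hx : IsGLGeneric k (kPoint x)) : (genericFiber K x).Braided :=
  letI := genericFiberMonoidal K hx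
  { braided := fun M N =>
      haveI := genericFiberIso_isMonoidal K hx
      letI := extendModRBraided (k := k) (R := R) K
      letI := fiberFunctorBraided x
      braided_of_comp (extendModR K) (genericFiber K x) (fiberFunctor x) (genericFiberIso K hx) M N }

/-- The functor `genericFiber` has a right adjoint. -/
def genericFiberAdjunction (hx : IsGLGeneric k (kPoint x)) :
    genericFiber K x ⊣ coindFunctor x ⋙ extendModR K :=
  -- The adjunction of `fiberFunctor` with `coindFunctor` is localized on the side of Mod_R only;
  -- Vec_k is regarded as its own localization at the isomorphisms.
  letI : CatCommSq (fiberFunctor x) (extendModR K) (𝟭 _) (genericFiber K x) :=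
    ⟨Functor.rightUnitor _ ≪≫ (genericFiberIso K hx).symm⟩
  letI : CatCommSq (coindFunctor x) (𝟭 _) (extendModR K) (coindFunctor x ⋙ extendModR K) :=
    ⟨(Functor.leftUnitor _).symm⟩
  (fiberCoindAdjunction x).localization (extendModR K) (genericIso k R K) (𝟭 _)
    (MorphismProperty.isomorphisms _) (genericFiber K x) (coindFunctor x ⋙ extendModR K)

variable {K}

/-- By exactness the fiber of the image of f embeds into that of N, hence it is zero; the image is
torsion-free, so it vanishes. -/
lemma eq_zero_of_fiberMap_eq_zero (hx : IsGLGeneric k (kPoint x)) {M N : ModR k R} (f : M ⟶ N)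
    (hN : ∀ (r : R) (n : N.obj.carrier), r • n = 0 → r = 0 ∨ n = 0)
    (h : fiberMap x f.hom.lin = 0) : f = 0 := by
  let I := LinearMap.range f.hom.lin
  let I' := N.obj.sub I (EquivariantModule.range_stable f.hom)
  have htop : (RingHom.ker x • ⊤ : Submodule R I'.carrier) = ⊤ := by
    refine eq_top_iff.2 ?_
    rintro ⟨_, m, rfl⟩ -
    have h1 : f.hom.lin m ∈ (RingHom.ker x • ⊤ : Submodule R N.obj.carrier) :=
      (Submodule.Quotient.mk_eq_zero _).1 (LinearMap.congr_fun h (Submodule.Quotient.mk m))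
    obtain ⟨i, hi, h2⟩ := exists_eq_of_mem_smul_top hx N.property
      (EquivariantModule.subι I (EquivariantModule.range_stable f.hom))
      (m := ⟨f.hom.lin m, m, rfl⟩) h1
    exact I.subtype_injective h2 ▸ hi
  have hzero := eq_zero_of_smul_top_eq_top (M := I') hx
    (isPolynomial_sub N.property I _) (fun r i hi =>
      (hN r i.1 (congrArg Subtype.val hi)).imp_right fun h => Subtype.ext h) htop
  exact ObjectProperty.hom_ext _ (EquivariantModule.hom_ext (LinearMap.ext fun m =>
    congrArg Subtype.val (hzero ⟨f.hom.lin m, m, rfl⟩)))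

/-- `polFunctor` is fully faithful with torsion-free values, so the vanishing criterion applies to a
difference of two morphisms. -/
lemma genericFiber_faithful (hx : IsGLGeneric k (kPoint x)) : (genericFiber K x).Faithful where
  map_injective {M N f g} h := by
    apply (polFunctor k R K).map_injective
    rw [← sub_eq_zero, ← Functor.map_sub]
    refine eq_zero_of_fiberMap_eq_zero hx _ (polFunctor_eq_zero_of_smul_eq_zero N) ?_
    have h1 : (genericFiber K x).map (f - g) = 0 := by
      rw [Functor.map_sub, h, sub_self]
    exact congrArg ModuleCat.Hom.hom h1

lemma genericFiber_isFiberFunctor (hx : IsGLGeneric k (kPoint x)) :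
    letI := genericFiberBraided K hx
    IsFiberFunctor (genericFiber K x) :=
  letI := genericFiberBraided K hx
  { preservesFiniteLimits := preservesFiniteLimits_genericFiber K hx
    preservesFiniteColimits :=
      have : PreservesColimitsOfSize.{0, 0} (genericFiber K x) :=
        (genericFiberAdjunction K hx).leftAdjoint_preservesColimits
      PreservesColimitsOfSize.preservesFiniteColimits _
    faithful := genericFiber_faithful hx
    preservesColimits := (genericFiberAdjunction K hx).leftAdjoint_preservesColimits
    additive := inferInstance
    linear := inferInstance }

end GenericFiber

/-- Both F and F' lift G along the localization L. The identity of G lifts uniquely to an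
isomorphism between them, since natural transformations out of D are determined on the image of L.
-/
lemma existsUnique_iso_of_isLocalization {C D E : Type*} [Category* C] [Category* D] [Category* E]
    (L : C ⥤ D) (W : MorphismProperty C) [L.IsLocalization W] {G : C ⥤ E} {F F' : D ⥤ E}
    (e : L ⋙ F ≅ G) (e' : L ⋙ F' ≅ G) :
    ∃! α : F ≅ F', Functor.isoWhiskerLeft L α ≪≫ e' = e := by
  let _ : Localization.Lifting L W G F := ⟨e⟩
  let _ : Localization.Lifting L W G F' := ⟨e'⟩
  have h : ∀ X, (Localization.liftNatTrans L W G G F F' (𝟙 G)).app (L.obj X) =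
      e.hom.app X ≫ e'.inv.app X := fun X => by
    rw [Localization.liftNatTrans_app, NatTrans.id_app, Category.id_comp]
    rfl
  refine ⟨Localization.liftNatIso L W G G F F' (Iso.refl G), ?_, fun β hβ => ?_⟩
  · refine Iso.ext (NatTrans.ext (funext fun X => ?_))
    change (Localization.liftNatTrans L W G G F F' (𝟙 G)).app (L.obj X) ≫ e'.hom.app X = _
    rw [h, Category.assoc, Iso.inv_hom_id_app, Category.comp_id]
  · refine Iso.ext (Localization.natTrans_ext L W fun X => ?_)
    refine Eq.trans ?_ (h X).symm
    rw [← Iso.app_inv, Iso.eq_comp_inv]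
    exact congrArg (fun i : L ⋙ F ≅ G => i.hom.app X) hβ

end GLRep

end

theorem mainTheorem12 {k : Type u} [Field k] [CharZero k]
    {R : Type u} [CommRing R] [IsDomain R] [Algebra k R] [MulSemiringAction (GLRep.GLInf k) R]
    [GLRep.IsGLAlgebra k R] (hR : GLRep.IsFinitelyGLGenerated k R)
    {K : Type u} [Field K] [Algebra k K] [MulSemiringAction (GLRep.GLInf k) K]
    [GLRep.IsGLField k K]
    (hK : ∀ a : K, (∀ g : GLRep.GLInf k, g • a = a) → a ∈ Set.range (algebraMap k K))
    [Algebra R K] [IsScalarTower k R K] [IsFractionRing R K]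
    [SMulDistribClass (GLRep.GLInf k) R K]
    (x : R →ₐ[k] k) (hx : GLRep.IsGLGeneric k (GLRep.kPoint x)) :
    ∃ (Φ : GLRep.ModK k K ⥤ ModuleCat.{u} k) (_ : Φ.Braided)
      (e : GLRep.extendModR K ⋙ Φ ≅ GLRep.fiberFunctor x),
      GLRep.IsFiberFunctor Φ ∧ NatTrans.IsMonoidal e.hom ∧
      ∀ (Φ' : GLRep.ModK k K ⥤ ModuleCat.{u} k)
        (e' : GLRep.extendModR K ⋙ Φ' ≅ GLRep.fiberFunctor x),
        ∃! α : Φ ≅ Φ', Functor.isoWhiskerLeft (GLRep.extendModR K) α ≪≫ e' = e :=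
  ⟨GLRep.genericFiber K x, GLRep.genericFiberBraided K hx, GLRep.genericFiberIso K hx,
    GLRep.genericFiber_isFiberFunctor hx, GLRep.genericFiberIso_isMonoidal K hx, fun _ e' =>
      GLRep.existsUnique_iso_of_isLocalization (GLRep.extendModR K) (GLRep.genericIso k R K)
        (GLRep.genericFiberIso K hx) e'⟩
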